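/- For every constant $d\in\mathbb N$ there is a randomized word-RAM algorithm with the following property. Given an $n$-node, $m$-edge undirected unweighted (simple) graph $G$ with $n\ge 1$ and $n\le 2m$ (for instance, any nonempty graph without isolated vertices), as a list of its edges, and an integer $k\ge 2$, the algorithm computes, with probability at least $1-n^{-d}$ and within $\tilde O\bigl(m^{2-2/k}n^{1/k}\bigr)$ steps, for every vertex $v$ an estimate $\hat c_v$ such that $$SC(v)\;\le\;\hat c_v\;\le\;SC(v)+2\left\lceil\frac{SC(v)}{2(k-1)}\right\rceil .$$ Here $SC(v)$ is the length of a shortest simple cycle containing $v$ (and $SC(v)=\hat c_v=\infty$ if there is none). The bound $\tilde O(f)$ means at most $C(\log n)^{b}f$, with constants $C,b$ that depend only on $d$ (not on $k$). The machine has words of at least $a\log_2 n$ bits, for a constant $a$ depending only on $d$, that can also hold $k$; standard arithmetic, bitwise and comparison operations on words, memory accesses and the drawing of a uniformly random word take one step each. -/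

import Mathlib

open scoped ENNReal

/-! ### A randomized word RAM

A machine with `w`-bit words has registers indexed by `ℕ` (a program, being a finite object, mentions
finitely many of them) and a memory of `2 ^ w` words, addressed by words. Programs are structured
(sequencing, branching, loops); every elementary instruction, every branch and every loop test takes
one step. A program does not depend on the word length. -/

namespace WordRAM

/-- The arithmetic, bitwise and comparison operations on words, each taking one step. -/
inductive BinOp where
  | add | sub | mul | div | mod | and | or | xor | shl | shr | lt | eq

/-- Unsigned arithmetic modulo `2 ^ w`; comparisons return `1` or `0`. -/
def BinOp.eval {w : ℕ} (o : BinOp) (x y : BitVec w) : BitVec w :=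
  match o with
  | .add => x + y
  | .sub => x - y
  | .mul => x * y
  | .div => x / y
  | .mod => x % y
  | .and => x &&& y
  | .or => x ||| y
  | .xor => x ^^^ y
  | .shl => x <<< y
  | .shr => x >>> y
  | .lt => if x < y then 1 else 0
  | .eq => if x = y then 1 else 0

/-- Programs. -/
inductive Program where
  /-- do nothing -/
  | skip : Program
  /-- `R[r] := c` (reduced modulo `2 ^ w`) -/
  | const (r c : ℕ) : Program
  /-- `R[r] := R[a] o R[b]` -/
  | op (o : BinOp) (r a b : ℕ) : Program
  /-- `R[r] := M[R[a]]` -/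
  | load (r a : ℕ) : Program
  /-- `M[R[a]] := R[b]` -/
  | store (a b : ℕ) : Program
  /-- `R[r] :=` a fresh uniformly random word -/
  | rand (r : ℕ) : Program
  /-- first `p`, then `q` -/
  | seq (p q : Program) : Program
  /-- if `R[r] ≠ 0` then `p` else `q` -/
  | ite (r : ℕ) (p q : Program) : Program
  /-- while `R[r] ≠ 0` do `p` -/
  | loop (r : ℕ) (p : Program) : Program

/-- The contents of the registers and of the memory. -/
structure State (w : ℕ) where
  reg : ℕ → BitVec w
  mem : BitVec w → BitVec w

namespace State

variable {w : ℕ}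

/-- Assign the value `x` to register `r`. -/
def setReg (s : State w) (r : ℕ) (x : BitVec w) : State w :=
  { s with reg := Function.update s.reg r x }

/-- Write the value `x` to the memory word with address `a`. -/
def setMem (s : State w) (a x : BitVec w) : State w :=
  { s with mem := Function.update s.mem a x }

end State

/-- A configuration: the list of programs that remain to be executed, one after the other, and the
current state. The machine has halted when the list is empty. -/
abbrev Config (w : ℕ) := List Program × State w

/-- One step of the machine, as a probability distribution on the next configuration.
A halted configuration does not change any more. -/
noncomputable def step {w : ℕ} : Config w → PMF (Config w)
  | ([], s) => PMF.pure ([], s)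
  | (.skip :: K, s) => PMF.pure (K, s)
  | (.const r c :: K, s) => PMF.pure (K, s.setReg r (BitVec.ofNat w c))
  | (.op o r a b :: K, s) => PMF.pure (K, s.setReg r (o.eval (s.reg a) (s.reg b)))
  | (.load r a :: K, s) => PMF.pure (K, s.setReg r (s.mem (s.reg a)))
  | (.store a b :: K, s) => PMF.pure (K, s.setMem (s.reg a) (s.reg b))
  | (.rand r :: K, s) =>
      (PMF.uniformOfFintype (Fin (2 ^ w))).map fun x => (K, s.setReg r (BitVec.ofFin x))
  | (.seq p q :: K, s) => PMF.pure (p :: q :: K, s)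
  | (.ite r p q :: K, s) => PMF.pure (if s.reg r ≠ 0 then p :: K else q :: K, s)
  | (.loop r p :: K, s) =>
      PMF.pure (if s.reg r ≠ 0 then p :: .loop r p :: K else K, s)

/-- The distribution of the configuration after `t` steps. -/
noncomputable def run {w : ℕ} : ℕ → Config w → PMF (Config w)
  | 0, c => PMF.pure c
  | t + 1, c => (step c).bind (run t)

/-- The initial state: the input is stored in the memory words `0, 1, 2, …`; everything else is `0`. -/
def initial (w : ℕ) (input : List ℕ) : State w where
  reg := fun _ => 0
  mem := fun a => BitVec.ofNat w (input.getD a.toNat 0)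

/-- The probability that the program `P`, started on the given input on a machine with `w`-bit words,
has halted after at most `t` steps in a state that satisfies `good`. -/
noncomputable def successProb (P : Program) (w : ℕ) (input : List ℕ) (t : ℕ)
    (good : State w → Prop) : ℝ≥0∞ :=
  (run t ([P], initial w input)).toOuterMeasure {c | c.1 = [] ∧ good c.2}

end WordRAM

/-! ### All-nodes shortest cycles -/

namespace ANSC

/-- The length `SC(v)` of a shortest (simple) cycle through `v`, and `⊤` if there is none. -/
noncomputable def shortestCycle {V : Type*} (G : SimpleGraph V) (v : V) : ℕ∞ :=
  ⨅ (p : G.Walk v v) (_ : p.IsCycle), (p.length : ℕ∞)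

/-- `es` lists every edge of `G` exactly once, in an arbitrary order, with arbitrary orientations. -/
def IsEdgeList {n : ℕ} (G : SimpleGraph (Fin n)) (es : List (Fin n × Fin n)) : Prop :=
  (es.map fun e => s(e.1, e.2)).Nodup ∧
    ∀ e : Sym2 (Fin n), e ∈ es.map (fun e => s(e.1, e.2)) ↔ e ∈ G.edgeSet

/-- The input `n, m, k, u₁, v₁, …, uₘ, vₘ` for the graph with vertices `0, …, n - 1` and edges
`uᵢvᵢ`, and the parameter `k`. -/
def input (n k : ℕ) (es : List (Fin n × Fin n)) : List ℕ :=
  [n, es.length, k] ++ es.flatMap fun e => [(e.1 : ℕ), (e.2 : ℕ)]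

/-- The estimate for the vertex `v` that is read off a final state: the content of the memory word
`v`, where `0` (which is not the length of a cycle) stands for infinity. -/
def estimate {w n : ℕ} (s : WordRAM.State w) (v : Fin n) : ℕ∞ :=
  if s.mem (BitVec.ofNat w v) = 0 then ⊤ else ((s.mem (BitVec.ofNat w v)).toNat : ℕ∞)

/-- `SC(v) ≤ c v ≤ SC(v) + 2⌈SC(v) / (2(k - 1))⌉` for all `v`. Where `SC(v) = ∞`, this says that
`c v = ∞`. -/
def IsApprox {V : Type*} (G : SimpleGraph V) (k : ℕ) (c : V → ℕ∞) : Prop :=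
  ∀ v, shortestCycle G v ≤ c v ∧
    ∀ ℓ : ℕ, shortestCycle G v = (ℓ : ℕ∞) →
      c v ≤ ((ℓ + 2 * ⌈(ℓ : ℝ) / (2 * ((k : ℝ) - 1))⌉₊ : ℕ) : ℕ∞)

end ANSC

/-! Fix a threshold `A` of about `(m²/n)^(1/k)` and call the ball of radius `r` around `x` dense if
at least `A` directed edges ("slots") start in it (`Dense`). For a shortest cycle `C` through `v`,
of length `ℓ`, put `ρ = ⌈ℓ / (2(k-1))⌉`. There are two cases (`est_le_of_cycle`).

Some vertex `x` of `C` is dense at radius `ρ - 1`. A random slot starts in this ball with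
probability at least `A / (4m)`, so about `m/A` random slots, times a logarithm, hit all dense balls
with high probability (`prob_not_hit_le`, `union_bound`, `one_le_haltProb_random_loop`). Take a
breadth-first search tree whose root is at distance at most `r` from `x`. Every vertex of `C` is on
the fundamental cycle of some non-tree edge `ab` of `C`, and `D a + D b + 1 ≤ ℓ + 2r`: go from the
root to `x`, then around `C` in both directions to `a` and to `b` (`IsBFSTree.exists_fundamental`).
So it suffices to give every vertex the minimum of `D a + D b + 1` over the fundamental cycles
through it. This is never below `SC`, because a fundamental cycle is a simple cycle of at most that
length (`cycleLe_of_side`, `cycleLe_of_top`). All minima together are found with jump pointers, as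
in a sparse table: the tree path of each edge is cut into logarithmically many pieces of lengths `2
^ j`, the weight is recorded at one table entry per piece, and at the end the table is pushed down
level by level (`ClimbInv`, `Cov.push`, `cover_spec`).

No vertex of `C` is dense at radius `ρ - 1`. Then a search from `v` that stops after `A` scanned
slots finds every slot that starts within distance `ρ - 1` of `v`. Repeating such bounded searches
from the endpoints found, for `h = k - 1` generations, advances by `ρ` along `C` in each generation,
so both halves of `C` are explored (`ExploreInv.cycleLe`). A full search from `v` in the explored
graph then makes the estimate exact.

The exploration around one vertex costs about `A^(k-1)`, hence `n A^(k-1) ≤ m²/A` for all vertices;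
the random searches cost about `m · m/A`. Both are of order `m^(2-2/k) n^(1/k)` up to logarithms
(`sq_le_timeBound_mul`, `Params.levels_le_timeBound`, `rounds_mul_le`). If `m² < n 2^k`, one takes
`A = 2m + 1`: nothing is dense, and one search from each vertex sees everything.

The algorithm is written in a small language on exact natural numbers with a clock, verified with
weakest preconditions, and compiled to the machine with constant slowdown (`Runs.compile_spec`).
Only the drawing of random words is treated on the machine itself. -/

namespace WordRAM

/-! ### Deterministic runs and success probabilities -/

/-- Started in state `s`, the program `P` deterministically ends in state `s'` after `t` steps. -/
def Det {w : ℕ} (P : Program) (s s' : State w) (t : ℕ) : Prop :=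
  ∀ (K : List Program) (T : ℕ), run (t + T) (P :: K, s) = run T (K, s')

section Det

variable {w : ℕ} {s s' s'' : State w} {p q : Program} {t t' : ℕ}

theorem run_succ_of_step {c c' : Config w} (h : step c = PMF.pure c') (T : ℕ) :
    run (1 + T) c = run T c' := by
  rw [add_comm, run, h, PMF.pure_bind]

theorem det_skip (s : State w) : Det .skip s s 1 := fun _ T => run_succ_of_step rfl T

theorem det_const (s : State w) (r c : ℕ) :
    Det (.const r c) s (s.setReg r (BitVec.ofNat w c)) 1 := fun _ T => run_succ_of_step rfl T

theorem det_op (s : State w) (o : BinOp) (r a b : ℕ) :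
    Det (.op o r a b) s (s.setReg r (o.eval (s.reg a) (s.reg b))) 1 :=
  fun _ T => run_succ_of_step rfl T

theorem det_load (s : State w) (r a : ℕ) :
    Det (.load r a) s (s.setReg r (s.mem (s.reg a))) 1 := fun _ T => run_succ_of_step rfl T

theorem det_store (s : State w) (a b : ℕ) :
    Det (.store a b) s (s.setMem (s.reg a) (s.reg b)) 1 := fun _ T => run_succ_of_step rfl T

theorem Det.seq (hp : Det p s s' t) (hq : Det q s' s'' t') : Det (.seq p q) s s'' (1 + (t + t')) := by
  intro K T
  rw [add_assoc, run_succ_of_step (c' := (p :: q :: K, s)) rfl, add_assoc, hp, hq]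

theorem Det.ite_pos {r : ℕ} (h : s.reg r ≠ 0) (hp : Det p s s' t) :
    Det (.ite r p q) s s' (1 + t) := by
  intro K T
  rw [add_assoc, run_succ_of_step (c' := (p :: K, s)) (by rw [step, if_pos h]), hp]

theorem Det.ite_neg {r : ℕ} (h : s.reg r = 0) (hq : Det q s s' t) :
    Det (.ite r p q) s s' (1 + t) := by
  intro K T
  rw [add_assoc, run_succ_of_step (c' := (q :: K, s)) (by simp [step, h]), hq]

theorem det_loop_done {r : ℕ} (h : s.reg r = 0) : Det (.loop r p) s s 1 := by
  intro K T
  rw [run_succ_of_step (c' := (K, s)) (by simp [step, h])]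

theorem Det.loop {r : ℕ} (h : s.reg r ≠ 0) (hp : Det p s s' t) (hq : Det (.loop r p) s' s'' t') :
    Det (.loop r p) s s'' (1 + (t + t')) := by
  intro K T
  rw [add_assoc, run_succ_of_step (c' := (p :: .loop r p :: K, s)) (by rw [step, if_pos h]), add_assoc,
    hp, hq]

end Det

/-- The probability to halt within `t` steps in a good state. -/
noncomputable def haltProb {w : ℕ} (good : State w → Prop) (t : ℕ) (c : Config w) : ℝ≥0∞ :=
  (run t c).toOuterMeasure {c | c.1 = [] ∧ good c.2}

section haltProb

variable {w : ℕ} {good : State w → Prop}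

theorem haltProb_succ (t : ℕ) (c : Config w) :
    haltProb good (t + 1) c = ∑' c', step c c' * haltProb good t c' := by
  simp only [haltProb, run, PMF.toOuterMeasure_bind_apply]

/-- A halted configuration is a fixed point of `step`, so success is never lost by waiting. -/
theorem haltProb_le_succ (t : ℕ) (c : Config w) : haltProb good t c ≤ haltProb good (t + 1) c := by
  induction t generalizing c with
  | zero =>
    by_cases hc : c.1 = [] ∧ good c.2
    · obtain ⟨l, s⟩ := c
      obtain ⟨rfl, h⟩ := hc
      have : run 1 (([], s) : Config w) = run 0 (([], s) : Config w) := by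
        simp [run, step]
      exact le_of_eq (by simp only [haltProb, zero_add, this])
    · have : haltProb good 0 c = 0 := by
        rw [haltProb, run, PMF.toOuterMeasure_pure_apply, if_neg]
        exact hc
      rw [this]; exact zero_le
  | succ t ih =>
    rw [haltProb_succ, haltProb_succ (t + 1)]
    exact ENNReal.tsum_le_tsum fun c' => mul_le_mul_right (ih c') _

theorem haltProb_mono {t t' : ℕ} (h : t ≤ t') (c : Config w) :
    haltProb good t c ≤ haltProb good t' c := by
  induction h with
  | refl => exact le_rfl
  | step _ ih => exact ih.trans (haltProb_le_succ _ c)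

theorem Det.haltProb_le {p : Program} {s s' : State w} {t : ℕ} (h : Det p s s' t)
    (K : List Program) (T : ℕ) :
    haltProb good T (K, s') ≤ haltProb good (t + T) (p :: K, s) := by
  rw [haltProb, haltProb, h]

theorem haltProb_nil {s : State w} (h : good s) (T : ℕ) : 1 ≤ haltProb good T ([], s) := by
  refine le_trans ?_ (haltProb_mono (Nat.zero_le T) _)
  rw [haltProb, run, PMF.toOuterMeasure_pure_apply, if_pos]
  exact ⟨rfl, h⟩

theorem haltProb_seq (p q : Program) (K : List Program) (s : State w) (T : ℕ) :
    haltProb good (T + 1) (.seq p q :: K, s) = haltProb good T (p :: q :: K, s) := by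
  rw [haltProb, haltProb, add_comm, run_succ_of_step rfl]

theorem haltProb_rand (r : ℕ) (K : List Program) (s : State w) (T : ℕ) :
    haltProb good (T + 1) (.rand r :: K, s) =
      ∑ x : Fin (2 ^ w), ((2 : ℝ≥0∞) ^ w)⁻¹ * haltProb good T (K, s.setReg r (BitVec.ofFin x)) := by
  rw [haltProb, run, step, PMF.map, PMF.bind_bind, PMF.toOuterMeasure_bind_apply, tsum_fintype]
  refine Finset.sum_congr rfl fun x _ => ?_
  simp [haltProb, PMF.uniformOfFintype_apply]

/-- A loop that draws one random word in each round. The rounds serve to hit the targets `u`, each of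
which is hit by a fraction of at least `1 - ρ` of all words. -/
theorem one_le_haltProb_random_loop {ι : Type*} [DecidableEq ι] (hit : ι → Fin (2 ^ w) → Prop)
    [∀ u x, Decidable (hit u x)] (ρ : ℝ≥0∞) (ctr r τ t₀ : ℕ) (p : Program) (K : List Program)
    (I : ℕ → Finset ι → State w → Prop)
    (hctr : ∀ i U s, I i U s → (s.reg ctr ≠ 0 ↔ i ≠ 0))
    (hstep : ∀ i U s, I (i + 1) U s → ∀ x : Fin (2 ^ w), ∃ s' t, t ≤ τ ∧
      Det p (s.setReg r (BitVec.ofFin x)) s' t ∧ I i (U.filter fun u => ¬ hit u x) s')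
    (hend : ∀ s, I 0 ∅ s → 1 ≤ haltProb good t₀ (K, s))
    (hprob : ∀ u, ((2 : ℝ≥0∞) ^ w)⁻¹ * (Finset.univ.filter fun x => ¬ hit u x).card ≤ ρ)
    (i : ℕ) (U : Finset ι) (s : State w) (hs : I i U s) :
    1 ≤ haltProb good (i * (τ + 3) + (1 + t₀)) (.loop ctr (.seq (.rand r) p) :: K, s) +
      U.card * ρ ^ i := by
  -- The union bound in potential form: `U` holds the targets not hit so far, and the probability of
  -- failure is at most `U.card * ρ ^ i` with `i` rounds left.
  induction i generalizing U s with
  | zero =>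
    rcases U.eq_empty_or_nonempty with rfl | hU
    · have h0 : s.reg ctr = 0 := by
        by_contra h
        exact (hctr _ _ _ hs).1 h rfl
      refine le_trans ((hend s hs).trans ?_) le_self_add
      rw [zero_mul, zero_add]
      exact (det_loop_done h0).haltProb_le K t₀
    -- No rounds are left but a target is unhit: the bound is void because `U.card ≥ 1`.
    · refine le_trans ?_ le_add_self
      simp only [pow_zero, mul_one]
      exact_mod_cast hU.card_pos
  | succ i ih =>
    have h0 : s.reg ctr ≠ 0 := (hctr _ _ _ hs).2 (Nat.succ_ne_zero i)
    set q : Program := .loop ctr (.seq (.rand r) p) with hq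
    set T := i * (τ + 3) + (1 + t₀) with hT
    have e1 : haltProb good ((i + 1) * (τ + 3) + (1 + t₀)) (q :: K, s) =
        ∑ x : Fin (2 ^ w), ((2 : ℝ≥0∞) ^ w)⁻¹ *
          haltProb good (τ + T) (p :: q :: K, s.setReg r (BitVec.ofFin x)) := by
      have : (i + 1) * (τ + 3) + (1 + t₀) = 1 + (τ + T + 1 + 1) := by rw [hT]; ring
      rw [this, haltProb, run_succ_of_step (c' := (.seq (.rand r) p :: q :: K, s))
        (by rw [hq, step, if_pos h0])]
      rw [← haltProb, haltProb_seq, haltProb_rand]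
    have key : ∀ x : Fin (2 ^ w), 1 ≤
        haltProb good (τ + T) (p :: q :: K, s.setReg r (BitVec.ofFin x)) +
          (U.filter fun u => ¬ hit u x).card * ρ ^ i := by
      intro x
      obtain ⟨s', t, ht, hd, hI⟩ := hstep i U s hs x
      refine (ih _ _ hI).trans (add_le_add_left ?_ _)
      exact (hd.haltProb_le _ T).trans (haltProb_mono (by omega) _)
    have hW : ((2 : ℝ≥0∞) ^ w) ≠ 0 := by positivity
    have hW' : ((2 : ℝ≥0∞) ^ w) ≠ ⊤ := by finiteness
    -- Average the induction hypothesis over the random word; exchanging the sums over words and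
    -- targets shows that on average at most `U.card * ρ` targets survive the round.
    calc (1 : ℝ≥0∞) = ∑ x : Fin (2 ^ w), ((2 : ℝ≥0∞) ^ w)⁻¹ * 1 := by
            simp [ENNReal.mul_inv_cancel hW hW']
      _ ≤ ∑ x : Fin (2 ^ w), ((2 : ℝ≥0∞) ^ w)⁻¹ *
          (haltProb good (τ + T) (p :: q :: K, s.setReg r (BitVec.ofFin x)) +
          (U.filter fun u => ¬ hit u x).card * ρ ^ i) :=
            Finset.sum_le_sum fun x _ => mul_le_mul_right (key x) _
      _ = haltProb good ((i + 1) * (τ + 3) + (1 + t₀)) (q :: K, s) +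
          (∑ x : Fin (2 ^ w), ((2 : ℝ≥0∞) ^ w)⁻¹ * ((U.filter fun u => ¬ hit u x).card : ℝ≥0∞)) *
            ρ ^ i := by
            rw [e1, Finset.sum_mul, ← Finset.sum_add_distrib]
            exact Finset.sum_congr rfl fun x _ => by ring
      _ ≤ _ := by
            rw [pow_succ' ρ i, ← mul_assoc]
            refine add_le_add_right (mul_le_mul_left ?_ _) _
            have : ∀ x : Fin (2 ^ w), ((U.filter fun u => ¬ hit u x).card : ℝ≥0∞) =
                ∑ u ∈ U, if hit u x then 0 else 1 := by
              intro x
              rw [Finset.card_filter]; push_cast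
              exact Finset.sum_congr rfl fun u _ => by split_ifs <;> simp_all
            simp_rw [this]
            rw [← Finset.mul_sum, Finset.sum_comm, Finset.mul_sum, ← nsmul_eq_mul]
            refine Finset.sum_le_card_nsmul _ _ _ fun u _ => le_trans (le_of_eq ?_) (hprob u)
            rw [Finset.card_filter]; push_cast
            congr 1
            exact Finset.sum_congr rfl fun x _ => by split_ifs <;> simp_all

end haltProb

end WordRAM

set_option linter.constructorNameAsVariable false
set_option linter.unusedSimpArgs false

namespace WordRAM.HL

/-! ### A small imperative language with arrays of natural numbers -/

/-- Variables. -/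
inductive V where
  | n | m | k | A | h | Z | J | inf | st | cnt (g : Bool)
  | root | lim | qh | qt | c | p | y | i | j | a | b | w | v | eh | T | r
  deriving DecidableEq, Fintype

/-- Arrays; `low` is the part of the memory that holds the input and the output. -/
inductive Ar where
  | low | src (g : Bool) | tgt (g : Bool) | hd (g : Bool) | nx (g : Bool)
  | vis | D | up | Q | SL | M | est
  deriving DecidableEq, Fintype

/-- Machine states: variables, arrays, and the elapsed time. -/
structure St where
  v : V → ℕ
  a : Ar → ℕ → ℕ
  t : ℕ

/-- The word size `W = 2 ^ w`, the length of the array `low`, and the length of the other arrays. -/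
structure Bounds where
  W : ℕ
  N : ℕ
  cap : ℕ

/-- Expressions. -/
inductive Ex where
  | lit (c : ℕ)
  | var (x : V)
  | bin (o : BinOp) (e f : Ex)
  | rd (j : Ar) (e : Ex)

instance : Coe V Ex := ⟨Ex.var⟩
instance (c : ℕ) : OfNat Ex c := ⟨Ex.lit c⟩
instance : Add Ex := ⟨Ex.bin .add⟩
instance : Sub Ex := ⟨Ex.bin .sub⟩
instance : Mul Ex := ⟨Ex.bin .mul⟩
instance : Div Ex := ⟨Ex.bin .div⟩

/-- Commands. -/
inductive Cmd where
  | skip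
  | asg (x : V) (e : Ex)
  | st (j : Ar) (e f : Ex)
  | seq (c d : Cmd)
  | ite (e : Ex) (c d : Cmd)
  | whl (e : Ex) (c : Cmd)

infixr:60 " ;; " => Cmd.seq

/-- Exact evaluation of the operations that are used. -/
def opN : BinOp → ℕ → ℕ → ℕ
  | .add, x, y => x + y
  | .sub, x, y => x - y
  | .mul, x, y => x * y
  | .div, x, y => x / y
  | .lt, x, y => if x < y then 1 else 0
  | .eq, x, y => if x = y then 1 else 0
  | _, _, _ => 0

/-- The machine operation agrees with the exact one. -/
def opOk (W : ℕ) : BinOp → ℕ → ℕ → Prop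
  | .add, x, y => x + y < W
  | .sub, x, y => y ≤ x
  | .mul, x, y => x * y < W
  | .div, _, _ => True
  | .lt, _, _ => True
  | .eq, _, _ => True
  | _, _, _ => False

/-- Admissible indices. -/
def Bounds.inRange (B : Bounds) (j : Ar) (i : ℕ) : Prop := if j = .low then i < B.N else i < B.cap

namespace St

variable (σ : St)

def tick : St := { σ with t := σ.t + 1 }
def setV (x : V) (c : ℕ) : St := { σ with v := Function.update σ.v x c }
def setA (j : Ar) (i c : ℕ) : St :=
  { σ with a := Function.update σ.a j (Function.update (σ.a j) i c) }

@[simp] theorem tick_v : σ.tick.v = σ.v := rfl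
@[simp] theorem tick_a : σ.tick.a = σ.a := rfl
@[simp] theorem tick_t : σ.tick.t = σ.t + 1 := rfl
@[simp] theorem setV_v (x : V) (c : ℕ) (y : V) : (σ.setV x c).v y = if y = x then c else σ.v y := by
  simp [setV, Function.update_apply]
@[simp] theorem setV_a (x : V) (c : ℕ) : (σ.setV x c).a = σ.a := rfl
@[simp] theorem setV_t (x : V) (c : ℕ) : (σ.setV x c).t = σ.t := rfl
@[simp] theorem setA_v (j : Ar) (i c : ℕ) : (σ.setA j i c).v = σ.v := rfl
@[simp] theorem setA_a (j : Ar) (i c : ℕ) (j' : Ar) : (σ.setA j i c).a j' =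
    if j' = j then Function.update (σ.a j) i c else σ.a j' := by
  by_cases h : j' = j
  · subst h; simp [setA]
  · simp [setA, h]
@[simp] theorem setA_t (j : Ar) (i c : ℕ) : (σ.setA j i c).t = σ.t := rfl

end St

namespace Ex

/-- The value of an expression. -/
def eval (σ : St) : Ex → ℕ
  | lit c => c
  | var x => σ.v x
  | bin o e f => opN o (e.eval σ) (f.eval σ)
  | rd j e => σ.a j (e.eval σ)

/-- The evaluation of the expression causes no overflow and no access out of range. -/
def ok (B : Bounds) (σ : St) : Ex → Prop
  | lit c => c < B.W
  | var _ => True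
  | bin o e f => e.ok B σ ∧ f.ok B σ ∧ opOk B.W o (e.eval σ) (f.eval σ)
  | rd j e => e.ok B σ ∧ B.inRange j (e.eval σ)

def lt (e f : Ex) : Ex := bin .lt e f
def eq (e f : Ex) : Ex := bin .eq e f

variable (B : Bounds) (σ : St) (e f : Ex)

@[simp] theorem eval_lit (c : ℕ) : (lit c).eval σ = c := rfl
@[simp] theorem eval_lit0 : ((0 : Ex)).eval σ = 0 := rfl
@[simp] theorem eval_lit1 : ((1 : Ex)).eval σ = 1 := rfl
@[simp] theorem eval_lit2 : ((2 : Ex)).eval σ = 2 := rfl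
@[simp] theorem eval_lit3 : ((3 : Ex)).eval σ = 3 := rfl
@[simp] theorem eval_lit4 : ((4 : Ex)).eval σ = 4 := rfl
@[simp] theorem eval_var (x : V) : (var x).eval σ = σ.v x := rfl
@[simp] theorem eval_add : (e + f).eval σ = e.eval σ + f.eval σ := rfl
@[simp] theorem eval_sub : (e - f).eval σ = e.eval σ - f.eval σ := rfl
@[simp] theorem eval_mul : (e * f).eval σ = e.eval σ * f.eval σ := rfl
@[simp] theorem eval_div : (e / f).eval σ = e.eval σ / f.eval σ := rfl
@[simp] theorem eval_lt : (e.lt f).eval σ = if e.eval σ < f.eval σ then 1 else 0 := rfl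
@[simp] theorem eval_eq : (e.eq f).eval σ = if e.eval σ = f.eval σ then 1 else 0 := rfl
@[simp] theorem eval_rd (j : Ar) : (rd j e).eval σ = σ.a j (e.eval σ) := rfl
@[simp] theorem ok_lit (c : ℕ) : (lit c).ok B σ ↔ c < B.W := Iff.rfl
@[simp] theorem ok_lit0 : ((0 : Ex)).ok B σ ↔ 0 < B.W := Iff.rfl
@[simp] theorem ok_lit1 : ((1 : Ex)).ok B σ ↔ 1 < B.W := Iff.rfl
@[simp] theorem ok_lit2 : ((2 : Ex)).ok B σ ↔ 2 < B.W := Iff.rfl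
@[simp] theorem ok_lit3 : ((3 : Ex)).ok B σ ↔ 3 < B.W := Iff.rfl
@[simp] theorem ok_lit4 : ((4 : Ex)).ok B σ ↔ 4 < B.W := Iff.rfl
@[simp] theorem ok_var (x : V) : (var x).ok B σ ↔ True := Iff.rfl
@[simp] theorem ok_add : (e + f).ok B σ ↔ e.ok B σ ∧ f.ok B σ ∧ e.eval σ + f.eval σ < B.W := Iff.rfl
@[simp] theorem ok_sub : (e - f).ok B σ ↔ e.ok B σ ∧ f.ok B σ ∧ f.eval σ ≤ e.eval σ := Iff.rfl
@[simp] theorem ok_mul : (e * f).ok B σ ↔ e.ok B σ ∧ f.ok B σ ∧ e.eval σ * f.eval σ < B.W := Iff.rfl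
@[simp] theorem ok_div : (e / f).ok B σ ↔ e.ok B σ ∧ f.ok B σ ∧ True := Iff.rfl
@[simp] theorem ok_lt : (e.lt f).ok B σ ↔ e.ok B σ ∧ f.ok B σ ∧ True := Iff.rfl
@[simp] theorem ok_eq : (e.eq f).ok B σ ↔ e.ok B σ ∧ f.ok B σ ∧ True := Iff.rfl
@[simp] theorem ok_rd (j : Ar) : (rd j e).ok B σ ↔ e.ok B σ ∧ B.inRange j (e.eval σ) := Iff.rfl

end Ex

namespace Cmd

/-- The variables that a command may change. -/
def wv : Cmd → V → Bool
  | skip, _ => false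
  | asg x _, y => decide (y = x)
  | st _ _ _, _ => false
  | seq c d, y => c.wv y || d.wv y
  | ite _ c d, y => c.wv y || d.wv y
  | whl _ c, y => c.wv y

/-- The arrays that a command may change. -/
def wa : Cmd → Ar → Bool
  | skip, _ => false
  | asg _ _, _ => false
  | st j _ _, i => decide (i = j)
  | seq c d, y => c.wa y || d.wa y
  | ite _ c d, y => c.wa y || d.wa y
  | whl _ c, y => c.wa y

/-- `for x < e do c` -/
def forTo (x : V) (e : Ex) (c : Cmd) : Cmd :=
  asg x 0 ;; whl ((Ex.var x).lt e) (c ;; asg x (x + 1))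

/-- Decrease the array entry to the given value if that is smaller. -/
def chmin (j : Ar) (e f : Ex) : Cmd := ite (f.lt (.rd j e)) (st j e f) skip

end Cmd

/-- Big-step semantics. -/
inductive Runs (B : Bounds) : Cmd → St → St → Prop where
  | skip (σ) : Runs B .skip σ σ.tick
  | asg {σ x e} (he : e.ok B σ) : Runs B (.asg x e) σ (σ.setV x (e.eval σ)).tick
  | st {σ j e f} (he : e.ok B σ) (hf : f.ok B σ) (hj : B.inRange j (e.eval σ)) :
      Runs B (.st j e f) σ (σ.setA j (e.eval σ) (f.eval σ)).tick
  | seq {σ σ' σ'' c d} (hc : Runs B c σ.tick σ') (hd : Runs B d σ' σ'') : Runs B (.seq c d) σ σ''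
  | ite_pos {σ σ' e c d} (he : e.ok B σ) (h : e.eval σ ≠ 0) (hc : Runs B c σ.tick σ') :
      Runs B (.ite e c d) σ σ'
  | ite_neg {σ σ' e c d} (he : e.ok B σ) (h : e.eval σ = 0) (hc : Runs B d σ.tick σ') :
      Runs B (.ite e c d) σ σ'
  | whl_done {σ e c} (he : e.ok B σ) (h : e.eval σ = 0) : Runs B (.whl e c) σ σ.tick
  | whl_step {σ σ' σ'' e c} (he : e.ok B σ) (h : e.eval σ ≠ 0) (hc : Runs B c σ.tick σ')
      (hd : Runs B (.whl e c) σ' σ'') : Runs B (.whl e c) σ σ''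

/-- `σ'` agrees with `σ` on everything that `c` does not change. -/
structure Frame (c : Cmd) (σ σ' : St) : Prop where
  v : ∀ x, c.wv x = false → σ'.v x = σ.v x
  a : ∀ j, c.wa j = false → σ'.a j = σ.a j

theorem Frame.refl (c : Cmd) (σ : St) : Frame c σ σ := ⟨fun _ _ => rfl, fun _ _ => rfl⟩

theorem Frame.trans {c : Cmd} {σ σ' σ'' : St} (h : Frame c σ σ') (h' : Frame c σ' σ'') :
    Frame c σ σ'' :=
  ⟨fun x hx => (h'.v x hx).trans (h.v x hx), fun x hx => (h'.a x hx).trans (h.a x hx)⟩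

/-- `wv` and `wa` are computable, so that a variable or an array is untouched by a concrete command
can be checked by `rfl`. Later specifications therefore mention only what changes. -/
theorem Runs.frame {B : Bounds} {c : Cmd} {σ σ' : St} (h : Runs B c σ σ') : Frame c σ σ' := by
  induction h with
  | skip σ => exact ⟨fun _ _ => rfl, fun _ _ => rfl⟩
  | asg he => exact ⟨fun x hx => by simp_all [Cmd.wv], fun _ _ => rfl⟩
  | st he hf hj => exact ⟨fun _ _ => rfl, fun j hj => by simp_all [Cmd.wa]⟩
  | seq hc hd ih1 ih2 =>
    refine ⟨fun x hx => ?_, fun j hj => ?_⟩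
    · simp only [Cmd.wv, Bool.or_eq_false_iff] at hx
      rw [ih2.v x hx.2, ih1.v x hx.1]; rfl
    · simp only [Cmd.wa, Bool.or_eq_false_iff] at hj
      rw [ih2.a j hj.2, ih1.a j hj.1]; rfl
  | ite_pos he h hc ih =>
    refine ⟨fun x hx => ?_, fun j hj => ?_⟩
    · simp only [Cmd.wv, Bool.or_eq_false_iff] at hx
      rw [ih.v x hx.1]; rfl
    · simp only [Cmd.wa, Bool.or_eq_false_iff] at hj
      rw [ih.a j hj.1]; rfl
  | ite_neg he h hc ih =>
    refine ⟨fun x hx => ?_, fun j hj => ?_⟩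
    · simp only [Cmd.wv, Bool.or_eq_false_iff] at hx
      rw [ih.v x hx.2]; rfl
    · simp only [Cmd.wa, Bool.or_eq_false_iff] at hj
      rw [ih.a j hj.2]; rfl
  | whl_done he h => exact ⟨fun _ _ => rfl, fun _ _ => rfl⟩
  | whl_step he h hc hd ih1 ih2 =>
    refine ⟨fun x hx => ?_, fun j hj => ?_⟩
    · rw [ih2.v x hx, ih1.v x hx]; rfl
    · rw [ih2.a j hj, ih1.a j hj]; rfl

/-- Weakest preconditions (for termination without error). -/
def wp (B : Bounds) (c : Cmd) (Q : St → Prop) (σ : St) : Prop := ∃ σ', Runs B c σ σ' ∧ Q σ'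

section wp

variable {B : Bounds} {Q Q' : St → Prop} {σ : St} {c d : Cmd} {e f : Ex} {x : V} {j : Ar}

/-- The frame comes for free with every specification that is used, since it follows from the
derivation. -/
theorem wp.mono (h : wp B c Q σ) (hQ : ∀ σ', Frame c σ σ' → Q σ' → Q' σ') : wp B c Q' σ := by
  obtain ⟨σ', h1, h2⟩ := h
  exact ⟨σ', h1, hQ σ' h1.frame h2⟩

@[simp] theorem wp_skip : wp B .skip Q σ ↔ Q σ.tick :=
  ⟨fun ⟨_, h, hQ⟩ => by cases h; exact hQ, fun h => ⟨_, .skip σ, h⟩⟩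

@[simp] theorem wp_asg : wp B (.asg x e) Q σ ↔ e.ok B σ ∧ Q (σ.setV x (e.eval σ)).tick :=
  ⟨fun ⟨_, h, hQ⟩ => by cases h with | asg he => exact ⟨he, hQ⟩, fun h => ⟨_, .asg h.1, h.2⟩⟩

@[simp] theorem wp_st : wp B (.st j e f) Q σ ↔
    (e.ok B σ ∧ f.ok B σ ∧ B.inRange j (e.eval σ)) ∧ Q (σ.setA j (e.eval σ) (f.eval σ)).tick :=
  ⟨fun ⟨_, h, hQ⟩ => by cases h with | st he hf hj => exact ⟨⟨he, hf, hj⟩, hQ⟩,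
    fun h => ⟨_, .st h.1.1 h.1.2.1 h.1.2.2, h.2⟩⟩

@[simp] theorem wp_seq : wp B (c ;; d) Q σ ↔ wp B c (fun σ' => wp B d Q σ') σ.tick :=
  ⟨fun ⟨_, h, hQ⟩ => by cases h with | seq h1 h2 => exact ⟨_, h1, _, h2, hQ⟩,
    fun ⟨_, h1, _, h2, h3⟩ => ⟨_, .seq h1 h2, h3⟩⟩

@[simp] theorem wp_ite : wp B (.ite e c d) Q σ ↔
    e.ok B σ ∧ (e.eval σ ≠ 0 → wp B c Q σ.tick) ∧ (e.eval σ = 0 → wp B d Q σ.tick) := by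
  constructor
  · rintro ⟨_, h, hQ⟩
    cases h with
    | ite_pos he h0 hc => exact ⟨he, fun _ => ⟨_, hc, hQ⟩, fun h => absurd h h0⟩
    | ite_neg he h0 hc => exact ⟨he, fun h => absurd h0 h, fun _ => ⟨_, hc, hQ⟩⟩
  · rintro ⟨he, h1, h2⟩
    by_cases h : e.eval σ = 0
    · obtain ⟨σ', hr, hq⟩ := h2 h
      exact ⟨σ', .ite_neg he h hr, hq⟩
    · obtain ⟨σ', hr, hq⟩ := h1 h
      exact ⟨σ', .ite_pos he h hr, hq⟩

/-- Total correctness by an invariant `I` and a variant `μ`; the frame is relative to the state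
before the loop, hence part of the invariant without being stated. -/
theorem wp_whl (I : St → Prop) (μ : St → ℕ) (h0 : I σ)
    (hok : ∀ σ', I σ' → Frame c σ σ' → e.ok B σ')
    (hstep : ∀ σ', I σ' → Frame c σ σ' → e.eval σ' ≠ 0 →
      wp B c (fun σ'' => I σ'' ∧ μ σ'' < μ σ') σ'.tick)
    (hQ : ∀ σ', I σ' → Frame c σ σ' → e.eval σ' = 0 → Q σ'.tick) : wp B (.whl e c) Q σ := by
  suffices H : ∀ (k : ℕ) (σ' : St), μ σ' = k → I σ' → Frame c σ σ' → wp B (.whl e c) Q σ' from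
    H _ σ rfl h0 (Frame.refl c σ)
  intro k
  induction k using Nat.strong_induction_on with
  | _ k ih =>
    rintro σ' rfl hI hF
    by_cases h : e.eval σ' = 0
    · exact ⟨_, .whl_done (hok σ' hI hF) h, hQ σ' hI hF h⟩
    · obtain ⟨σ₁, hr, hI₁, hμ⟩ := hstep σ' hI hF h
      have hF' : Frame c σ' σ₁ := ⟨hr.frame.v, hr.frame.a⟩
      obtain ⟨σ₂, hr₂, hq⟩ := ih _ hμ σ₁ rfl hI₁ (hF.trans hF')
      exact ⟨σ₂, .whl_step (hok σ' hI hF) h hr hr₂, hq⟩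

-- Both branches take the same time, and overwriting an entry by itself changes nothing, so the case
-- distinction disappears into `min`.
@[simp] theorem wp_chmin : wp B (.chmin j e f) Q σ ↔
    (e.ok B σ ∧ f.ok B σ ∧ B.inRange j (e.eval σ)) ∧
      Q (σ.setA j (e.eval σ) (min (f.eval σ) (σ.a j (e.eval σ)))).tick.tick := by
  have hev : ∀ e : Ex, e.eval σ.tick = e.eval σ := by
    intro e; induction e <;> simp_all [Ex.eval]
  have hok : ∀ e : Ex, e.ok B σ.tick ↔ e.ok B σ := by
    intro e; induction e <;> simp_all [Ex.ok]
  simp only [Cmd.chmin, wp_ite, wp_st, Ex.ok_lt, Ex.ok_rd, Ex.eval_lt, Ex.eval_rd, wp_skip, hev, hok]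
  have hs : (σ.tick.setA j (e.eval σ) (f.eval σ)) = (σ.setA j (e.eval σ) (f.eval σ)).tick := rfl
  rw [hs]
  by_cases h : f.eval σ < σ.a j (e.eval σ)
  · rw [min_eq_left h.le]; simp [h]; tauto
  · have hm : σ.setA j (e.eval σ) (σ.a j (e.eval σ)) = σ := by simp [St.setA]
    rw [min_eq_right (not_lt.1 h), hm]; simp [h]; tauto

/-- Loops with a fixed number of rounds, with an invariant on the arrays. -/
theorem wp_forTo (I : ℕ → (Ar → ℕ → ℕ) → Prop) (b τ : ℕ) (hx : c.wv x = false)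
    (hb : b + 1 < B.W) (h0 : I 0 σ.a)
    (he : ∀ σ' : St, (∀ y, y ≠ x → c.wv y = false → σ'.v y = σ.v y) →
      (∀ j, c.wa j = false → σ'.a j = σ.a j) → e.ok B σ' ∧ e.eval σ' = b)
    (hbody : ∀ k < b, ∀ σ' : St, I k σ'.a → σ'.v x = k →
      (∀ y, y ≠ x → c.wv y = false → σ'.v y = σ.v y) →
      (∀ j, c.wa j = false → σ'.a j = σ.a j) →
      wp B c (fun σ'' => I (k + 1) σ''.a ∧ σ''.t ≤ σ'.t + τ) σ')
    (hQ : ∀ σ' : St, I b σ'.a → (∀ y, y ≠ x → c.wv y = false → σ'.v y = σ.v y) →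
      (∀ j, c.wa j = false → σ'.a j = σ.a j) → σ'.t ≤ σ.t + (b * (τ + 3) + 3) → Q σ') :
    wp B (.forTo x e c) Q σ := by
  have h1W : 1 < B.W := by omega
  simp only [Cmd.forTo, wp_seq, wp_asg, Ex.ok_lit0, Ex.ok_lit1, Ex.eval_lit0, Ex.eval_lit1]
  refine ⟨by omega, ?_⟩
  set σ₁ := (σ.tick.setV x 0).tick with hσ₁
  have hv₁ : ∀ y, y ≠ x → σ₁.v y = σ.v y := fun y hy => by simp [hσ₁, hy]
  have ha₁ : ∀ j, σ₁.a j = σ.a j := fun j => rfl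
  have frv : ∀ σ' : St, Frame (c ;; .asg x (x + 1)) σ₁ σ' →
      ∀ y, y ≠ x → c.wv y = false → σ'.v y = σ.v y := by
    intro σ' hF y hy hc
    rw [hF.v y (by simp [Cmd.wv, hy, hc]), hv₁ y hy]
  have fra : ∀ σ' : St, Frame (c ;; .asg x (x + 1)) σ₁ σ' →
      ∀ j, c.wa j = false → σ'.a j = σ.a j := by
    intro σ' hF j hc
    rw [hF.a j (by simp [Cmd.wa, hc]), ha₁]
  -- A round costs 3 units beside the body (loop test, sequencing, increment); the initialization
  -- costs 2 and the last test 1.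
  refine wp_whl (I := fun σ' => σ'.v x ≤ b ∧ I (σ'.v x) σ'.a ∧ σ'.t ≤ σ.t + 2 + σ'.v x * (τ + 3))
    (μ := fun σ' => b - σ'.v x) ?_ ?_ ?_ ?_
  · simp [hσ₁, h0]
  · intro σ' hI hF
    have := he σ' (frv σ' hF) (fra σ' hF)
    simp [this.1]
  · intro σ' ⟨hI1, hI2, hI3⟩ hF hlt
    have h := he σ' (frv σ' hF) (fra σ' hF)
    have hlt' : σ'.v x < b := by
      by_contra hcon
      simp [h.2, hcon] at hlt
    rw [wp_seq]
    refine (hbody _ hlt' σ'.tick.tick hI2 rfl (frv σ' hF) (fra σ' hF)).mono ?_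
    intro σ'' hF' ⟨hI', ht'⟩
    have hxx : σ''.v x = σ'.v x := hF'.v x hx
    rw [wp_asg]
    refine ⟨?_, ⟨?_, ?_, ?_⟩, ?_⟩
    · simp only [Ex.ok_add, Ex.ok_var, Ex.ok_lit0, Ex.ok_lit1, Ex.eval_var, Ex.eval_lit0, Ex.eval_lit1, true_and]
      rw [hxx]; omega
    · simp [hxx]; omega
    · simpa [hxx] using hI'
    · simp only [St.tick_t, St.setV_t, St.tick_v, St.setV_v, if_true, Ex.eval_add, Ex.eval_var,
        Ex.eval_lit0, Ex.eval_lit1, hxx] at ht' ⊢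
      have : (σ'.v x + 1) * (τ + 3) = σ'.v x * (τ + 3) + (τ + 3) := by ring
      omega
    · simp [hxx]; omega
  · intro σ' ⟨hI1, hI2, hI3⟩ hF hlt
    have h := he σ' (frv σ' hF) (fra σ' hF)
    have hxb : σ'.v x = b := by
      by_contra hcon
      have : σ'.v x < b := by omega
      simp [h.2, this] at hlt
    rw [hxb] at hI2 hI3
    exact hQ _ hI2 (frv σ' hF) (fra σ' hF) (by simp only [St.tick_t]; omega)

end wp

end WordRAM.HL

namespace WordRAM.HL

/-! ### Compilation -/

/-- The number of arrays, which is the distance of consecutive entries of an array. -/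
def stride : ℕ := Fintype.card Ar

noncomputable def Ar.code (j : Ar) : ℕ := (Fintype.equivFin Ar j : ℕ)

theorem Ar.code_lt (j : Ar) : j.code < stride := (Fintype.equivFin Ar j).isLt

theorem Ar.code_inj {i j : Ar} (h : i.code = j.code) : i = j :=
  (Fintype.equivFin Ar).injective (Fin.ext h)

/-- The address of an array entry. -/
noncomputable def adr (N : ℕ) (j : Ar) (i : ℕ) : ℕ :=
  if j = .low then i else (i + N) * stride + j.code

theorem stride_pos : 0 < stride := by decide

/-- The arrays are interleaved with period `stride` behind the first `N` cells: the residue of an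
address names the array and the quotient gives the index. Addresses thus depend on `N` only, not on
the lengths of the arrays. -/
theorem adr_inj {B : Bounds} {j j' : Ar} {i i' : ℕ} (hi : B.inRange j i) (hi' : B.inRange j' i')
    (h : adr B.N j i = adr B.N j' i') : j = j' ∧ i = i' := by
  have key : ∀ (i : ℕ) (j : Ar), B.N ≤ (i + B.N) * stride + j.code := by
    intro i j
    have := Nat.le_mul_of_pos_right (i + B.N) stride_pos
    omega
  unfold adr Bounds.inRange at *
  split_ifs at * with h1 h2 h2
  · exact ⟨h1.trans h2.symm, h⟩
  · have := key i' j'; omega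
  · have := key i j; omega
  · have e1 := congrArg (· % stride) h
    have e2 := congrArg (· / stride) h
    simp only [Nat.mul_add_mod_self_right, Nat.mod_eq_of_lt (Ar.code_lt _)] at e1
    have hd : ∀ (x : ℕ) (j : Ar), (x * stride + j.code) / stride = x := by
      intro x j
      rw [mul_comm, Nat.mul_add_div stride_pos, Nat.div_eq_of_lt (Ar.code_lt j), add_zero]
    simp only [hd] at e2
    exact ⟨Ar.code_inj e1, by omega⟩

/-- The registers of the variables. -/
noncomputable def rv (x : V) : ℕ := 2 * (Fintype.equivFin V x : ℕ) + 1

theorem rv_inj {x y : V} (h : rv x = rv y) : x = y := by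
  refine (Fintype.equivFin V).injective (Fin.ext ?_)
  unfold rv at h; omega

/-- The registers for intermediate results. -/
def tmp (i : ℕ) : ℕ := 2 * i + 2

/-- Replace the index in `tmp i` by the address of the entry of `j` with this index. -/
noncomputable def cAdr (j : Ar) (i : ℕ) : Program :=
  if j = .low then .skip else
    .seq (.op .add (tmp i) (tmp i) 0) (.seq (.const (tmp (i + 1)) stride)
      (.seq (.op .mul (tmp i) (tmp i) (tmp (i + 1))) (.seq (.const (tmp (i + 1)) j.code)
        (.op .add (tmp i) (tmp i) (tmp (i + 1))))))

/-- Evaluate an expression into `tmp i`. -/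
noncomputable def Ex.compile : Ex → ℕ → Program
  | lit c, i => .const (tmp i) c
  | var x, i => .op .or (tmp i) (rv x) (rv x)
  | bin o e f, i => .seq (e.compile i) (.seq (f.compile (i + 1))
      (.op o (tmp i) (tmp i) (tmp (i + 1))))
  | rd j e, i => .seq (e.compile i) (.seq (cAdr j i) (.load (tmp i) (tmp i)))

/-- Bounds the number of steps for evaluating an expression. -/
def Ex.steps : Ex → ℕ
  | lit _ => 1
  | var _ => 1
  | bin _ e f => e.steps + f.steps + 3
  | rd _ e => e.steps + 12

noncomputable def Cmd.compile : Cmd → Program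
  | skip => .skip
  | asg x e => .seq (e.compile 0) (.op .or (rv x) (tmp 0) (tmp 0))
  | st j e f => .seq (e.compile 0) (.seq (cAdr j 0) (.seq (f.compile 1) (.store (tmp 0) (tmp 1))))
  | seq c d => .seq c.compile d.compile
  | ite e c d => .seq (e.compile 0) (.ite (tmp 0) c.compile d.compile)
  | whl e c => .seq (e.compile 0) (.loop (tmp 0) (.seq c.compile (e.compile 0)))

/-- Bounds the number of machine steps per time unit. -/
def Cmd.slow : Cmd → ℕ
  | skip => 1
  | asg _ e => e.steps + 2
  | st _ e f => e.steps + f.steps + 20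
  | seq c d => c.slow + d.slow + 1
  | ite e c d => e.steps + c.slow + d.slow + 2
  | whl e c => e.steps + c.slow + 3

/-- The words are long enough to address all arrays. -/
structure Bounds.Fits (B : Bounds) (w : ℕ) : Prop where
  W : B.W = 2 ^ w
  cap : (B.cap + B.N) * stride ≤ B.W
  one_lt : 1 < B.W

/-- The machine state `s` represents `σ`. -/
structure Rep (B : Bounds) {w : ℕ} (s : State w) (σ : St) : Prop where
  N : s.reg 0 = BitVec.ofNat w B.N
  v : ∀ x, s.reg (rv x) = BitVec.ofNat w (σ.v x)
  v_lt : ∀ x, σ.v x < B.W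
  a : ∀ j i, B.inRange j i → s.mem (BitVec.ofNat w (adr B.N j i)) = BitVec.ofNat w (σ.a j i)
  a_lt : ∀ j i, B.inRange j i → σ.a j i < B.W

section

variable {B : Bounds} {w : ℕ} (hB : B.Fits w)
include hB

theorem adr_lt {j : Ar} {i : ℕ} (h : B.inRange j i) : adr B.N j i < B.W := by
  have h1 := hB.cap
  unfold adr Bounds.inRange at *
  split_ifs at * with hj
  · have := Nat.le_mul_of_pos_right (B.cap + B.N) stride_pos
    omega
  · have := j.code_lt
    have h2 : (i + B.N + 1) * stride ≤ (B.cap + B.N) * stride := Nat.mul_le_mul_right _ (by omega)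
    rw [Nat.succ_mul] at h2
    omega

theorem ofNat_inj {x y : ℕ} (hx : x < B.W) (hy : y < B.W)
    (h : BitVec.ofNat w x = BitVec.ofNat w y) : x = y := by
  have := congrArg BitVec.toNat h
  rw [hB.W] at hx hy
  simpa [BitVec.toNat_ofNat, Nat.mod_eq_of_lt hx, Nat.mod_eq_of_lt hy] using this

theorem ofNat_eq_zero {x : ℕ} (hx : x < B.W) : BitVec.ofNat w x = 0 ↔ x = 0 := by
  have h0 : (0 : ℕ) < B.W := by have := hB.one_lt; omega
  constructor
  · intro h
    exact ofNat_inj hB hx h0 (by simpa using h)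
  · rintro rfl; rfl

theorem eval_ofNat (o : BinOp) {x y : ℕ} (hx : x < B.W) (hy : y < B.W) (h : opOk B.W o x y) :
    o.eval (BitVec.ofNat w x) (BitVec.ofNat w y) = BitVec.ofNat w (opN o x y) ∧
      opN o x y < B.W := by
  have h1 := hB.one_lt
  have hx' := hx
  have hy' := hy
  rw [hB.W] at hx' hy'
  cases o <;> simp only [opOk, opN, BinOp.eval] at *
  · exact ⟨by rw [BitVec.ofNat_add], h⟩
  · refine ⟨?_, by omega⟩
    apply BitVec.eq_of_toNat_eq
    rw [BitVec.toNat_sub_of_le]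
    · simp only [BitVec.toNat_ofNat]
      rw [Nat.mod_eq_of_lt hx', Nat.mod_eq_of_lt hy', Nat.mod_eq_of_lt (by omega)]
    · rw [BitVec.le_def, BitVec.toNat_ofNat, BitVec.toNat_ofNat, Nat.mod_eq_of_lt hx',
        Nat.mod_eq_of_lt hy']; exact h
  · exact ⟨by rw [BitVec.ofNat_mul], h⟩
  · have hlt : x / y < B.W := lt_of_le_of_lt (Nat.div_le_self x y) hx
    refine ⟨?_, hlt⟩
    apply BitVec.eq_of_toNat_eq
    rw [hB.W] at hlt
    simp only [BitVec.toNat_udiv, BitVec.toNat_ofNat, Nat.mod_eq_of_lt hx', Nat.mod_eq_of_lt hy',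
      Nat.mod_eq_of_lt hlt]
  · have : BitVec.ofNat w x < BitVec.ofNat w y ↔ x < y := by
      rw [BitVec.lt_def, BitVec.toNat_ofNat, BitVec.toNat_ofNat, Nat.mod_eq_of_lt hx',
        Nat.mod_eq_of_lt hy']
    simp only [this]
    split_ifs
    · exact ⟨rfl, h1⟩
    · exact ⟨rfl, by omega⟩
  · have : BitVec.ofNat w x = BitVec.ofNat w y ↔ x = y :=
      ⟨fun h => ofNat_inj hB hx hy h, fun h => by rw [h]⟩
    simp only [this]
    split_ifs
    · exact ⟨rfl, h1⟩
    · exact ⟨rfl, by omega⟩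

omit hB in
/-- The two states differ at most in intermediate results from number `i` on. -/
def SameBelow {w : ℕ} (i : ℕ) (s s' : State w) : Prop :=
  s'.mem = s.mem ∧ ∀ r, (r < tmp i ∨ r % 2 = 1) → s'.reg r = s.reg r

omit hB in
theorem SameBelow.refl {w : ℕ} (i : ℕ) (s : State w) : SameBelow i s s := ⟨rfl, fun _ _ => rfl⟩

omit hB in
theorem SameBelow.trans {w i : ℕ} {s s' s'' : State w} (h : SameBelow i s s')
    (h' : SameBelow i s' s'') : SameBelow i s s'' :=
  ⟨h'.1.trans h.1, fun r hr => (h'.2 r hr).trans (h.2 r hr)⟩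

omit hB in
theorem SameBelow.mono {w i i' : ℕ} (hi : i ≤ i') {s s' : State w} (h : SameBelow i' s s') :
    SameBelow i s s' :=
  ⟨h.1, fun r hr => h.2 r (by unfold tmp at *; omega)⟩

omit hB in
theorem sameBelow_setReg {w i i' : ℕ} (hi : i ≤ i') (s : State w) (x : BitVec w) :
    SameBelow i s (s.setReg (tmp i') x) := by
  refine ⟨rfl, fun r hr => ?_⟩
  simp only [State.setReg, Function.update_apply]
  rw [if_neg]
  unfold tmp at *; omega

omit hB in
theorem Rep.sameBelow {s s' : State w} {σ : St} (h : Rep B s σ) {i : ℕ} (hs : SameBelow i s s') :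
    Rep B s' σ := by
  refine ⟨?_, ?_, h.v_lt, ?_, h.a_lt⟩
  · rw [hs.2 0 (by unfold tmp; omega), h.N]
  · intro x
    rw [hs.2 _ (by unfold rv; omega), h.v]
  · intro j k hk
    rw [hs.1, h.a j k hk]

omit hB in
theorem cAdr_spec {s : State w} {σ : St} (hR : Rep B s σ) {j : Ar} {i c : ℕ}
    (hc : s.reg (tmp i) = BitVec.ofNat w c) :
    ∃ s' t, t ≤ 9 ∧ Det (cAdr j i) s s' t ∧ SameBelow i s s' ∧
      s'.reg (tmp i) = BitVec.ofNat w (adr B.N j c) := by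
  by_cases h : j = .low
  · refine ⟨s, 1, by omega, ?_, .refl i s, ?_⟩
    · rw [cAdr, if_pos h]; exact det_skip s
    · rw [hc, adr, if_pos h]
  · rw [cAdr, if_neg h]
    refine ⟨_, _, ?_, (det_op s _ _ _ _).seq ((det_const _ _ _).seq ((det_op _ _ _ _ _).seq
      ((det_const _ _ _).seq (det_op _ _ _ _ _)))), ?_, ?_⟩
    · omega
    · exact (sameBelow_setReg le_rfl _ _).trans ((sameBelow_setReg (Nat.le_succ i) _ _).trans
        ((sameBelow_setReg le_rfl _ _).trans ((sameBelow_setReg (Nat.le_succ i) _ _).trans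
          (sameBelow_setReg le_rfl _ _))))
    · have h1 : tmp i ≠ tmp (i + 1) := by unfold tmp; omega
      simp only [State.setReg, Function.update_self, Function.update_of_ne h1,
        Function.update_of_ne h1.symm, BinOp.eval, hc, hR.N, adr, if_neg h, BitVec.ofNat_add,
        BitVec.ofNat_mul]

/-- Evaluation into `tmp i` only disturbs temporaries from number `i` on, so a left operand in `tmp
i` survives while the right one is evaluated into `tmp (i + 1)`. Variables are in odd registers and
`N` is in register 0, out of reach of the temporaries. -/
theorem Ex.compile_spec {s : State w} {σ : St} (e : Ex) (i : ℕ) (hR : Rep B s σ) (he : e.ok B σ) :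
    e.eval σ < B.W ∧ ∃ s' t, t ≤ e.steps ∧ Det (e.compile i) s s' t ∧ SameBelow i s s' ∧
      s'.reg (tmp i) = BitVec.ofNat w (e.eval σ) := by
  induction e generalizing i s with
  | lit c =>
    exact ⟨he, _, _, le_rfl, det_const _ _ _, sameBelow_setReg le_rfl _ _,
      by simp [State.setReg, eval]⟩
  | var x =>
    refine ⟨hR.v_lt x, _, _, le_rfl, det_op _ _ _ _ _, sameBelow_setReg le_rfl _ _, ?_⟩
    simp [State.setReg, eval, BinOp.eval, hR.v]
  | bin o e f ihe ihf =>
    obtain ⟨h1, h2, h3⟩ := he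
    obtain ⟨e1, s₁, t₁, ht₁, hd₁, hs₁, hr₁⟩ := ihe i hR h1
    have hR₁ := hR.sameBelow hs₁
    obtain ⟨f1, s₂, t₂, ht₂, hd₂, hs₂, hr₂⟩ := ihf (i + 1) hR₁ h2
    have ev := eval_ofNat hB o e1 f1 h3
    refine ⟨ev.2, _, _, ?_, hd₁.seq (hd₂.seq (det_op _ _ _ _ _)),
      (hs₁.trans (hs₂.mono (Nat.le_succ i))).trans (sameBelow_setReg le_rfl _ _), ?_⟩
    · simp only [steps]; omega
    · have : s₂.reg (tmp i) = s₁.reg (tmp i) := hs₂.2 _ (by unfold tmp; omega)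
      simp only [State.setReg, Function.update_self, this, hr₁, hr₂, ev.1, eval]
  | rd j e ih =>
    obtain ⟨h1, h2⟩ := he
    obtain ⟨e1, s₁, t₁, ht₁, hd₁, hs₁, hr₁⟩ := ih i hR h1
    have hR₁ := hR.sameBelow hs₁
    obtain ⟨s₂, t₂, ht₂, hd₂, hs₂, hr₂⟩ := cAdr_spec hR₁ hr₁
    have hR₂ := hR₁.sameBelow hs₂
    refine ⟨hR.a_lt _ _ h2, _, _, ?_, hd₁.seq (hd₂.seq (det_load _ _ _)),
      (hs₁.trans hs₂).trans (sameBelow_setReg le_rfl _ _), ?_⟩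
    · simp only [steps]; omega
    · simp only [State.setReg, Function.update_self, hr₂, hR₂.a _ _ h2, eval]

omit hB in
theorem Rep.tick {s : State w} {σ : St} (h : Rep B s σ) : Rep B s σ.tick :=
  ⟨h.N, h.v, h.v_lt, h.a, h.a_lt⟩

omit hB in
theorem Rep.setV {s : State w} {σ : St} (h : Rep B s σ) (x : V) {c : ℕ} (hc : c < B.W) :
    Rep B (s.setReg (rv x) (BitVec.ofNat w c)) (σ.setV x c) := by
  refine ⟨?_, ?_, ?_, h.a, h.a_lt⟩
  · have h0 : 0 ≠ rv x := by unfold rv; omega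
    simp only [State.setReg, Function.update_of_ne h0, h.N]
  · intro y
    rw [St.setV_v]
    split_ifs with hy
    · subst hy; simp [State.setReg]
    · rw [← h.v y, State.setReg]
      exact Function.update_of_ne (fun h' => hy (rv_inj h')) _ _
  · intro y
    rw [St.setV_v]
    split_ifs
    · exact hc
    · exact h.v_lt y

theorem Rep.setA {s : State w} {σ : St} (h : Rep B s σ) {j : Ar} {i c : ℕ} (hj : B.inRange j i)
    (hc : c < B.W) :
    Rep B (s.setMem (BitVec.ofNat w (adr B.N j i)) (BitVec.ofNat w c)) (σ.setA j i c) := by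
  refine ⟨h.N, h.v, h.v_lt, ?_, ?_⟩
  · intro j' i' hi'
    by_cases hh : j' = j ∧ i' = i
    · obtain ⟨rfl, rfl⟩ := hh
      simp [State.setMem]
    · have hne : BitVec.ofNat w (adr B.N j' i') ≠ BitVec.ofNat w (adr B.N j i) := fun he =>
        hh (adr_inj hi' hj (ofNat_inj hB (adr_lt hB hi') (adr_lt hB hj) he))
      rw [State.setMem]
      simp only [Function.update_of_ne hne, h.a j' i' hi', St.setA_a]
      split_ifs with hjj
      · subst hjj
        rw [Function.update_of_ne (fun hi => hh ⟨rfl, hi⟩)]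
      · rfl
  · intro j' i' hi'
    rw [St.setA_a]
    split_ifs with hjj
    · subst hjj
      rw [Function.update_apply]
      split_ifs
      · exact hc
      · exact h.a_lt _ _ hi'
    · exact h.a_lt _ _ hi'

omit hB in
/-- The simulation of a loop from the point on where its condition has been evaluated. -/
def LoopSpec (B : Bounds) (w : ℕ) : Cmd → St → St → Prop
  | .whl e c, σ, σ' => ∀ s : State w, Rep B s σ → s.reg (tmp 0) = BitVec.ofNat w (e.eval σ) →
      ∃ s' t, Det (.loop (tmp 0) (.seq c.compile (e.compile 0))) s s' t ∧ Rep B s' σ' ∧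
        -- The surplus `e.steps + 1` pays for the evaluation of the condition that comes before this
        -- point, either ahead of the loop or at the end of the previous round.
        ∀ κ, (Cmd.whl e c).slow ≤ κ → t + e.steps + 1 + κ * σ.t ≤ κ * σ'.t
  | _, _, _ => True

theorem LoopSpec.compile_spec {e : Ex} {c : Cmd} {σ σ' : St} (he : e.ok B σ)
    (h : LoopSpec B w (.whl e c) σ σ') {s : State w} (hR : Rep B s σ) :
    ∃ s' t, Det (Cmd.whl e c).compile s s' t ∧ Rep B s' σ' ∧
      ∀ κ, (Cmd.whl e c).slow ≤ κ → t + κ * σ.t ≤ κ * σ'.t := by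
  obtain ⟨hlt, s₁, t₁, ht₁, hd₁, hs₁, hr₁⟩ := e.compile_spec hB 0 hR he
  obtain ⟨s₂, t₂, hd₂, hR₂, hk₂⟩ := h s₁ (hR.sameBelow hs₁) hr₁
  refine ⟨_, _, hd₁.seq hd₂, hR₂, fun κ hκ => ?_⟩
  have := hk₂ κ hκ
  omega

/-- The compiled program simulates the big-step semantics. -/
theorem Runs.compile_aux {c : Cmd} {σ σ' : St} (h : Runs B c σ σ') :
    LoopSpec B w c σ σ' ∧ ∀ s : State w, Rep B s σ → ∃ s' t, Det c.compile s s' t ∧ Rep B s' σ' ∧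
      ∀ κ, c.slow ≤ κ → t + κ * σ.t ≤ κ * σ'.t := by
  induction h with
  | skip σ => exact ⟨trivial, fun s hR => ⟨s, 1, det_skip s, hR.tick, fun κ hκ => by
      simp only [Cmd.slow, St.tick_t] at *; rw [mul_add]; omega⟩⟩
  | @asg σ x e he =>
    refine ⟨trivial, fun s hR => ?_⟩
    obtain ⟨hlt, s₁, t₁, ht₁, hd₁, hs₁, hr₁⟩ := e.compile_spec hB 0 hR he
    refine ⟨_, _, hd₁.seq (det_op _ _ _ _ _), ?_, ?_⟩
    · have := ((hR.sameBelow hs₁).setV x hlt).tick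
      simpa [BinOp.eval, hr₁] using this
    · intro κ hκ
      simp only [Cmd.slow, St.tick_t, St.setV_t] at *; rw [mul_add]; omega
  | @st σ j e f he hf hj =>
    refine ⟨trivial, fun s hR => ?_⟩
    obtain ⟨_, s₁, t₁, ht₁, hd₁, hs₁, hr₁⟩ := e.compile_spec hB 0 hR he
    have hR₁ := hR.sameBelow hs₁
    obtain ⟨s₂, t₂, ht₂, hd₂, hs₂, hr₂⟩ := cAdr_spec hR₁ hr₁
    have hR₂ := hR₁.sameBelow hs₂
    obtain ⟨hlt, s₃, t₃, ht₃, hd₃, hs₃, hr₃⟩ := f.compile_spec hB 1 hR₂ hf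
    have hR₃ := hR₂.sameBelow hs₃
    refine ⟨_, _, hd₁.seq (hd₂.seq (hd₃.seq (det_store _ _ _))), ?_, ?_⟩
    · have h0 : s₃.reg (tmp 0) = s₂.reg (tmp 0) := hs₃.2 _ (by unfold tmp; omega)
      rw [h0, hr₂, hr₃]
      exact (hR₃.setA hB hj hlt).tick
    · intro κ hκ
      simp only [Cmd.slow, St.tick_t, St.setA_t] at *; rw [mul_add]; omega
  | @seq σ σ' σ'' c d hc hd ihc ihd =>
    refine ⟨trivial, fun s hR => ?_⟩
    obtain ⟨s₁, t₁, hd₁, hR₁, hk₁⟩ := ihc.2 _ hR.tick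
    obtain ⟨s₂, t₂, hd₂, hR₂, hk₂⟩ := ihd.2 _ hR₁
    refine ⟨_, _, hd₁.seq hd₂, hR₂, fun κ hκ => ?_⟩
    simp only [Cmd.slow] at hκ
    have h1 := hk₁ κ (by omega)
    have h2 := hk₂ κ (by omega)
    simp only [St.tick_t] at *; rw [mul_add] at h1; omega
  | @ite_pos σ σ' e c d he h0 hc ih =>
    refine ⟨trivial, fun s hR => ?_⟩
    obtain ⟨hlt, s₁, t₁, ht₁, hd₁, hs₁, hr₁⟩ := e.compile_spec hB 0 hR he
    obtain ⟨s₂, t₂, hd₂, hR₂, hk₂⟩ := ih.2 _ (hR.sameBelow hs₁).tick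
    refine ⟨_, _, hd₁.seq (Det.ite_pos ?_ hd₂), hR₂, fun κ hκ => ?_⟩
    · rw [hr₁, Ne, ofNat_eq_zero hB hlt]; exact h0
    · simp only [Cmd.slow] at hκ
      have h2 := hk₂ κ (by omega)
      simp only [St.tick_t] at *; rw [mul_add] at h2; omega
  | @ite_neg σ σ' e c d he h0 hc ih =>
    refine ⟨trivial, fun s hR => ?_⟩
    obtain ⟨hlt, s₁, t₁, ht₁, hd₁, hs₁, hr₁⟩ := e.compile_spec hB 0 hR he
    obtain ⟨s₂, t₂, hd₂, hR₂, hk₂⟩ := ih.2 _ (hR.sameBelow hs₁).tick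
    refine ⟨_, _, hd₁.seq (Det.ite_neg ?_ hd₂), hR₂, fun κ hκ => ?_⟩
    · rw [hr₁, ofNat_eq_zero hB hlt]; exact h0
    · simp only [Cmd.slow] at hκ
      have h2 := hk₂ κ (by omega)
      simp only [St.tick_t] at *; rw [mul_add] at h2; omega
  | @whl_done σ e c he h0 =>
    have hL : LoopSpec B w (.whl e c) σ σ.tick := by
      intro s hR hr
      refine ⟨s, 1, det_loop_done ?_, hR.tick, fun κ hκ => ?_⟩
      · rw [hr, h0]; rfl
      · simp only [Cmd.slow, St.tick_t] at *; rw [mul_add]; omega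
    exact ⟨hL, fun s hR => hL.compile_spec hB he hR⟩
  | @whl_step σ σ' σ'' e c he h0 hc hd ihc ihd =>
    have he' : e.ok B σ' := by cases hd <;> assumption
    have hL : LoopSpec B w (.whl e c) σ σ'' := by
      intro s hR hr
      obtain ⟨hlt, -⟩ := e.compile_spec hB 0 hR he
      obtain ⟨s₂, t₂, hd₂, hR₂, hk₂⟩ := ihc.2 _ hR.tick
      obtain ⟨hlt, s₁, t₁, ht₁, hd₁, hs₁, hr₁⟩ := e.compile_spec hB 0 hR₂ he'
      obtain ⟨s₃, t₃, hd₃, hR₃, hk₃⟩ := ihd.1 s₁ (hR₂.sameBelow hs₁) hr₁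
      refine ⟨_, _, Det.loop ?_ (hd₂.seq hd₁) hd₃, hR₃, fun κ hκ => ?_⟩
      · rw [hr, Ne, ofNat_eq_zero hB (by assumption)]; exact h0
      · have h3 := hk₃ κ hκ
        simp only [Cmd.slow] at hκ
        have h2 := hk₂ κ (by omega)
        simp only [St.tick_t] at *; rw [mul_add] at h2; omega
    exact ⟨hL, fun s hR => hL.compile_spec hB he hR⟩

theorem Runs.compile_spec {c : Cmd} {σ σ' : St} (h : Runs B c σ σ') {s : State w}
    (hR : Rep B s σ) : ∃ s' t, Det c.compile s s' t ∧ Rep B s' σ' ∧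
      ∀ κ, c.slow ≤ κ → t + κ * σ.t ≤ κ * σ'.t :=
  (h.compile_aux hB).2 s hR

end

end WordRAM.HL

namespace ANSC

/-! ### Cycles and breadth-first search trees -/

/-- There is a walk of length at most `r` from `x` to `y`. -/
def Near (G : SimpleGraph ℕ) (x y r : ℕ) : Prop := ∃ p : G.Walk x y, p.length ≤ r

/-- There is a cycle of length at most `ℓ` through `u`. -/
def CycleLe (G : SimpleGraph ℕ) (u ℓ : ℕ) : Prop := ∃ p : G.Walk u u, p.IsCycle ∧ p.length ≤ ℓ

theorem CycleLe.mono {G : SimpleGraph ℕ} {u ℓ ℓ' : ℕ} (h : CycleLe G u ℓ) (hl : ℓ ≤ ℓ') :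
    CycleLe G u ℓ' := by
  obtain ⟨p, h1, h2⟩ := h
  exact ⟨p, h1, h2.trans hl⟩

theorem CycleLe.mono_graph {G H : SimpleGraph ℕ} (hGH : G ≤ H) {u ℓ : ℕ} (h : CycleLe G u ℓ) :
    CycleLe H u ℓ := by
  obtain ⟨p, h1, h2⟩ := h
  exact ⟨p.mapLe hGH, (SimpleGraph.Walk.isCycle_mapLe hGH).2 h1, by simpa using h2⟩

/-- Shortcut the walk to a path by `bypass` and close it at `u`. All cycles of the proof are
produced in this way, so walks need not be simple. -/
theorem cycleLe_of_detour {G : SimpleGraph ℕ} {u x y : ℕ} (hx : G.Adj u x) (hy : G.Adj u y)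
    (hxy : x ≠ y) (q : G.Walk x y) (hq : u ∉ q.support) : CycleLe G u (q.length + 2) := by
  classical
  have hb : u ∉ q.bypass.support := fun h => hq (q.support_bypass_subset_support h)
  refine ⟨.cons hx (q.bypass.concat hy.symm), ?_, ?_⟩
  · rw [SimpleGraph.Walk.cons_isCycle_iff]
    refine ⟨(q.bypass_isPath).concat hb hy.symm, ?_⟩
    rw [SimpleGraph.Walk.edges_concat, List.concat_eq_append, List.mem_append]
    rintro (h | h)
    · exact hb (q.bypass.fst_mem_support_of_mem_edges h)
    · simp only [List.mem_singleton, Sym2.eq_iff] at h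
      rcases h with ⟨h1, h2⟩ | ⟨h1, h2⟩
      · exact hy.ne h1
      · exact hxy h2
  · simp only [SimpleGraph.Walk.length_cons, SimpleGraph.Walk.length_concat]
    have := q.length_bypass_le_length
    omega

theorem exists_walks_of_mem_darts {G : SimpleGraph ℕ} {x y : ℕ} (q : G.Walk x y) (d : G.Dart)
    (hd : d ∈ q.darts) : ∃ (p₁ : G.Walk x d.fst) (p₂ : G.Walk d.snd y),
      p₁.length + p₂.length + 1 = q.length := by
  induction q with
  | nil => simp at hd
  | @cons u v w h q ih =>
    rw [SimpleGraph.Walk.darts_cons, List.mem_cons] at hd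
    rcases hd with rfl | hd
    · exact ⟨.nil, q, by simp⟩
    · obtain ⟨p₁, p₂, hp⟩ := ih hd
      exact ⟨.cons h p₁, p₂, by simp only [SimpleGraph.Walk.length_cons]; omega⟩

/-- Rotate the closed walk to start at `x`. -/
theorem exists_walks_of_closed {G : SimpleGraph ℕ} {v x : ℕ} (p : G.Walk v v) (hx : x ∈ p.support)
    (d : G.Dart) (hd : d ∈ p.darts) : ∃ (p₁ : G.Walk x d.fst) (p₂ : G.Walk d.snd x),
      p₁.length + p₂.length + 1 = p.length := by
  have hd' : d ∈ (p.rotate x hx).darts := (p.rotate_darts x hx).mem_iff.2 hd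
  obtain ⟨p₁, p₂, h⟩ := exists_walks_of_mem_darts _ d hd'
  exact ⟨p₁, p₂, by rw [h, SimpleGraph.Walk.length_rotate]⟩

/-- A breadth-first search tree for the component of `root`, with depths `D` and parents `P`. -/
structure IsBFSTree (G : SimpleGraph ℕ) (root : ℕ) (Vis : ℕ → Prop) (D P : ℕ → ℕ) : Prop where
  vis_root : Vis root
  D_root : D root = 0
  -- With this default value the iterates of `P` are total and stop at the root.
  P_root : P root = root
  par : ∀ y, Vis y → y ≠ root → Vis (P y) ∧ G.Adj (P y) y ∧ D y = D (P y) + 1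
  adj : ∀ a b, Vis a → G.Adj a b → Vis b ∧ D b ≤ D a + 1

namespace IsBFSTree

variable {G : SimpleGraph ℕ} {root : ℕ} {Vis : ℕ → Prop} {D P : ℕ → ℕ}
  (h : IsBFSTree G root Vis D P)
include h

theorem vis_P {y : ℕ} (hy : Vis y) : Vis (P y) := by
  by_cases hr : y = root
  · rw [hr, h.P_root]; exact h.vis_root
  · exact (h.par y hy hr).1

theorem vis_iter {y : ℕ} (hy : Vis y) (i : ℕ) : Vis (P^[i] y) := by
  induction i with
  | zero => exact hy
  | succ i ih => rw [Function.iterate_succ_apply']; exact h.vis_P ih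

theorem eq_root {y : ℕ} (hy : Vis y) (hD : D y = 0) : y = root := by
  by_contra hr
  have := (h.par y hy hr).2.2
  omega

theorem D_P {y : ℕ} (hy : Vis y) : D (P y) = D y - 1 := by
  by_cases hr : y = root
  · rw [hr, h.P_root, h.D_root]
  · have := (h.par y hy hr).2.2
    omega

theorem D_iter {y : ℕ} (hy : Vis y) (i : ℕ) : D (P^[i] y) = D y - i := by
  induction i with
  | zero => rfl
  | succ i ih => rw [Function.iterate_succ_apply', h.D_P (h.vis_iter hy i), ih]; omega

theorem iter_eq_root {y : ℕ} (hy : Vis y) {i : ℕ} (hi : D y ≤ i) : P^[i] y = root :=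
  h.eq_root (h.vis_iter hy i) (by rw [h.D_iter hy]; omega)

theorem exists_climb {y : ℕ} (hy : Vis y) {i : ℕ} (hi : i ≤ D y) :
    ∃ p : G.Walk y (P^[i] y), p.length = i ∧ ∀ z ∈ p.support, ∃ i' ≤ i, z = P^[i'] y := by
  induction i with
  | zero => exact ⟨.nil, rfl, by simp⟩
  | succ i ih =>
    obtain ⟨p, hp, hs⟩ := ih (by omega)
    have hr : P^[i] y ≠ root := by
      intro hr
      have := h.D_iter hy i
      rw [hr, h.D_root] at this
      omega
    have ha := (h.par _ (h.vis_iter hy i) hr).2.1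
    rw [← Function.iterate_succ_apply' P] at ha
    refine ⟨p.concat ha.symm, (SimpleGraph.Walk.length_concat _ _).trans (by rw [hp]), ?_⟩
    intro z hz
    rw [SimpleGraph.Walk.support_concat, List.mem_append, List.mem_singleton] at hz
    rcases hz with hz | hz
    · obtain ⟨i', hi', he⟩ := hs z hz
      exact ⟨i', by omega, he⟩
    · exact ⟨i + 1, le_rfl, hz⟩

theorem D_le_length {x y : ℕ} (p : G.Walk x y) (hx : Vis x) : Vis y ∧ D y ≤ D x + p.length := by
  induction p with
  | nil => exact ⟨hx, by simp⟩
  | cons ha p ih =>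
    obtain ⟨h1, h2⟩ := h.adj _ _ hx ha
    obtain ⟨h3, h4⟩ := ih h1
    exact ⟨h3, by rw [SimpleGraph.Walk.length_cons]; omega⟩

/-- Vertices of the tree path from `a` to `b`, except the top, are on the fundamental cycle. -/
theorem cycleLe_of_side {a b u i : ℕ} (ha : Vis a) (hab : G.Adj a b) (hPa : P a ≠ b)
    (hu : P^[i] a = u) (hub : ∀ i', P^[i'] b ≠ u) : CycleLe G u (D a + D b + 1) := by
  have hb : Vis b := (h.adj a b ha hab).1
  have hur : u ≠ root := fun e => hub (D b) (by rw [h.iter_eq_root hb le_rfl, e])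
  have huv : Vis u := hu ▸ h.vis_iter ha i
  have hDu : D u = D a - i := hu ▸ h.D_iter ha i
  obtain ⟨hPv, hPadj, hPD⟩ := h.par u huv hur
  obtain ⟨q₁, hl₁, hs₁⟩ : ∃ p : G.Walk b root, p.length = D b ∧
      ∀ z ∈ p.support, ∃ i' ≤ D b, z = P^[i'] b := by
    have := h.exists_climb hb (le_refl (D b))
    rwa [h.iter_eq_root hb le_rfl] at this
  obtain ⟨q₂, hl₂, hs₂⟩ : ∃ p : G.Walk (P u) root, p.length = D (P u) ∧
      ∀ z ∈ p.support, ∃ i' ≤ D (P u), z = P^[i'] (P u) := by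
    have := h.exists_climb hPv (le_refl (D (P u)))
    rwa [h.iter_eq_root hPv le_rfl] at this
  have hav₁ : u ∉ q₁.support := fun hm => by
    obtain ⟨i', -, he⟩ := hs₁ u hm
    exact hub i' he.symm
  have hav₂ : u ∉ q₂.support := fun hm => by
    obtain ⟨i', -, he⟩ := hs₂ u hm
    have := h.D_iter hPv i'
    rw [← he] at this
    omega
  -- The detour goes from `b` to the root and down to `P u`. It avoids `u`, since `u` is no ancestor
  -- of `b` and the ancestors of `P u` are less deep than `u`. Passing the lowest common ancestor is
  -- harmless: only the bound `D a + D b + 1` is wanted.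
  let q := q₁.append q₂.reverse
  have hq : u ∉ q.support := by
    rw [SimpleGraph.Walk.mem_support_append_iff, SimpleGraph.Walk.support_reverse,
      List.mem_reverse]
    exact not_or.2 ⟨hav₁, hav₂⟩
  have hql : q.length = D b + D (P u) := by
    simp only [q, SimpleGraph.Walk.length_append, SimpleGraph.Walk.length_reverse, hl₁, hl₂]
  -- The two neighbours of `u` on the cycle are `P u` and, on the other side, `b` itself if `u = a`,
  -- and otherwise the child of `u` on the way to `a`.
  rcases i with _ | i
  · have : a = u := hu
    subst this
    exact (cycleLe_of_detour hab hPadj.symm (fun e => hPa e.symm) q hq).mono (by omega)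
  · have hi : i + 1 ≤ D a := by
      by_contra hcon
      exact hur (h.eq_root huv (by omega))
    obtain ⟨q₃, hl₃, hs₃⟩ := h.exists_climb ha (i := i) (by omega)
    have hPx : P (P^[i] a) = u := by rw [← Function.iterate_succ_apply' P]; exact hu
    have hxr : P^[i] a ≠ root := fun e => hur (by rw [← hPx, e, h.P_root])
    have hx := h.par _ (h.vis_iter ha i) hxr
    rw [hPx] at hx
    let q' := q₃.reverse.append (.cons hab q)
    have hq' : u ∉ q'.support := by
      rw [SimpleGraph.Walk.mem_support_append_iff, SimpleGraph.Walk.support_reverse,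
        List.mem_reverse, SimpleGraph.Walk.support_cons, List.mem_cons]
      refine not_or.2 ⟨fun hm => ?_, not_or.2 ⟨fun e => ?_, hq⟩⟩
      · obtain ⟨i', hi', he⟩ := hs₃ u hm
        have := h.D_iter ha i'
        rw [← he] at this
        omega
      · subst e; omega
    refine (cycleLe_of_detour hx.2.1 hPadj.symm (fun e => ?_) q' hq').mono ?_
    · have : D (P^[i] a) = D (P u) := by rw [e]
      omega
    · simp only [q', SimpleGraph.Walk.length_append, SimpleGraph.Walk.length_reverse,
        SimpleGraph.Walk.length_cons, hl₃, hql]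
      omega

/-- The top of the tree path from `a` to `b` is on the fundamental cycle. -/
theorem cycleLe_of_top {a b i i' : ℕ} (ha : Vis a) (hab : G.Adj a b)
    (hne : P^[i] a ≠ P^[i'] b) (hP : P (P^[i] a) = P (P^[i'] b)) (hia : i < D a) (hib : i' < D b) :
    CycleLe G (P (P^[i] a)) (D a + D b + 1) := by
  have hb : Vis b := (h.adj a b ha hab).1
  have hDx := h.D_iter ha i
  have hDy := h.D_iter hb i'
  have hxr : P^[i] a ≠ root := fun e => by rw [e, h.D_root] at hDx; omega
  have hyr : P^[i'] b ≠ root := fun e => by rw [e, h.D_root] at hDy; omega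
  obtain ⟨-, hx, hx'⟩ := h.par _ (h.vis_iter ha i) hxr
  obtain ⟨-, hy, hy'⟩ := h.par _ (h.vis_iter hb i') hyr
  obtain ⟨q₁, hl₁, hs₁⟩ := h.exists_climb ha hia.le
  obtain ⟨q₂, hl₂, hs₂⟩ := h.exists_climb hb hib.le
  rw [← hP] at hy hy'
  refine (cycleLe_of_detour hx hy hne (q₁.reverse.append (.cons hab q₂)) ?_).mono ?_
  · rw [SimpleGraph.Walk.mem_support_append_iff, SimpleGraph.Walk.support_reverse,
      List.mem_reverse, SimpleGraph.Walk.support_cons, List.mem_cons]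
    have key : P (P^[i] a) ∉ q₁.support := fun hm => by
      obtain ⟨j, hj, he⟩ := hs₁ _ hm
      have := h.D_iter ha j
      rw [← he] at this
      omega
    refine not_or.2 ⟨key, not_or.2 ⟨fun e => key (by rw [e]; exact q₁.start_mem_support),
      fun hm => ?_⟩⟩
    obtain ⟨j, hj, he⟩ := hs₂ _ hm
    have := h.D_iter hb j
    rw [← he] at this
    omega
  · simp only [SimpleGraph.Walk.length_append, SimpleGraph.Walk.length_reverse,
        SimpleGraph.Walk.length_cons, hl₁, hl₂]
    omega

/-- Every vertex `v` of a cycle is on the fundamental cycle of an edge of the cycle. -/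
theorem exists_fundamental {v x r : ℕ} (p : G.Walk v v) (hp : p.IsCycle) (hx : x ∈ p.support)
    (hr : Near G root x r) :
    ∃ a b, Vis a ∧ G.Adj a b ∧ P a ≠ b ∧ P b ≠ a ∧ D a + D b + 1 ≤ p.length + 2 * r ∧
      ∃ c, (∃ i, P^[i] a = c) ∧ (∀ i, P^[i] b ≠ c) ∧ (v = c ∨ v = P c) := by
  obtain ⟨p₀, hp₀⟩ := hr
  -- From the root to `x`, then both ways around the cycle to the ends of `d`: the two walks have
  -- total length at most `p.length - 1 + 2 * r`.
  have hdart : ∀ d ∈ p.darts, Vis d.fst ∧ Vis d.snd ∧ D d.fst + D d.snd + 1 ≤ p.length + 2 * r := by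
    intro d hd
    obtain ⟨p₁, p₂, hl⟩ := exists_walks_of_closed p hx d hd
    obtain ⟨h1, h2⟩ := h.D_le_length (p₀.append p₁) h.vis_root
    obtain ⟨h3, h4⟩ := h.D_le_length (p₀.append p₂.reverse) h.vis_root
    rw [h.D_root, SimpleGraph.Walk.length_append] at h2 h4
    rw [SimpleGraph.Walk.length_reverse] at h4
    exact ⟨h1, h3, by omega⟩
  cases p with
  | nil => exact absurd hp SimpleGraph.Walk.not_isCycle_nil
  | @cons _ y _ hvy q =>
    rw [SimpleGraph.Walk.cons_isCycle_iff] at hp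
    obtain ⟨hv, hy, hw⟩ := hdart ⟨(v, y), hvy⟩ (by simp)
    simp only at hv hy hw
    -- The only tree edge that leaves the subtree of `c` is the one from `c` to `c' = P c`. A walk
    -- from `c` to `c'` without this edge must leave the subtree by a non-tree edge, which has
    -- exactly one end below `c`.
    have crossing : ∀ (c c' : ℕ) (q' : G.Walk c c'), P c = c' → c ≠ c' → Vis c → D c = D c' + 1 →
        s(c, c') ∉ q'.edges →
        (∀ d ∈ q'.darts, Vis d.fst ∧ Vis d.snd ∧ D d.fst + D d.snd + 1 ≤
          (SimpleGraph.Walk.cons hvy q).length + 2 * r) →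
        ∃ a b, Vis a ∧ G.Adj a b ∧ P a ≠ b ∧ P b ≠ a ∧
          D a + D b + 1 ≤ (SimpleGraph.Walk.cons hvy q).length + 2 * r ∧
          (∃ i, P^[i] a = c) ∧ (∀ i, P^[i] b ≠ c) := by
      intro c c' q' hPc hne hc hD hedge hq'
      have hc' : Vis c' := hPc ▸ h.vis_P hc
      obtain ⟨d, hd, hd1, hd2⟩ := q'.exists_boundary_dart {z | ∃ i, P^[i] z = c} ⟨0, rfl⟩
        (by
          rintro ⟨i, hi⟩
          have := h.D_iter hc' i
          rw [hi] at this
          omega)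
      obtain ⟨h1, h2, h3⟩ := hq' d hd
      refine ⟨d.fst, d.snd, h1, d.adj, ?_, ?_, h3, hd1, fun i hi => hd2 ⟨i, hi⟩⟩
      · intro e
        obtain ⟨i, hi⟩ := hd1
        rcases i with _ | i
        · have e1 : d.fst = c := hi
          rw [e1, hPc] at e
          refine hedge ?_
          have : d.edge = s(c, c') := by
            rw [← e1, e]; rfl
          rw [← this]
          exact List.mem_map_of_mem hd
        · rw [Function.iterate_succ_apply, e] at hi
          exact hd2 ⟨i, hi⟩
      · intro e
        obtain ⟨i, hi⟩ := hd1
        exact hd2 ⟨i + 1, by rw [Function.iterate_succ_apply, e, hi]⟩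
    -- Consider the first edge `vy` of the cycle. If it is a tree edge, the rest of the cycle leaves
    -- the subtree of its lower end, which is `c`; so `v` is `P c` or `c`, according to which end is
    -- lower.
    by_cases h1 : P y = v
    · have hyr : y ≠ root := fun e => hvy.ne (by rw [← h1, e, h.P_root])
      obtain ⟨a, b, r1, r2, r3, r4, r5, r6, r7⟩ := crossing y v q h1 hvy.ne.symm hy
        (by rw [(h.par y hy hyr).2.2, h1]) (by rw [Sym2.eq_swap]; exact hp.2)
        (fun d hd => hdart d (by simp [hd]))
      exact ⟨a, b, r1, r2, r3, r4, r5, y, r6, r7, .inr h1.symm⟩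
    by_cases h2 : P v = y
    · have hvr : v ≠ root := fun e => hvy.ne (by rw [← h2, e, h.P_root])
      obtain ⟨a, b, r1, r2, r3, r4, r5, r6, r7⟩ := crossing v y q.reverse h2 hvy.ne hv
        (by rw [(h.par v hv hvr).2.2, h2])
        (by rw [SimpleGraph.Walk.edges_reverse, List.mem_reverse]; exact hp.2)
        (fun d hd => by
          rw [SimpleGraph.Walk.mem_darts_reverse] at hd
          obtain ⟨k1, k2, k3⟩ := hdart d.symm (by simp [hd])
          simp only [SimpleGraph.Dart.symm] at k1 k2 k3
          exact ⟨k2, k1, by simp only [Prod.fst_swap, Prod.snd_swap] at k3; omega⟩)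
      exact ⟨a, b, r1, r2, r3, r4, r5, v, r6, r7, .inl rfl⟩
    -- Now `vy` is itself a non-tree edge. Since `D y ≤ D v + 1`, the vertex `v` could only be an
    -- ancestor of `y` by being equal to `y` or to its parent.
    · refine ⟨v, y, hv, hvy, h2, h1, hw, v, ⟨0, rfl⟩, ?_, .inl rfl⟩
      intro i hi
      have hD := h.D_iter hy i
      have hle := (h.adj v y hv hvy).2
      rw [hi] at hD
      rcases i with _ | i
      · exact hvy.ne hi.symm
      · rw [Function.iterate_succ_apply] at hi
        rcases Nat.eq_zero_or_pos (D y) with h0 | h0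
        · have := h.eq_root hy h0
          rw [this, h.P_root, Function.iterate_fixed h.P_root] at hi
          exact hvy.ne (by rw [this, hi])
        · by_cases hi0 : i = 0
          · subst hi0; exact h1 hi
          · have hv0 : v = root := h.eq_root hv (by omega)
            have : P y = root := h.eq_root (h.vis_P hy) (by rw [h.D_P hy]; omega)
            exact h1 (by rw [this, hv0])

end IsBFSTree

end ANSC

namespace ANSC

/-! ### Graphs given by lists of directed edges -/

/-- A list of directed edges, the slots `1, …, cnt`. -/
structure Slots where
  cnt : ℕ
  src : ℕ → ℕ
  tgt : ℕ → ℕ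

/-- `q` is a slot of `S`. -/
def Slots.Mem (S : Slots) (q : ℕ) : Prop := 1 ≤ q ∧ q ≤ S.cnt

/-- The slots describe a simple graph on `0, …, n - 1`, each edge occurring in both directions. -/
structure Slots.Good (S : Slots) (n : ℕ) : Prop where
  src_lt : ∀ q, S.Mem q → S.src q < n
  ne : ∀ q, S.Mem q → S.src q ≠ S.tgt q
  symm : ∀ q, S.Mem q → ∃ q', S.Mem q' ∧ S.src q' = S.tgt q ∧ S.tgt q' = S.src q

theorem Slots.Good.tgt_lt {S : Slots} {n : ℕ} (h : S.Good n) {q : ℕ} (hq : S.Mem q) :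
    S.tgt q < n := by
  obtain ⟨q', h1, h2, -⟩ := h.symm q hq
  exact h2 ▸ h.src_lt q' h1

/-- The graph that is described by the slots. -/
def Slots.graph (S : Slots) : SimpleGraph ℕ :=
  SimpleGraph.fromRel fun a b => ∃ q, S.Mem q ∧ S.src q = a ∧ S.tgt q = b

theorem Slots.Good.adj_iff {S : Slots} {n : ℕ} (h : S.Good n) {a b : ℕ} :
    S.graph.Adj a b ↔ ∃ q, S.Mem q ∧ S.src q = a ∧ S.tgt q = b := by
  rw [Slots.graph, SimpleGraph.fromRel_adj]
  constructor
  · rintro ⟨-, h1 | ⟨q, h1, h2, h3⟩⟩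
    · exact h1
    · obtain ⟨q', h4, h5, h6⟩ := h.symm q h1
      exact ⟨q', h4, h5.trans h3, h6.trans h2⟩
  · rintro ⟨q, h1, rfl, rfl⟩
    exact ⟨h.ne q h1, .inl ⟨q, h1, rfl, rfl⟩⟩

/-- Linked lists of the slots with given source, in decreasing order. -/
structure Chain (c : ℕ) (src hd nx : ℕ → ℕ) : Prop where
  -- Slots are numbered from 1, and 0 is the null pointer. The two maximality conditions say that
  -- the lists omit nothing.
  hd_src : ∀ u, hd u ≠ 0 → hd u ≤ c ∧ src (hd u) = u
  hd_max : ∀ q, 1 ≤ q → q ≤ c → q ≤ hd (src q)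
  nx_src : ∀ q, 1 ≤ q → q ≤ c → nx q < q ∧ (nx q ≠ 0 → src (nx q) = src q)
  nx_max : ∀ q q', q ≤ c → 1 ≤ q' → q' < q → src q' = src q → q' ≤ nx q

theorem Chain.zero {src hd nx : ℕ → ℕ} (h : ∀ u, hd u = 0) : Chain 0 src hd nx :=
  ⟨fun u hu => absurd (h u) hu, fun q h1 h2 => by omega, fun q h1 h2 => by omega,
    fun q q' h1 h2 h3 => by omega⟩

/-- The new slot has the largest number, so it is put in front of the list of its source. -/
theorem Chain.succ {c : ℕ} {src hd nx : ℕ → ℕ} (h : Chain c src hd nx) :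
    Chain (c + 1) src (Function.update hd (src (c + 1)) (c + 1))
      (Function.update nx (c + 1) (hd (src (c + 1)))) := by
  refine ⟨fun u hu => ?_, fun q h1 h2 => ?_, fun q h1 h2 => ?_, fun q q' h1 h2 h3 h4 => ?_⟩
  · by_cases hus : u = src (c + 1)
    · subst hus; simp
    · rw [Function.update_of_ne hus] at hu ⊢
      exact ⟨(h.hd_src u hu).1.trans (Nat.le_succ c), (h.hd_src u hu).2⟩
  · by_cases hus : src q = src (c + 1)
    · rw [hus, Function.update_self]; exact h2
    · rw [Function.update_of_ne hus]
      refine h.hd_max q h1 ?_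
      by_contra hcon
      exact hus (by rw [show q = c + 1 by omega])
  · by_cases hq : q = c + 1
    · subst hq
      rw [Function.update_self]
      by_cases h0 : hd (src (c + 1)) = 0
      · omega
      · have := h.hd_src _ h0
        exact ⟨by omega, fun _ => this.2⟩
    · rw [Function.update_of_ne hq]
      exact h.nx_src q h1 (by omega)
  · by_cases hq : q = c + 1
    · subst hq
      rw [Function.update_self, ← h4]
      exact h.hd_max q' h2 (by omega)
    · rw [Function.update_of_ne hq]
      exact h.nx_max q q' (by omega) h2 h3 h4

/-! ### Breadth-first search -/

/-- The variables of breadth-first search: stamps of visited vertices, depths, parents, the queue,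
the list of scanned slots, the bounds of the queue, the number of scanned slots, the next slot. -/
structure BFSState where
  vis : ℕ → ℕ
  D : ℕ → ℕ
  P : ℕ → ℕ
  Q : ℕ → ℕ
  SL : ℕ → ℕ
  qh : ℕ
  qt : ℕ
  c : ℕ
  p : ℕ

/-- The slot `q` has been scanned. -/
def BFSState.Scanned (b : BFSState) (S : Slots) (q : ℕ) : Prop :=
  -- The lists are decreasing, so at the front of the queue the slots already scanned are those
  -- above the pointer `p`.
  (∃ i < b.qh, S.src q = b.Q i) ∨ (b.qh < b.qt ∧ S.src q = b.Q b.qh ∧ b.p < q)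

/-- The first `qt` entries of `Q` are the visited vertices, by nondecreasing depth (`mono`) and
never more than one level beyond the front (`front`); `SL` lists exactly the scanned slots, at most
`lim` of them. A vertex is visited if its stamp is the current one, so `vis` need not be cleared
between searches. `D_le` serves to bound depths by the number of vertices. -/
structure BFSInv (S : Slots) (n lim root st : ℕ) (b : BFSState) : Prop where
  qt_pos : 1 ≤ b.qt
  qh_le : b.qh ≤ b.qt
  Q_zero : b.Q 0 = root
  Q_lt : ∀ i < b.qt, b.Q i < n
  vis_iff : ∀ y, b.vis y = st ↔ ∃ i < b.qt, b.Q i = y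
  vis_le : ∀ y, b.vis y ≤ st
  Q_inj : ∀ i < b.qt, ∀ j < b.qt, b.Q i = b.Q j → i = j
  mono : ∀ j < b.qt, ∀ i ≤ j, b.D (b.Q i) ≤ b.D (b.Q j)
  front : b.qh < b.qt → ∀ i < b.qt, b.D (b.Q i) ≤ b.D (b.Q b.qh) + 1
  D_root : b.D root = 0
  P_root : b.P root = root
  tree : ∀ i < b.qt, 0 < i → ∃ i' < b.qt, b.P (b.Q i) = b.Q i' ∧ b.D (b.Q i) = b.D (b.Q i') + 1 ∧
    ∃ q, S.Mem q ∧ S.src q = b.Q i' ∧ S.tgt q = b.Q i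
  cur : b.p ≠ 0 → b.qh < b.qt ∧ b.p ≤ S.cnt ∧ S.src b.p = b.Q b.qh
  done : ∀ q, S.Mem q → b.Scanned S q → ∃ j < b.c, b.SL j = q
  SL_spec : ∀ j < b.c, S.Mem (b.SL j) ∧ b.Scanned S (b.SL j) ∧ b.vis (S.tgt (b.SL j)) = st ∧
    b.D (S.tgt (b.SL j)) ≤ b.D (S.src (b.SL j)) + 1
  SL_inj : ∀ i < b.c, ∀ j < b.c, b.SL i = b.SL j → i = j
  c_le : b.c ≤ lim
  D_le : ∀ i < b.qt, b.D (b.Q i) ≤ i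

theorem bfsInv_init {S : Slots} {n lim root st : ℕ} {hd nx : ℕ → ℕ}
    (hC : Chain S.cnt S.src hd nx) (hroot : root < n) (vis D P Q SL : ℕ → ℕ)
    (hvis : ∀ y, vis y < st) :
    BFSInv S n lim root st ⟨Function.update vis root st, Function.update D root 0,
      Function.update P root root, Function.update Q 0 root, SL, 0, 1, 0, hd root⟩ := by
  constructor <;> simp only [Nat.lt_one_iff, forall_eq, Function.update_self, le_refl, zero_le,
    Nat.not_lt_zero, false_imp_iff, implies_true, hroot]
  · intro y
    by_cases h : y = root
    · subst h; simp
    · rw [Function.update_of_ne h]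
      simp [(hvis y).ne, Ne.symm h]
  · intro y
    by_cases h : y = root
    · subst h; simp
    · rw [Function.update_of_ne h]; exact (hvis y).le
  · intro i hi
    rw [Nat.le_zero.1 hi, Function.update_self, Function.update_self]
  · exact fun h0 => ⟨trivial, hC.hd_src root h0⟩
  · rintro q hq (⟨i, hi, -⟩ | ⟨-, h1, h2⟩)
    · exact absurd hi (Nat.not_lt_zero i)
    · simp only [Function.update_self] at h1 h2
      have := hC.hd_max q hq.1 hq.2
      rw [h1] at this
      omega

section

variable {S : Slots} {n lim root st : ℕ} {hd nx : ℕ → ℕ} {b : BFSState}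

theorem BFSInv.mem_p (h : BFSInv S n lim root st b) (hp : b.p ≠ 0) : S.Mem b.p :=
  ⟨Nat.one_le_iff_ne_zero.2 hp, (h.cur hp).2.1⟩

/-- By `front`, the depth given to the new vertex is at least all existing depths, so it may stand
at the end of the queue. No scanned slot touches the new vertex, so facts about scanned slots
persist. -/
theorem BFSInv.enqueue (hS : S.Good n) (h : BFSInv S n lim root st b) (hp : b.p ≠ 0)
    (hy : b.vis (S.tgt b.p) ≠ st) :
    BFSInv S n lim root st { b with
      vis := Function.update b.vis (S.tgt b.p) st
      D := Function.update b.D (S.tgt b.p) (b.D (b.Q b.qh) + 1)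
      P := Function.update b.P (S.tgt b.p) (b.Q b.qh)
      Q := Function.update b.Q b.qt (S.tgt b.p)
      qt := b.qt + 1 } := by
  obtain ⟨hlt, hpc, hsrc⟩ := h.cur hp
  have hmem := h.mem_p hp
  set y := S.tgt b.p with hydef
  have hyQ : ∀ i < b.qt, b.Q i ≠ y := fun i hi e => hy ((h.vis_iff y).2 ⟨i, hi, e⟩)
  have eQ : ∀ i < b.qt, Function.update b.Q b.qt y i = b.Q i := fun i hi =>
    Function.update_of_ne hi.ne _ _
  have eD : ∀ z, z ≠ y → Function.update b.D y (b.D (b.Q b.qh) + 1) z = b.D z := fun z hz =>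
    Function.update_of_ne hz _ _
  have eDQ : ∀ i < b.qt, Function.update b.D y (b.D (b.Q b.qh) + 1) (b.Q i) = b.D (b.Q i) :=
    fun i hi => eD _ (hyQ i hi)
  have hroot : root ≠ y := by rw [← h.Q_zero]; exact hyQ 0 h.qt_pos
  have hsc : ∀ q, BFSState.Scanned { b with
      vis := Function.update b.vis y st
      D := Function.update b.D y (b.D (b.Q b.qh) + 1)
      P := Function.update b.P y (b.Q b.qh)
      Q := Function.update b.Q b.qt y
      qt := b.qt + 1 } S q ↔ b.Scanned S q := by
    intro q
    simp only [BFSState.Scanned, eQ _ hlt]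
    refine or_congr ⟨?_, ?_⟩ ⟨?_, ?_⟩
    · rintro ⟨i, hi, e⟩; exact ⟨i, hi, by rwa [eQ i (by omega)] at e⟩
    · rintro ⟨i, hi, e⟩; exact ⟨i, hi, by rwa [eQ i (by omega)]⟩
    · rintro ⟨-, h2⟩; exact ⟨hlt, h2⟩
    · rintro ⟨-, h2⟩; exact ⟨by omega, h2⟩
  have hvis : ∀ z, Function.update b.vis y st z = st ↔ z = y ∨ b.vis z = st := by
    intro z
    rw [Function.update_apply]
    split_ifs with hz <;> simp [hz]
  constructor
  · exact Nat.le_succ_of_le h.qt_pos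
  · exact Nat.le_succ_of_le h.qh_le
  · simp only [eQ 0 h.qt_pos]; exact h.Q_zero
  · intro i hi
    by_cases hi' : i = b.qt
    · subst hi'; simp only [Function.update_self]; exact hS.tgt_lt hmem
    · have hi2 : i < b.qt := by simp only at hi; omega
      simp only [eQ i hi2]; exact h.Q_lt i hi2
  · intro z
    simp only
    rw [hvis, h.vis_iff]
    constructor
    · rintro (rfl | ⟨i, hi, rfl⟩)
      · exact ⟨b.qt, Nat.lt_succ_self _, Function.update_self _ _ _⟩
      · exact ⟨i, Nat.lt_succ_of_lt hi, eQ i hi⟩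
    · rintro ⟨i, hi, rfl⟩
      by_cases hi' : i = b.qt
      · subst hi'; exact .inl (Function.update_self _ _ _)
      · have hi2 : i < b.qt := by omega
        exact .inr ⟨i, hi2, (eQ i hi2).symm⟩
  · intro z
    simp only [Function.update_apply]
    split_ifs
    · exact le_rfl
    · exact h.vis_le z
  · intro i hi j hj e
    simp only at hi hj e
    by_cases hi' : i = b.qt <;> by_cases hj' : j = b.qt
    · omega
    · rw [hi', Function.update_self, eQ j (by omega)] at e
      exact absurd e.symm (hyQ j (by omega))
    · rw [hj', Function.update_self, eQ i (by omega)] at e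
      exact absurd e (hyQ i (by omega))
    · rw [eQ i (by omega), eQ j (by omega)] at e
      exact h.Q_inj i (by omega) j (by omega) e
  · intro j hj i hi
    simp only at hj ⊢
    by_cases hj' : j = b.qt
    · subst hj'
      rw [Function.update_self, Function.update_self]
      by_cases hi' : i = b.qt
      · subst hi'; rw [Function.update_self, Function.update_self]
      · rw [eQ i (by omega), eDQ i (by omega)]
        exact h.front hlt i (by omega)
    · rw [eQ i (by omega), eQ j (by omega), eDQ i (by omega), eDQ j (by omega)]
      exact h.mono j (by omega) i hi
  · intro _ i hi
    simp only at hi ⊢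
    rw [eQ _ hlt, eDQ _ hlt]
    by_cases hi' : i = b.qt
    · subst hi'; rw [Function.update_self, Function.update_self]
    · rw [eQ i (by omega), eDQ i (by omega)]
      exact h.front hlt i (by omega)
  · simp only [eD root hroot]; exact h.D_root
  · simp only [Function.update_of_ne hroot]; exact h.P_root
  · intro i hi hi0
    simp only at hi ⊢
    by_cases hi' : i = b.qt
    · subst hi'
      refine ⟨b.qh, by omega, ?_⟩
      simp only [Function.update_self, eQ _ hlt, eDQ _ hlt, true_and]
      exact ⟨b.p, hmem, hsrc, rfl⟩
    · obtain ⟨i', h1, h2, h3, h4⟩ := h.tree i (by omega) hi0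
      refine ⟨i', by omega, ?_⟩
      rw [eQ i (by omega), eQ i' h1, eDQ i (by omega), eDQ i' h1,
        Function.update_of_ne (hyQ i (by omega))]
      exact ⟨h2, h3, h4⟩
  · intro hp'
    simp only [eQ _ hlt]
    exact ⟨by omega, hpc, hsrc⟩
  · intro q hq hs
    exact h.done q hq ((hsc q).1 hs)
  · intro j hj
    obtain ⟨h1, h2, h3, h4⟩ := h.SL_spec j hj
    refine ⟨h1, (hsc _).2 h2, (hvis _).2 (.inr h3), ?_⟩
    simp only
    rw [eD _ (fun e => hy (e ▸ h3)), eD]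
    · exact h4
    · rcases h2 with ⟨i, hi, e⟩ | ⟨-, e, -⟩
      · rw [e]; exact hyQ i (by have := h.qh_le; omega)
      · rw [e]; exact hyQ _ hlt
  · exact h.SL_inj
  · exact h.c_le
  · intro i hi
    simp only at hi ⊢
    by_cases hi' : i = b.qt
    · subst hi'
      rw [Function.update_self, Function.update_self]
      exact Nat.succ_le_of_lt ((h.D_le _ hlt).trans_lt hlt)
    · rw [eQ i (by omega), eDQ i (by omega)]
      exact h.D_le i (by omega)

/-- Moving the pointer to `nx b.p` adds exactly the slot `b.p` to the scanned ones, because no slot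
of the same source lies between. It was unscanned before, as sources in the queue are distinct;
hence `SL` stays injective. -/
theorem BFSInv.scan (hC : Chain S.cnt S.src hd nx) (h : BFSInv S n lim root st b) (hp : b.p ≠ 0)
    (hc : b.c < lim) (hv : b.vis (S.tgt b.p) = st)
    (hD : b.D (S.tgt b.p) ≤ b.D (S.src b.p) + 1) :
    BFSInv S n lim root st { b with
      SL := Function.update b.SL b.c b.p
      c := b.c + 1
      p := nx b.p } := by
  obtain ⟨hlt, hpc, hsrc⟩ := h.cur hp
  have hmem := h.mem_p hp
  obtain ⟨hn1, hn2⟩ := hC.nx_src b.p hmem.1 hmem.2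
  have hsc : ∀ q, S.Mem q → (BFSState.Scanned { b with
      SL := Function.update b.SL b.c b.p
      c := b.c + 1
      p := nx b.p } S q ↔ b.Scanned S q ∨ q = b.p) := by
    intro q hq
    simp only [BFSState.Scanned]
    constructor
    · rintro (h1 | ⟨h1, h2, h3⟩)
      · exact .inl (.inl h1)
      · rcases lt_trichotomy b.p q with h4 | h4 | h4
        · exact .inl (.inr ⟨h1, h2, h4⟩)
        · exact .inr h4.symm
        · have := hC.nx_max b.p q hpc hq.1 h4 (h2.trans hsrc.symm)
          omega
    · rintro ((h1 | ⟨h1, h2, h3⟩) | rfl)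
      · exact .inl h1
      · exact .inr ⟨h1, h2, by omega⟩
      · exact .inr ⟨hlt, hsrc, hn1⟩
  have hnp : ¬ b.Scanned S b.p := by
    rintro (⟨i, hi, e⟩ | ⟨-, -, h3⟩)
    · have := h.Q_inj _ hlt i (by omega) (hsrc.symm.trans e)
      omega
    · omega
  have eSL : ∀ i < b.c, Function.update b.SL b.c b.p i = b.SL i := fun i hi =>
    Function.update_of_ne hi.ne _ _
  refine { h with
    cur := ?_, done := ?_, SL_spec := ?_, SL_inj := ?_, c_le := hc }
  · intro h0
    exact ⟨hlt, by simp only; omega, (hn2 h0).trans hsrc⟩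
  · intro q hq hs
    rcases (hsc q hq).1 hs with hs | rfl
    · obtain ⟨j, hj, e⟩ := h.done q hq hs
      exact ⟨j, Nat.lt_succ_of_lt hj, (eSL j hj).trans e⟩
    · exact ⟨b.c, Nat.lt_succ_self _, Function.update_self _ _ _⟩
  · intro j hj
    simp only at hj ⊢
    by_cases hj' : j = b.c
    · subst hj'
      rw [Function.update_self]
      exact ⟨hmem, (hsc _ hmem).2 (.inr rfl), hv, hD⟩
    · rw [eSL j (by omega)]
      obtain ⟨h1, h2, h3⟩ := h.SL_spec j (by omega)
      exact ⟨h1, (hsc _ h1).2 (.inl h2), h3⟩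
  · intro i hi j hj e
    simp only at hi hj e
    by_cases hi' : i = b.c <;> by_cases hj' : j = b.c
    · omega
    · rw [hi', Function.update_self, eSL j (by omega)] at e
      exact absurd (e ▸ (h.SL_spec j (by omega)).2.1) hnp
    · rw [hj', Function.update_self, eSL i (by omega)] at e
      exact absurd (e ▸ (h.SL_spec i (by omega)).2.1) hnp
    · rw [eSL i (by omega), eSL j (by omega)] at e
      exact h.SL_inj i (by omega) j (by omega) e

/-- An exhausted list means that all slots of the front vertex are scanned, so moving the front on
does not change the set of scanned slots. -/
theorem BFSInv.advance (hC : Chain S.cnt S.src hd nx) (h : BFSInv S n lim root st b)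
    (hp : b.p = 0) (hlt : b.qh < b.qt) (p' : ℕ)
    (hp' : p' = if b.qh + 1 < b.qt then hd (b.Q (b.qh + 1)) else 0) :
    BFSInv S n lim root st { b with qh := b.qh + 1, p := p' } := by
  have hsc : ∀ q, S.Mem q → (BFSState.Scanned { b with qh := b.qh + 1, p := p' } S q ↔
      b.Scanned S q) := by
    intro q hq
    simp only [BFSState.Scanned]
    constructor
    · rintro (⟨i, hi, e⟩ | ⟨h1, h2, h3⟩)
      · by_cases hi' : i = b.qh
        · subst hi'; exact .inr ⟨hlt, e, by rw [hp]; exact hq.1⟩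
        · exact .inl ⟨i, by omega, e⟩
      · rw [hp', if_pos h1] at h3
        have := hC.hd_max q hq.1 hq.2
        rw [h2] at this
        omega
    · rintro (⟨i, hi, e⟩ | ⟨h1, h2, h3⟩)
      · exact .inl ⟨i, by omega, e⟩
      · exact .inl ⟨b.qh, by omega, h2⟩
  refine { h with
    qh_le := hlt, front := ?_, cur := ?_, done := ?_, SL_spec := ?_ }
  · intro h1 i hi
    simp only at h1 ⊢
    exact (h.front hlt i hi).trans (Nat.succ_le_succ (h.mono _ h1 _ (Nat.le_succ _)))
  · intro h0
    simp only at h0 ⊢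
    by_cases h1 : b.qh + 1 < b.qt
    · rw [if_pos h1] at hp'
      have := hC.hd_src _ (hp' ▸ h0)
      rw [hp']
      exact ⟨h1, this⟩
    · rw [if_neg h1] at hp'
      exact absurd hp' h0
  · intro q hq hs
    exact h.done q hq ((hsc q hq).1 hs)
  · intro j hj
    obtain ⟨h1, h2, h3⟩ := h.SL_spec j hj
    exact ⟨h1, (hsc _ h1).2 h2, h3⟩

/-- When the queue is exhausted, the search has produced a breadth-first search tree. -/
theorem BFSInv.isBFSTree (hS : S.Good n) (h : BFSInv S n lim root st b) (hq : b.qh = b.qt) :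
    IsBFSTree S.graph root (fun y => ∃ i < b.qt, b.Q i = y) b.D b.P := by
  refine ⟨⟨0, h.qt_pos, h.Q_zero⟩, h.D_root, h.P_root, ?_, ?_⟩
  · rintro _ ⟨i, hi, rfl⟩ hr
    have hi0 : 0 < i := by
      rcases Nat.eq_zero_or_pos i with rfl | h0
      · exact absurd h.Q_zero hr
      · exact h0
    obtain ⟨i', h1, h2, h3, q, h4, h5, h6⟩ := h.tree i hi hi0
    rw [h2]
    exact ⟨⟨i', h1, rfl⟩, hS.adj_iff.2 ⟨q, h4, h5, h6⟩, h3⟩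
  · rintro _ y ⟨i, hi, rfl⟩ ha
    obtain ⟨q, hq1, hq2, rfl⟩ := hS.adj_iff.1 ha
    obtain ⟨j, hj, rfl⟩ := h.done q hq1 (.inl ⟨i, by omega, hq2⟩)
    obtain ⟨-, -, h3, h4⟩ := h.SL_spec j hj
    rw [hq2] at h4
    exact ⟨(h.vis_iff _).1 h3, h4⟩

/-- Parents lead back to the root, so depths bound distances from above, even if the search was cut
off. -/
theorem BFSInv.near (hS : S.Good n) (h : BFSInv S n lim root st b) :
    ∀ i < b.qt, Near S.graph root (b.Q i) (b.D (b.Q i)) := by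
  suffices H : ∀ d, ∀ i < b.qt, b.D (b.Q i) = d → Near S.graph root (b.Q i) d from
    fun i hi => H _ i hi rfl
  intro d
  induction d with
  | zero =>
    intro i hi hd
    rcases Nat.eq_zero_or_pos i with rfl | h0
    · rw [h.Q_zero]; exact ⟨.nil, le_rfl⟩
    · obtain ⟨i', h1, h2, h3, -⟩ := h.tree i hi h0
      omega
  | succ d ih =>
    intro i hi hd
    rcases Nat.eq_zero_or_pos i with rfl | h0
    · rw [h.Q_zero, h.D_root] at hd; omega
    · obtain ⟨i', h1, h2, h3, q, h4, h5, h6⟩ := h.tree i hi h0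
      obtain ⟨p, hp⟩ := ih i' h1 (by omega)
      refine ⟨p.concat (hS.adj_iff.2 ⟨q, h4, h5, h6⟩), ?_⟩
      rw [SimpleGraph.Walk.length_concat]; omega

/-- Vertices that are at most as far as the front of the queue have been visited. -/
theorem BFSInv.visited_of_near (hS : S.Good n) (h : BFSInv S n lim root st b) {z ℓ : ℕ}
    (hz : Near S.graph root z ℓ) (hℓ : b.qh < b.qt → ℓ ≤ b.D (b.Q b.qh)) :
    ∃ i < b.qt, b.Q i = z ∧ b.D z ≤ ℓ := by
  obtain ⟨p, hp⟩ := hz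
  induction ℓ generalizing z with
  | zero =>
    have := SimpleGraph.Walk.eq_of_length_eq_zero (Nat.le_zero.1 hp)
    subst this
    exact ⟨0, h.qt_pos, h.Q_zero, h.D_root.le⟩
  | succ ℓ ih =>
    by_cases hpl : p.length ≤ ℓ
    · obtain ⟨i, h1, h2, h3⟩ := ih (fun hl => (Nat.le_succ ℓ).trans (hℓ hl)) p hpl
      exact ⟨i, h1, h2, h3.trans (Nat.le_succ ℓ)⟩
    · have hpos : ¬ p.Nil := by
        intro hn
        rw [← SimpleGraph.Walk.length_eq_zero_iff] at hn
        omega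
      have hlen := SimpleGraph.Walk.length_dropLast_add_one hpos
      obtain ⟨i, h1, h2, h3⟩ := ih (fun hl => (Nat.le_succ ℓ).trans (hℓ hl)) p.dropLast (by omega)
      obtain ⟨q, hq1, hq2, hq3⟩ := hS.adj_iff.1 (p.adj_penultimate hpos)
      -- The last vertex but one is less deep than the front, so it stands before the front and all
      -- its slots have been scanned.
      have hiq : i < b.qh := by
        by_contra hcon
        have h5 := h.mono i h1 b.qh (by omega)
        have h6 := hℓ (by omega)
        rw [h2] at h5
        omega
      obtain ⟨j, hj, rfl⟩ := h.done q hq1 (.inl ⟨i, hiq, hq2.trans h2.symm⟩)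
      obtain ⟨-, -, h7, h8⟩ := h.SL_spec j hj
      rw [hq3] at h7 h8
      rw [hq2] at h8
      obtain ⟨i', h9, h10⟩ := (h.vis_iff _).1 h7
      exact ⟨i', h9, h10, by omega⟩

/-- The scanned slots contain all slots near the root, or there are `lim` of them near the root. -/
theorem BFSInv.ball (hS : S.Good n) (h : BFSInv S n lim root st b)
    (hend : ¬ (b.qh < b.qt ∧ b.c < lim)) (r : ℕ) :
    (∀ q, S.Mem q → Near S.graph root (S.src q) r → ∃ j < b.c, b.SL j = q) ∨
    ∃ U : Finset ℕ, lim ≤ U.card ∧ ∀ q ∈ U, S.Mem q ∧ Near S.graph root (S.src q) r := by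
  -- If the search stopped with its front within distance `r`, then it stopped because of the limit,
  -- and the sources of all `lim` scanned slots are no deeper than the front. Otherwise every vertex
  -- within distance `r` has been dealt with.
  by_cases hlt : b.qh < b.qt ∧ b.D (b.Q b.qh) ≤ r
  · right
    have hc : b.c = lim := by
      have := h.c_le
      have : ¬ b.c < lim := fun h' => hend ⟨hlt.1, h'⟩
      omega
    refine ⟨(Finset.range b.c).image b.SL, ?_, ?_⟩
    · rw [Finset.card_image_of_injOn, Finset.card_range, hc]
      intro i hi j hj e
      rw [Finset.coe_range] at hi hj
      exact h.SL_inj i hi j hj e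
    · intro q hq
      rw [Finset.mem_image] at hq
      obtain ⟨j, hj, rfl⟩ := hq
      obtain ⟨h1, h2, -⟩ := h.SL_spec j (Finset.mem_range.1 hj)
      refine ⟨h1, ?_⟩
      have : ∃ i ≤ b.qh, S.src (b.SL j) = b.Q i := by
        rcases h2 with ⟨i, hi, e⟩ | ⟨-, e, -⟩
        · exact ⟨i, hi.le, e⟩
        · exact ⟨b.qh, le_rfl, e⟩
      obtain ⟨i, hi, e⟩ := this
      obtain ⟨p, hp⟩ := h.near hS i (by omega)
      rw [e]
      exact ⟨p, hp.trans ((h.mono _ hlt.1 i hi).trans hlt.2)⟩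
  · left
    intro q hq hn
    have hfar : b.qh < b.qt → r < b.D (b.Q b.qh) := fun h1 => by
      by_contra h2
      exact hlt ⟨h1, by omega⟩
    obtain ⟨i, h1, h2, h3⟩ := h.visited_of_near hS hn (fun h1 => (hfar h1).le)
    refine h.done q hq (.inl ⟨i, ?_, h2.symm⟩)
    by_contra hcon
    have h5 := h.mono i h1 b.qh (by omega)
    have h6 := hfar (by omega)
    rw [h2] at h5
    omega

end

end ANSC

namespace WordRAM.HL

open ANSC

/-! ### Building linked lists and breadth-first search -/

/-- Build the linked lists of slots. -/
def build (g : Bool) : Cmd :=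
  .forTo .i (V.cnt g)
    (.st (.nx g) (V.i + 1) (.rd (.hd g) (.rd (.src g) (V.i + 1))) ;;
     .st (.hd g) (.rd (.src g) (V.i + 1)) (V.i + 1))

/-- Empty the linked lists of slots. -/
def reset (g : Bool) : Cmd :=
  .forTo .i (V.cnt g) (.st (.hd g) (.rd (.src g) (V.i + 1)) 0)

/-- Breadth-first search from `root`, with at most `lim` scanned slots. -/
def bfs (g : Bool) : Cmd :=
  .asg .st (V.st + 1) ;; .st .vis V.root V.st ;; .st .D V.root 0 ;; .st .up V.root V.root ;;
  .st .Q 0 V.root ;; .asg .qh 0 ;; .asg .qt 1 ;; .asg .c 0 ;; .asg .p (.rd (.hd g) V.root) ;;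
  .whl ((Ex.var .qh).lt V.qt * (Ex.var .c).lt V.lim)
    (.ite V.p
      (.asg .y (.rd (.tgt g) V.p) ;;
       .ite (Ex.eq (.rd .vis V.y) V.st) .skip
        (.st .vis V.y V.st ;; .st .D V.y (.rd .D (.rd .Q V.qh) + 1) ;;
         .st .up V.y (.rd .Q V.qh) ;; .st .Q V.qt V.y ;; .asg .qt (V.qt + 1)) ;;
       .st .SL V.c V.p ;; .asg .c (V.c + 1) ;; .asg .p (.rd (.nx g) V.p))
      (.asg .qh (V.qh + 1) ;;
       .ite ((Ex.var .qh).lt V.qt) (.asg .p (.rd (.hd g) (.rd .Q V.qh))) .skip))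

/-- The graph that is stored in the memory. -/
def St.slots (σ : St) (g : Bool) : Slots := ⟨σ.v (.cnt g), σ.a (.src g), σ.a (.tgt g)⟩

/-- The variables of breadth-first search in the memory. -/
def St.bfsState (σ : St) : BFSState :=
  ⟨σ.a .vis, σ.a .D, σ.a .up, σ.a .Q, σ.a .SL, σ.v .qh, σ.v .qt, σ.v .c, σ.v .p⟩

variable {B : Bounds}

theorem indicator_mul_ne_zero {p q : Prop} [Decidable p] [Decidable q] :
    (if p then 1 else 0) * (if q then 1 else 0) ≠ 0 ↔ p ∧ q := by
  split_ifs <;> simp [*]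

theorem indicator_mul_lt {p q : Prop} [Decidable p] [Decidable q] {W : ℕ} (hW : 1 < W) :
    (if p then 1 else 0) * (if q then 1 else 0) < W := by
  split_ifs <;> omega

theorem inRange_iff {j : Ar} (hj : j ≠ .low) (i : ℕ) : B.inRange j i ↔ i < B.cap := by
  simp [Bounds.inRange, hj]

theorem build_spec (hW : B.cap ≤ B.W) (g : Bool) (σ : St) (hc : σ.v (.cnt g) + 2 < B.cap)
    (hsrc : ∀ q, (σ.slots g).Mem q → σ.a (.src g) q < B.cap) (h0 : ∀ u, σ.a (.hd g) u = 0) :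
    wp B (build g) (fun σ' => Chain (σ.v (.cnt g)) (σ.a (.src g)) (σ'.a (.hd g)) (σ'.a (.nx g)) ∧
      σ'.t ≤ σ.t + (6 * σ.v (.cnt g) + 3)) σ := by
  refine wp_forTo (I := fun k a => Chain k (σ.a (.src g)) (a (.hd g)) (a (.nx g)))
    (b := σ.v (.cnt g)) (τ := 3) rfl (by omega) (.zero h0) ?_ ?_ ?_
  · intro σ' hv ha
    simp [hv (.cnt g) (by simp) rfl]
  · intro k hk σ' hI hk' hv ha
    have e1 : σ'.a (.src g) = σ.a (.src g) := ha _ (by simp [Cmd.wa])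
    have := hsrc (k + 1) ⟨by omega, hk⟩
    simp [e1, hk', inRange_iff]
    refine ⟨by omega, by omega, hI.succ⟩
  · intro σ' hI hv ha ht
    exact ⟨hI, by omega⟩

/-- Only heads at sources of stored slots can be nonzero, so clearing costs as much as the stored
graph is large, independently of `n`. This matters since it is done once for every vertex. -/
theorem reset_spec (hW : B.cap ≤ B.W) (g : Bool) (σ : St) (hc : σ.v (.cnt g) + 2 < B.cap)
    (hsrc : ∀ q, (σ.slots g).Mem q → σ.a (.src g) q < B.cap)
    (hC : Chain (σ.v (.cnt g)) (σ.a (.src g)) (σ.a (.hd g)) (σ.a (.nx g))) :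
    wp B (reset g) (fun σ' => (∀ u, σ'.a (.hd g) u = 0) ∧
      σ'.t ≤ σ.t + (6 * σ.v (.cnt g) + 3)) σ := by
  refine wp_forTo (I := fun k a => ∀ u, a (.hd g) u ≠ 0 →
      ∃ q, k < q ∧ q ≤ σ.v (.cnt g) ∧ σ.a (.src g) q = u)
    (b := σ.v (.cnt g)) (τ := 3) rfl (by omega) ?_ ?_ ?_ ?_
  · intro u hu
    obtain ⟨h1, h2⟩ := hC.hd_src u hu
    exact ⟨_, Nat.pos_of_ne_zero hu, h1, h2⟩
  · intro σ' hv ha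
    simp [hv (.cnt g) (by simp) rfl]
  · intro k hk σ' hI hk' hv ha
    have e1 : σ'.a (.src g) = σ.a (.src g) := ha _ (by simp [Cmd.wa])
    have := hsrc (k + 1) ⟨by omega, hk⟩
    simp [e1, hk', inRange_iff]
    refine ⟨by omega, fun u hu => ?_⟩
    rw [Function.update_apply] at hu
    split_ifs at hu with h
    · exact absurd rfl hu
    · obtain ⟨q, h1, h2, h3⟩ := hI u hu
      refine ⟨q, lt_of_le_of_ne h1 fun e => h ?_, h2, h3⟩
      rw [e, h3]
  · intro σ' hI hv ha ht
    refine ⟨fun u => ?_, by omega⟩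
    by_contra hu
    obtain ⟨q, h1, h2, -⟩ := hI u hu
    omega

/-- Each round increases `c + qh`, and `qh ≤ qt ≤ c + 1`, as each new vertex comes with a scanned
slot. So the time is linear in the number of scanned slots, whatever the size of the graph; the
bounded searches rely on this. -/
theorem bfs_spec (hW : B.cap ≤ B.W) (g : Bool) (σ : St) {n : ℕ} (hS : (σ.slots g).Good n)
    (hC : Chain (σ.v (.cnt g)) (σ.a (.src g)) (σ.a (.hd g)) (σ.a (.nx g)))
    (hroot : σ.v .root < n) (hvis : ∀ y, σ.a .vis y ≤ σ.v .st) (hst : σ.v .st + 1 < B.W)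
    (hlim : σ.v .lim + 3 < B.cap) (hn : n < B.cap) (hcnt : σ.v (.cnt g) + 1 < B.cap) :
    wp B (bfs g) (fun σ' => BFSInv (σ.slots g) n (σ.v .lim) (σ.v .root) (σ.v .st + 1) σ'.bfsState ∧
      ¬ (σ'.v .qh < σ'.v .qt ∧ σ'.v .c < σ.v .lim) ∧ σ'.v .qt ≤ σ'.v .c + 1 ∧
      σ'.v .st = σ.v .st + 1 ∧ σ'.t ≤ σ.t + (60 * σ'.v .c + 60)) σ := by
  have hcap : 3 < B.cap := by omega
  set S := σ.slots g with hSdef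
  have hC' : Chain S.cnt S.src (σ.a (.hd g)) (σ.a (.nx g)) := hC
  simp only [bfs, wp_seq, wp_asg, wp_st, Ex.ok_var, Ex.ok_lit0, Ex.ok_lit1, Ex.ok_add, Ex.eval_var,
    Ex.eval_add, Ex.eval_lit0, Ex.eval_lit1, Ex.ok_rd, Ex.eval_rd, inRange_iff, ne_eq, reduceCtorEq,
    not_false_eq_true, true_and, and_true, St.tick_v, St.tick_a, St.setV_v, St.setV_a, St.setA_v,
    St.setA_a, if_true, if_false]
  refine ⟨⟨by omega, by omega⟩, by omega, ⟨by omega, by omega⟩, by omega, ⟨by omega, by omega⟩,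
    by omega, by omega, by omega, by omega, ?_⟩
  refine wp_whl (I := fun σ' => BFSInv S n (σ.v .lim) (σ.v .root) (σ.v .st + 1) σ'.bfsState ∧
      σ'.v .qt ≤ σ'.v .c + 1 ∧ σ'.v .st = σ.v .st + 1 ∧
      σ'.t ≤ σ.t + 20 + 30 * (σ'.v .c + σ'.v .qh))
    (μ := fun σ' => 2 * σ.v .lim + 2 - (σ'.v .c + σ'.v .qh)) ?_ ?_ ?_ ?_
  · refine ⟨?_, by simp, by simp, by simp⟩
    have := bfsInv_init (lim := σ.v .lim) (st := σ.v .st + 1) hC' hroot (σ.a .vis) (σ.a .D) (σ.a .up)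
      (σ.a .Q) (σ.a .SL) (fun y => Nat.lt_succ_of_le (hvis y))
    simpa [St.bfsState] using this
  · rintro σ' ⟨hI, -⟩ hF
    exact ⟨⟨trivial, trivial, trivial⟩, ⟨trivial, trivial, trivial⟩, indicator_mul_lt (by omega)⟩
  · rintro σ' ⟨hI, hqt, hst', ht⟩ hF hlt
    have hlt' : σ'.v .qh < σ'.v .qt ∧ σ'.v .c < σ.v .lim := by
      have := hF.v .lim rfl
      simp only [St.tick_v, St.setV_v, St.setA_v, reduceCtorEq, if_false] at this
      rw [← this]
      exact indicator_mul_ne_zero.1 hlt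
    have es : σ'.a (.src g) = σ.a (.src g) := by simpa using hF.a (.src g) (by simp [Cmd.wa])
    have et : σ'.a (.tgt g) = σ.a (.tgt g) := by simpa using hF.a (.tgt g) (by simp [Cmd.wa])
    have eh : σ'.a (.hd g) = σ.a (.hd g) := by simpa using hF.a (.hd g) (by simp [Cmd.wa])
    have en : σ'.a (.nx g) = σ.a (.nx g) := by simpa using hF.a (.nx g) (by simp [Cmd.wa])
    have hQlt := hI.Q_lt
    have hDle := hI.D_le (σ'.v .qh) hlt'.1
    have hqhn := hQlt (σ'.v .qh) hlt'.1
    simp only [St.bfsState] at hDle hqhn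
    rw [wp_ite]
    refine ⟨trivial, fun hp => ?_, fun hp => ?_⟩
    · simp only [Ex.eval_var] at hp
      have hmem := hI.mem_p hp
      have hy := hS.tgt_lt hmem
      have hpc := hmem.2
      obtain ⟨-, -, hsp⟩ := hI.cur hp
      simp only [St.bfsState, hSdef, St.slots] at hsp hpc hy
      simp [inRange_iff, es, et, eh, en, hst']
      refine ⟨by omega, by omega, fun hold => ?_, fun hnew => ?_⟩
      · refine ⟨by omega, ⟨by omega, by omega⟩, by omega, ⟨?_, by omega, by omega⟩, by omega⟩
        have hD : σ'.a .D (S.tgt (σ'.v .p)) ≤ σ'.a .D (S.src (σ'.v .p)) + 1 := by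
          obtain ⟨i, hi, e⟩ := (hI.vis_iff _).1 hold
          have := hI.front hlt'.1 i hi
          rw [e] at this
          simp only [hSdef, St.slots, hsp]
          exact this
        have h2 := hI.scan hC' hp hlt'.2 hold hD
        simpa [St.bfsState, hSdef, St.slots] using h2
      · refine ⟨by omega, ⟨⟨by omega, by omega, by omega⟩, by omega⟩, ⟨by omega, by omega⟩, by omega,
          ⟨by omega, by omega⟩, by omega, ⟨by omega, by omega⟩, by omega,
          ⟨?_, by omega, by omega⟩, by omega⟩
        have h1 := hI.enqueue hS hp hnew
        have hne : S.src (σ'.v .p) ≠ S.tgt (σ'.v .p) := hS.ne _ hmem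
        have h2 := h1.scan hC' hp hlt'.2 (Function.update_self _ _ _) (by
          simp only [St.bfsState]
          rw [Function.update_self, Function.update_of_ne hne]
          exact le_of_eq (by rw [← hsp]; rfl))
        simpa [St.bfsState, hSdef, St.slots] using h2
    · simp only [Ex.eval_var, not_not] at hp
      have hQ2 : σ'.v .qh + 1 < σ'.v .qt → σ'.a .Q (σ'.v .qh + 1) < n := hQlt _
      simp [inRange_iff, es, et, eh, en, hst']
      refine ⟨⟨by omega, by omega⟩, fun hlt2 => ?_, fun hge => ?_⟩
      · refine ⟨⟨by omega, by have := hQ2 hlt2; omega⟩, ⟨?_, hqt, by omega⟩, by omega⟩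
        have h2 := hI.advance hC' hp hlt'.1 _ (if_pos hlt2).symm
        simpa [St.bfsState] using h2
      · refine ⟨⟨?_, hqt, by omega⟩, by omega⟩
        have h2 := hI.advance hC' hp hlt'.1 0 (if_neg (not_lt.2 hge)).symm
        simpa [St.bfsState, hp] using h2
  · rintro σ' ⟨hI, hqt, hst', ht⟩ hF hlt
    have := hI.qh_le
    have e := hF.v .lim rfl
    simp only [St.tick_v, St.setV_v, St.setA_v, reduceCtorEq, if_false] at e
    have hlt' : ¬ (σ'.v .qh < σ'.v .qt ∧ σ'.v .c < σ.v .lim) := by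
      rw [← e]
      exact fun h => indicator_mul_ne_zero.2 h hlt
    simp only [St.tick_v, St.tick_t]
    refine ⟨hI, hlt', hqt, hst', ?_⟩
    simp only [St.bfsState] at this
    omega

end WordRAM.HL

namespace ANSC

/-! ### Covering tree paths with jump pointers -/

/-- Replace `M x` by its minimum with `w`. -/
def chminAt (M : ℕ → ℕ) (x w : ℕ) : ℕ → ℕ := Function.update M x (min w (M x))

theorem chminAt_le (M : ℕ → ℕ) (x w y : ℕ) : chminAt M x w y ≤ M y := by
  unfold chminAt
  rw [Function.update_apply]
  split_ifs with h
  · subst h; exact min_le_right _ _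
  · exact le_rfl

theorem chminAt_self_le (M : ℕ → ℕ) (x w : ℕ) : chminAt M x w x ≤ w := by
  simp [chminAt]

theorem chminAt_of_ne {M : ℕ → ℕ} {x w y : ℕ} (h : y ≠ x) : chminAt M x w y = M y :=
  Function.update_of_ne h _ _

theorem mul_add_inj {n j j' y y' : ℕ} (hy : y < n) (hy' : y' < n) (h : j * n + y = j' * n + y') :
    j = j' ∧ y = y' := by
  have hn : 0 < n := by omega
  have h1 := congrArg (· / n) h
  have h2 := congrArg (· % n) h
  simp only [Nat.mul_add_mod_self_right, Nat.mod_eq_of_lt hy, Nat.mod_eq_of_lt hy'] at h2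
  refine ⟨?_, h2⟩
  simp only [mul_comm _ n, Nat.mul_add_div hn, Nat.div_eq_of_lt hy, Nat.div_eq_of_lt hy',
    add_zero] at h1
  exact h1

/-- The entry `M (j * n + y)` is a bound for cycles through the first `2 ^ j` ancestors of `y`. -/
def Sound (G : SimpleGraph ℕ) (Vis : ℕ → Prop) (P : ℕ → ℕ) (n J inf : ℕ) (M : ℕ → ℕ) : Prop :=
  ∀ j ≤ J, ∀ y, Vis y → M (j * n + y) < inf → ∀ i < 2 ^ j, CycleLe G (P^[i] y) (M (j * n + y))

/-- Some entry of `M`, on a level up to `j`, bounds the value at `y` by `w`. -/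
def Cov (Vis : ℕ → Prop) (P : ℕ → ℕ) (n j : ℕ) (M : ℕ → ℕ) (y w : ℕ) : Prop :=
  ∃ j' ≤ j, ∃ z, Vis z ∧ ∃ i < 2 ^ j', P^[i] z = y ∧ M (j' * n + z) ≤ w

theorem Cov.mono {Vis : ℕ → Prop} {P : ℕ → ℕ} {n j : ℕ} {M M' : ℕ → ℕ} {y w : ℕ}
    (h : Cov Vis P n j M y w) (hM : ∀ x, M' x ≤ M x) : Cov Vis P n j M' y w := by
  obtain ⟨j', h1, z, h2, i, h3, h4, h5⟩ := h
  exact ⟨j', h1, z, h2, i, h3, h4, (hM _).trans h5⟩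

theorem cov_chminAt {Vis : ℕ → Prop} {P : ℕ → ℕ} {n J j i : ℕ} (M : ℕ → ℕ) {a w : ℕ} (hj : j ≤ J)
    (ha : Vis a) (hi : i < 2 ^ j) : Cov Vis P n J (chminAt M (j * n + a) w) (P^[i] a) w :=
  ⟨j, hj, a, ha, i, hi, rfl, chminAt_self_le _ _ _⟩

theorem Sound.chminAt {G : SimpleGraph ℕ} {Vis : ℕ → Prop} {P : ℕ → ℕ} {n J inf : ℕ} {M : ℕ → ℕ}
    (hn : ∀ y, Vis y → y < n) (h : Sound G Vis P n J inf M) {j a w : ℕ} (ha : Vis a)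
    (hw : w < inf → ∀ i < 2 ^ j, CycleLe G (P^[i] a) w) :
    Sound G Vis P n J inf (chminAt M (j * n + a) w) := by
  intro j' hj' y hy hlt i hi
  by_cases he : j' * n + y = j * n + a
  · obtain ⟨rfl, rfl⟩ := mul_add_inj (hn y hy) (hn a ha) he
    simp only [ANSC.chminAt, Function.update_self] at hlt ⊢
    rcases le_total w (M (j' * n + y)) with hle | hle
    · rw [min_eq_left hle] at hlt ⊢
      exact hw hlt i hi
    · rw [min_eq_right hle] at hlt ⊢
      exact h j' hj' y hy hlt i hi
  · rw [chminAt_of_ne he] at hlt ⊢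
    exact h j' hj' y hy hlt i hi

/-- Pushing level `j + 1` down to level `j`. -/
theorem Cov.push {Vis : ℕ → Prop} {P : ℕ → ℕ} {n j : ℕ} {M M' : ℕ → ℕ} {y w : ℕ}
    (h : Cov Vis P n (j + 1) M y w) (hM : ∀ x, M' x ≤ M x) (hV : ∀ z, Vis z → Vis (P^[2 ^ j] z))
    (h1 : ∀ z, Vis z → M' (j * n + z) ≤ M ((j + 1) * n + z))
    (h2 : ∀ z, Vis z → M' (j * n + P^[2 ^ j] z) ≤ M ((j + 1) * n + z)) :
    Cov Vis P n j M' y w := by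
  obtain ⟨j', hj', z, hz, i, hi, he, hw⟩ := h
  rcases Nat.lt_or_ge j' (j + 1) with hlt | hge
  · exact ⟨j', by omega, z, hz, i, hi, he, (hM _).trans hw⟩
  · obtain rfl : j' = j + 1 := by omega
    by_cases hi' : i < 2 ^ j
    · exact ⟨j, le_rfl, z, hz, i, hi', he, (h1 z hz).trans hw⟩
    · rw [pow_succ] at hi
      refine ⟨j, le_rfl, _, hV z hz, i - 2 ^ j, by omega, ?_, (h2 z hz).trans hw⟩
      rw [← Function.iterate_add_apply, Nat.sub_add_cancel (by omega), he]

theorem Sound.push {G : SimpleGraph ℕ} {Vis : ℕ → Prop} {P : ℕ → ℕ} {n J inf : ℕ} {M : ℕ → ℕ}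
    (hn : ∀ y, Vis y → y < n) (hP : ∀ y i, Vis y → Vis (P^[i] y))
    (h : Sound G Vis P n J inf M) {j y : ℕ} (hj : j + 1 ≤ J) (hy : Vis y) :
    Sound G Vis P n J inf (ANSC.chminAt (ANSC.chminAt M (j * n + y) (M ((j + 1) * n + y)))
      (j * n + P^[2 ^ j] y) (M ((j + 1) * n + y))) := by
  have key := h (j + 1) hj y hy
  refine (h.chminAt hn hy fun hw i hi => key hw i ?_).chminAt hn (hP y _ hy) fun hw i hi => ?_
  · rw [pow_succ]; omega
  · rw [← Function.iterate_add_apply]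
    exact key hw _ (by rw [pow_succ]; omega)

/-- The edge from `a` to `b`, with `D b ≤ D a`, is not in the tree; `a₁` is the ancestor of `a` on
the level of `b`. -/
structure NonTree (G : SimpleGraph ℕ) (Vis : ℕ → Prop) (D P : ℕ → ℕ) (a b a₁ : ℕ) : Prop where
  vis : Vis a
  adj : G.Adj a b
  le : D b ≤ D a
  eq : a₁ = if D b < D a then P a else a
  ne : a₁ ≠ b

section

variable {G : SimpleGraph ℕ} {root : ℕ} {Vis : ℕ → Prop} {D P : ℕ → ℕ} {a b a₁ : ℕ}

theorem NonTree.of_ne (ha : Vis a) (hab : G.Adj a b)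
    (hle : D b ≤ D a) (hPa : P a ≠ b) :
    NonTree G Vis D P a b (if D b < D a then P a else a) := by
  refine ⟨ha, hab, hle, rfl, ?_⟩
  split_ifs
  · exact hPa
  · exact hab.ne

/-- Depths of adjacent vertices of a breadth-first search tree differ by at most 1, so a single step
lifts `a` to the level of `b`. -/
theorem NonTree.eq_iterate (h : IsBFSTree G root Vis D P) (e : NonTree G Vis D P a b a₁) :
    a₁ = P^[D a - D b] a := by
  have := (h.adj b a (h.adj a b e.vis e.adj).1 e.adj.symm).2
  have hle := e.le
  rw [e.eq]
  split_ifs with hlt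
  · rw [show D a - D b = 1 by omega]; rfl
  · rw [show D a - D b = 0 by omega]; rfl

theorem NonTree.vis' (h : IsBFSTree G root Vis D P) (e : NonTree G Vis D P a b a₁) : Vis b :=
  (h.adj a b e.vis e.adj).1

theorem NonTree.vis₁ (h : IsBFSTree G root Vis D P) (e : NonTree G Vis D P a b a₁) : Vis a₁ := by
  rw [e.eq_iterate h]; exact h.vis_iter e.vis _

theorem NonTree.P_ne (h : IsBFSTree G root Vis D P) (e : NonTree G Vis D P a b a₁) : P a ≠ b := by
  have h1 := e.ne
  have h2 := e.eq
  have hle := e.le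
  split_ifs at h2 with hlt
  · rw [← h2]; exact h1
  · intro hP
    have h3 := h.D_P e.vis
    rw [hP] at h3
    have ha : a = root := h.eq_root e.vis (by omega)
    rw [ha, h.P_root, ← ha] at hP
    exact e.adj.ne hP

theorem NonTree.P_ne' (h : IsBFSTree G root Vis D P) (e : NonTree G Vis D P a b a₁) : P b ≠ a := by
  intro hP
  have hle := e.le
  have h3 := h.D_P (e.vis' h)
  rw [hP] at h3
  have hb : b = root := h.eq_root (e.vis' h) (by omega)
  rw [hb, h.P_root, ← hb] at hP
  exact e.adj.ne hP.symm

theorem NonTree.iterate_add (h : IsBFSTree G root Vis D P) (e : NonTree G Vis D P a b a₁) (i : ℕ) :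
    P^[i] a₁ = P^[i + (D a - D b)] a := by
  rw [e.eq_iterate h, Function.iterate_add_apply]

theorem NonTree.D_iter₁ (h : IsBFSTree G root Vis D P) (e : NonTree G Vis D P a b a₁) (i : ℕ) :
    D (P^[i] a₁) = D b - i := by
  have hle := e.le
  rw [e.iterate_add h, h.D_iter e.vis]; omega

/-- Since `a₁` and `b` are on the same level, an ancestor of `b` can only coincide with the `i`-th
ancestor of `a₁` if it is the `i`-th ancestor of `b`. Being strictly below the lowest common
ancestor thus becomes an inequality of `i`-th ancestors, which jump pointers can test. -/
theorem NonTree.not_anc (h : IsBFSTree G root Vis D P) (e : NonTree G Vis D P a b a₁) {i : ℕ}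
    (hi : P^[i] a₁ ≠ P^[i] b) (i' : ℕ) : P^[i'] b ≠ P^[i] a₁ := by
  intro he
  have h1 := e.D_iter₁ h i
  have h2 := h.D_iter (e.vis' h) i'
  rw [he, h1] at h2
  rcases Nat.lt_or_ge i (D b) with hlt | hge
  · obtain rfl : i' = i := by omega
    exact hi he.symm
  · exact hi (by rw [h.eq_root (h.vis_iter (e.vis₁ h) i) (by omega),
      h.iter_eq_root (e.vis' h) hge])

theorem NonTree.not_anc' (h : IsBFSTree G root Vis D P) (e : NonTree G Vis D P a b a₁) {i : ℕ}
    (hi : P^[i] a₁ ≠ P^[i] b) (i' : ℕ) : P^[i'] a ≠ P^[i] b := by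
  intro he
  have hle := e.le
  have h1 := h.D_iter (e.vis' h) i
  have h2 := h.D_iter e.vis i'
  rw [he, h1] at h2
  rcases Nat.lt_or_ge i (D b) with hlt | hge
  · obtain rfl : i' = i + (D a - D b) := by omega
    exact hi (by rw [e.iterate_add h, he])
  · exact hi (by rw [h.eq_root (h.vis_iter (e.vis₁ h) i) (by rw [e.D_iter₁ h]; omega),
      h.iter_eq_root (e.vis' h) hge])

theorem NonTree.cycleLe_left (h : IsBFSTree G root Vis D P) (e : NonTree G Vis D P a b a₁) {i : ℕ}
    (hi : P^[i] a₁ ≠ P^[i] b) : CycleLe G (P^[i] a₁) (D a + D b + 1) :=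
  h.cycleLe_of_side e.vis e.adj (e.P_ne h) (e.iterate_add h i).symm (e.not_anc h hi)

theorem NonTree.cycleLe_right (h : IsBFSTree G root Vis D P) (e : NonTree G Vis D P a b a₁) {i : ℕ}
    (hi : P^[i] a₁ ≠ P^[i] b) : CycleLe G (P^[i] b) (D a + D b + 1) :=
  (h.cycleLe_of_side (e.vis' h) e.adj.symm (e.P_ne' h) rfl (e.not_anc' h hi)).mono (by omega)

/-- Treats `a` separately: the climb starts at `a₁`, which may be the parent of `a`. -/
theorem NonTree.cycleLe_start (h : IsBFSTree G root Vis D P) (e : NonTree G Vis D P a b a₁) :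
    CycleLe G a (D a + D b + 1) := by
  refine h.cycleLe_of_side e.vis e.adj (e.P_ne h) (i := 0) rfl fun i' he => ?_
  have h1 := e.eq
  have h2 := e.ne
  have hle := e.le
  split_ifs at h1 with hlt
  · have := h.D_iter (e.vis' h) i'
    rw [he] at this
    omega
  · rw [h1] at h2
    have h3 : D a = D b - i' := by rw [← he, h.D_iter (e.vis' h)]
    rcases Nat.eq_zero_or_pos (D b) with h0 | h0
    · exact h2 (by rw [h.eq_root e.vis (by omega), h.eq_root (e.vis' h) h0])
    · obtain rfl : i' = 0 := by omega
      exact h2 he.symm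

theorem NonTree.cycleLe_top (h : IsBFSTree G root Vis D P) (e : NonTree G Vis D P a b a₁) {i : ℕ}
    (hi : P^[i] a₁ ≠ P^[i] b) (hP : P (P^[i] a₁) = P (P^[i] b)) :
    CycleLe G (P (P^[i] a₁)) (D a + D b + 1) := by
  have hle := e.le
  have hib : i < D b := by
    by_contra hcon
    exact hi (by rw [h.eq_root (h.vis_iter (e.vis₁ h) i) (by rw [e.D_iter₁ h]; omega),
      h.iter_eq_root (e.vis' h) (by omega)])
  rw [e.iterate_add h] at hi hP ⊢
  exact h.cycleLe_of_top e.vis e.adj hi hP (by omega) hib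

/-- The loop that climbs from `a₁` and `b` towards their lowest common ancestor, in steps of
decreasing lengths `2 ^ j`. -/
structure ClimbInv (G : SimpleGraph ℕ) (Vis : ℕ → Prop) (P : ℕ → ℕ) (n J inf w a₁ b : ℕ)
    (M₀ : ℕ → ℕ) (j : ℕ) (M : ℕ → ℕ) (x y : ℕ) : Prop where
  sound : Sound G Vis P n J inf M
  le : ∀ z, M z ≤ M₀ z
  ne : x ≠ y
  eq : P^[2 ^ j] x = P^[2 ^ j] y
  pos : ∃ i, P^[i] a₁ = x ∧ P^[i] b = y ∧
    ∀ i' < i, Cov Vis P n J M (P^[i'] a₁) w ∧ Cov Vis P n J M (P^[i'] b) w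

variable {n J inf : ℕ} {M₀ M : ℕ → ℕ} {j x y : ℕ}

theorem ClimbInv.vis (h : IsBFSTree G root Vis D P) (e : NonTree G Vis D P a b a₁) {w : ℕ}
    (hc : ClimbInv G Vis P n J inf w a₁ b M₀ j M x y) : Vis x ∧ Vis y := by
  obtain ⟨i, rfl, rfl, -⟩ := hc.pos
  exact ⟨h.vis_iter (e.vis₁ h) i, h.vis_iter (e.vis' h) i⟩

/-- If the `2 ^ j`-th ancestors differ, so do all earlier ones, and then the first `2 ^ j` ancestors
on both sides, counted from `x` and `y` themselves, are on the fundamental cycle. One table entry on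
each side records all of them. -/
theorem ClimbInv.step (h : IsBFSTree G root Vis D P) (hn : ∀ y, Vis y → y < n)
    (e : NonTree G Vis D P a b a₁)
    (hc : ClimbInv G Vis P n J inf (D a + D b + 1) a₁ b M₀ (j + 1) M x y) (hj : j ≤ J)
    (hne : P^[2 ^ j] x ≠ P^[2 ^ j] y) :
    ClimbInv G Vis P n J inf (D a + D b + 1) a₁ b M₀ j
      (chminAt (chminAt M (j * n + x) (D a + D b + 1)) (j * n + y) (D a + D b + 1))
      (P^[2 ^ j] x) (P^[2 ^ j] y) := by
  obtain ⟨hx, hy⟩ := hc.vis h e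
  obtain ⟨hs, hle, hxy, heq, i, hi1, hi2, hi3⟩ := hc
  have hne' : ∀ i' < 2 ^ j, P^[i' + i] a₁ ≠ P^[i' + i] b := by
    intro i' hi' he
    rw [Function.iterate_add_apply, Function.iterate_add_apply, hi1, hi2] at he
    refine hne ?_
    rw [show 2 ^ j = (2 ^ j - i') + i' by omega, Function.iterate_add_apply,
      Function.iterate_add_apply, he]
  have hle2 : ∀ z, chminAt (chminAt M (j * n + x) (D a + D b + 1)) (j * n + y) (D a + D b + 1) z ≤
      chminAt M (j * n + x) (D a + D b + 1) z := fun z => chminAt_le _ _ _ z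
  have hle1 : ∀ z, chminAt M (j * n + x) (D a + D b + 1) z ≤ M z := fun z => chminAt_le _ _ _ z
  refine ⟨?_, fun z => ((hle2 z).trans (hle1 z)).trans (hle z), hne, ?_, i + 2 ^ j, ?_, ?_, ?_⟩
  · refine (hs.chminAt hn hx fun _ i' hi' => ?_).chminAt hn hy fun _ i' hi' => ?_
    · rw [← hi1, ← Function.iterate_add_apply]
      exact e.cycleLe_left h (hne' i' hi')
    · rw [← hi2, ← Function.iterate_add_apply]
      exact e.cycleLe_right h (hne' i' hi')
  · rw [← Function.iterate_add_apply, ← Function.iterate_add_apply, ← two_mul, ← pow_succ']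
    exact heq
  · rw [add_comm, Function.iterate_add_apply, hi1]
  · rw [add_comm, Function.iterate_add_apply, hi2]
  · intro i' hi'
    by_cases hlt : i' < i
    · exact ⟨((hi3 i' hlt).1.mono hle1).mono hle2, ((hi3 i' hlt).2.mono hle1).mono hle2⟩
    · have e1 : P^[i'] a₁ = P^[i' - i] x := by
        rw [← hi1, ← Function.iterate_add_apply, Nat.sub_add_cancel (by omega)]
      have e2 : P^[i'] b = P^[i' - i] y := by
        rw [← hi2, ← Function.iterate_add_apply, Nat.sub_add_cancel (by omega)]
      rw [e1, e2]
      exact ⟨(cov_chminAt M hj hx (by omega)).mono hle2, cov_chminAt _ hj hy (by omega)⟩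

theorem ClimbInv.skip {w : ℕ}
    (hc : ClimbInv G Vis P n J inf w a₁ b M₀ (j + 1) M x y)
    (heq : P^[2 ^ j] x = P^[2 ^ j] y) : ClimbInv G Vis P n J inf w a₁ b M₀ j M x y :=
  ⟨hc.sound, hc.le, hc.ne, heq, hc.pos⟩

/-- Jumps of length `2 ^ (J + 1)` bring both sides to the root, because depths are below `2 ^ J`. -/
theorem ClimbInv.start (h : IsBFSTree G root Vis D P) (hn : ∀ y, Vis y → y < n)
    (hD : ∀ y, Vis y → D y < 2 ^ J) (e : NonTree G Vis D P a b a₁)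
    (hs : Sound G Vis P n J inf M) :
    ClimbInv G Vis P n J inf (D a + D b + 1) a₁ b (chminAt M a (D a + D b + 1)) (J + 1)
      (chminAt M a (D a + D b + 1)) a₁ b := by
  have hJ : ∀ y, Vis y → P^[2 ^ (J + 1)] y = root := fun y hy =>
    h.iter_eq_root hy ((hD y hy).le.trans (Nat.pow_le_pow_right (by omega) (Nat.le_succ J)))
  refine ⟨?_, fun z => le_rfl, e.ne, ?_, 0, rfl, rfl, fun i' hi' => absurd hi' (Nat.not_lt_zero _)⟩
  · have := hs.chminAt (j := 0) (w := D a + D b + 1) hn e.vis fun _ i hi => by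
      obtain rfl : i = 0 := by omega
      exact e.cycleLe_start h
    rwa [zero_mul, zero_add] at this
  · rw [hJ _ (e.vis₁ h), hJ _ (e.vis' h)]

/-- The result of covering the fundamental cycle of an edge. -/
def EdgeDone (Vis : ℕ → Prop) (D P : ℕ → ℕ) (n J : ℕ) (M : ℕ → ℕ) (a b : ℕ) : Prop :=
  -- These `c` make up the tree path without its top; the parents `P c` add the top.
  ∀ c, ((∃ i, P^[i] a = c) ∧ (∀ i, P^[i] b ≠ c)) ∨ ((∃ i, P^[i] b = c) ∧ (∀ i, P^[i] a ≠ c)) →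
    Cov Vis P n J M c (D a + D b + 1) ∧ Cov Vis P n J M (P c) (D a + D b + 1)

theorem EdgeDone.mono {M' : ℕ → ℕ} (h : EdgeDone Vis D P n J M a b) (hM : ∀ x, M' x ≤ M x) :
    EdgeDone Vis D P n J M' a b :=
  fun c hc => ⟨(h c hc).1.mono hM, (h c hc).2.mono hM⟩

/-- After level 0 the two vertices are distinct with the same parent: they are the children of the
lowest common ancestor on the path. Three single entries, for them and for their parent, complete
the path. -/
theorem ClimbInv.finish (h : IsBFSTree G root Vis D P) (hn : ∀ y, Vis y → y < n)
    (e : NonTree G Vis D P a b a₁)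
    (hc : ClimbInv G Vis P n J inf (D a + D b + 1) a₁ b (chminAt M₀ a (D a + D b + 1)) 0 M x y) :
    let M' := chminAt (chminAt (chminAt M x (D a + D b + 1)) y (D a + D b + 1)) (P x)
      (D a + D b + 1)
    Sound G Vis P n J inf M' ∧ (∀ z, M' z ≤ M₀ z) ∧ EdgeDone Vis D P n J M' a b := by
  intro M'
  obtain ⟨hx, hy⟩ := hc.vis h e
  obtain ⟨hs, hle, hxy, heq, t, rfl, rfl, hi3⟩ := hc
  simp only [pow_zero, Function.iterate_one] at heq
  set w := D a + D b + 1 with hw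
  have hle1 : ∀ z, chminAt M (P^[t] a₁) w z ≤ M z := fun z => chminAt_le _ _ _ z
  have hle2 : ∀ z, chminAt (chminAt M (P^[t] a₁) w) (P^[t] b) w z ≤ chminAt M (P^[t] a₁) w z :=
    fun z => chminAt_le _ _ _ z
  have hle3 : ∀ z, M' z ≤ chminAt (chminAt M (P^[t] a₁) w) (P^[t] b) w z :=
    fun z => chminAt_le _ _ _ z
  have hleM : ∀ z, M' z ≤ M z := fun z => (hle3 z).trans ((hle2 z).trans (hle1 z))
  have cov0 : ∀ (N : ℕ → ℕ) (u : ℕ), Vis u → Cov Vis P n J (chminAt N u w) u w := by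
    intro N u hu
    have := cov_chminAt (P := P) (n := n) (J := J) (j := 0) (i := 0) N (w := w) (Nat.zero_le J) hu
      (by simp)
    simpa using this
  have sound0 : ∀ (N : ℕ → ℕ) (u : ℕ), Vis u → Sound G Vis P n J inf N → CycleLe G u w →
      Sound G Vis P n J inf (chminAt N u w) := by
    intro N u hu hN hcyc
    have := hN.chminAt (j := 0) (w := w) hn hu fun _ i hi => by
      obtain rfl : i = 0 := by omega
      exact hcyc
    rwa [zero_mul, zero_add] at this
  have cov_le : ∀ s ≤ t, Cov Vis P n J M' (P^[s] a₁) w ∧ Cov Vis P n J M' (P^[s] b) w := by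
    intro s hs'
    rcases Nat.lt_or_ge s t with hlt | hge
    · exact ⟨(hi3 s hlt).1.mono hleM, (hi3 s hlt).2.mono hleM⟩
    · obtain rfl : s = t := by omega
      exact ⟨((cov0 M _ hx).mono hle2).mono hle3, (cov0 _ _ hy).mono hle3⟩
  have cov_top : Cov Vis P n J M' (P (P^[t] a₁)) w := cov0 _ _ (h.vis_P hx)
  have cov_succ : ∀ s ≤ t, Cov Vis P n J M' (P (P^[s] a₁)) w ∧ Cov Vis P n J M' (P (P^[s] b)) w := by
    intro s hs'
    rcases Nat.lt_or_ge s t with hlt | hge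
    · have := cov_le (s + 1) hlt
      rwa [Function.iterate_succ_apply', Function.iterate_succ_apply'] at this
    · obtain rfl : s = t := by omega
      exact ⟨cov_top, heq ▸ cov_top⟩
  have hmeet : ∀ s, t < s → P^[s] a₁ = P^[s] b := by
    intro s hs'
    have key : P^[t + 1] a₁ = P^[t + 1] b := by
      rw [Function.iterate_succ_apply', Function.iterate_succ_apply', heq]
    rw [show s = (s - (t + 1)) + (t + 1) by omega, Function.iterate_add_apply P (s - (t + 1)),
      Function.iterate_add_apply P (s - (t + 1)), key]
  refine ⟨?_, fun z => (hleM z).trans ((hle z).trans (chminAt_le _ _ _ z)), ?_⟩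
  · exact sound0 _ _ (h.vis_P hx) (sound0 _ _ hy (sound0 _ _ hx hs (e.cycleLe_left h hxy))
      (e.cycleLe_right h hxy)) (e.cycleLe_top h hxy heq)
  · rintro c (⟨⟨i, rfl⟩, hc⟩ | ⟨⟨i, rfl⟩, hc⟩)
    -- Here the vertex is `a` itself, below `a₁`; it was entered before the climb.
    · by_cases hi : i < D a - D b
      · have hD := (h.adj b a (e.vis' h) e.adj.symm).2
        obtain rfl : i = 0 := by omega
        have e1 : P a = a₁ := by rw [e.eq, if_pos (by omega)]
        refine ⟨(cov0 M₀ a e.vis).mono fun z => (hleM z).trans (hle z), ?_⟩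
        simp only [Function.iterate_zero, id_eq, e1]
        exact (cov_le 0 (Nat.zero_le t)).1
      · have e1 : P^[i] a = P^[i - (D a - D b)] a₁ := by
          rw [e.iterate_add h, Nat.sub_add_cancel (by omega)]
        have hst : i - (D a - D b) ≤ t := by
          by_contra hcon
          exact hc _ (by rw [e1, hmeet _ (by omega)])
        rw [e1]
        exact ⟨(cov_le _ hst).1, (cov_succ _ hst).1⟩
    · have hst : i ≤ t := by
        by_contra hcon
        exact hc (i + (D a - D b)) (by rw [← e.iterate_add h, hmeet _ (by omega)])
      exact ⟨(cov_le _ hst).2, (cov_succ _ hst).2⟩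

end

end ANSC

namespace WordRAM.HL

open ANSC

/-! ### Covering the fundamental cycles of a breadth-first search tree -/

/-- Compute the jump pointers and initialize the table `M`. -/
def jumpTables : Cmd :=
  .forTo .j (V.J + 1) (.forTo .i V.qt (
    .asg .y (.rd .Q V.i) ;; .st .M (V.j * V.n + V.y) V.inf ;;
    .st .up ((V.j + 1) * V.n + V.y) (.rd .up (V.j * V.n + .rd .up (V.j * V.n + V.y)))))

/-- Climb from `a` and `b` to the children of their lowest common ancestor. -/
def climb : Cmd :=
  .whl V.j (.asg .j (V.j - 1) ;;
    .ite (Ex.eq (.rd .up (V.j * V.n + V.a)) (.rd .up (V.j * V.n + V.b))) .skip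
      (.chmin .M (V.j * V.n + V.a) V.w ;; .chmin .M (V.j * V.n + V.b) V.w ;;
       .asg .a (.rd .up (V.j * V.n + V.a)) ;; .asg .b (.rd .up (V.j * V.n + V.b))))

/-- Cover the fundamental cycle of the edge from `a` to `b`. -/
def coverEdge : Cmd :=
  .ite ((Ex.rd .D V.a).lt (.rd .D V.b)) .skip
    (.asg .w (.rd .D V.a + .rd .D V.b + 1) ;; .asg .y V.a ;;
     .ite ((Ex.rd .D V.b).lt (.rd .D V.a)) (.asg .a (.rd .up V.a)) .skip ;;
     .ite (Ex.eq V.a V.b) .skip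
      (.chmin .M V.y V.w ;; .asg .j (V.J + 1) ;; climb ;;
       .chmin .M V.a V.w ;; .chmin .M V.b V.w ;; .chmin .M (.rd .up V.a) V.w))

/-- Cover the fundamental cycles of all scanned edges. -/
def coverEdges (g : Bool) : Cmd :=
  .forTo .i V.c (.asg .a (.rd (.src g) (.rd .SL V.i)) ;; .asg .b (.rd (.tgt g) (.rd .SL V.i)) ;;
    coverEdge)

/-- Push the entries of the table `M` down to level `0`. -/
def pushDown : Cmd :=
  .forTo .j V.J (.forTo .i V.qt (
    .asg .y (.rd .Q V.i) ;; .asg .w (.rd .M ((V.J - V.j) * V.n + V.y)) ;;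
    .chmin .M ((V.J - V.j - 1) * V.n + V.y) V.w ;;
    .chmin .M ((V.J - V.j - 1) * V.n + .rd .up ((V.J - V.j - 1) * V.n + V.y)) V.w))

/-- Update the estimates. -/
def updateEst : Cmd := .forTo .i V.qt (.chmin .est (.rd .Q V.i) (.rd .M (.rd .Q V.i)))

/-- Cover all fundamental cycles and update the estimates. -/
def cover (g : Bool) : Cmd := jumpTables ;; coverEdges g ;; pushDown ;; updateEst

/-- The search tree and the bounds on its size. -/
structure CoverCtx (B : Bounds) (G : SimpleGraph ℕ) (Q : ℕ → ℕ) (qt : ℕ) (D P : ℕ → ℕ)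
    (root n J inf : ℕ) : Prop where
  tree : IsBFSTree G root (fun y => ∃ i < qt, Q i = y) D P
  lt_n : ∀ i < qt, Q i < n
  D_lt : ∀ i < qt, D (Q i) < n
  n_le : n ≤ 2 ^ J
  cap : (J + 3) * n + J + 3 < B.cap
  cap_le : B.cap ≤ B.W
  inf_lt : inf < B.W
  qt_lt : qt + 1 < B.cap

section

variable {B : Bounds} {G : SimpleGraph ℕ} {Q : ℕ → ℕ} {qt : ℕ} {D P : ℕ → ℕ} {root n J inf : ℕ}

theorem CoverCtx.idx (h : CoverCtx B G Q qt D P root n J inf) {j y : ℕ} (hj : j ≤ J + 2)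
    (hy : y < n) : j * n + y < B.cap ∧ j * n + y < B.W ∧ j * n < B.W := by
  have h1 := h.cap
  have h2 := h.cap_le
  have h3 : (j + 1) * n ≤ (J + 3) * n := Nat.mul_le_mul_right n (by omega)
  rw [Nat.succ_mul] at h3
  omega

theorem CoverCtx.lt (h : CoverCtx B G Q qt D P root n J inf) {y : ℕ} (hy : ∃ i < qt, Q i = y) :
    y < n := by
  obtain ⟨i, hi, rfl⟩ := hy; exact h.lt_n i hi

theorem CoverCtx.D_lt_pow (h : CoverCtx B G Q qt D P root n J inf) {y : ℕ}
    (hy : ∃ i < qt, Q i = y) : D y < n ∧ D y < 2 ^ J := by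
  obtain ⟨i, hi, rfl⟩ := hy
  exact ⟨h.D_lt i hi, (h.D_lt i hi).trans_le h.n_le⟩

/-- The jump pointers have been computed up to level `k`. -/
def UpTo (Q : ℕ → ℕ) (qt : ℕ) (P : ℕ → ℕ) (n k : ℕ) (up : ℕ → ℕ) : Prop :=
  ∀ j ≤ k, ∀ i < qt, up (j * n + Q i) = P^[2 ^ j] (Q i)

/-- Only entries of visited vertices are written, so the cost is proportional to the size of the
tree and not to `n`; stale entries elsewhere are never read. -/
theorem jumpTables_spec (h : CoverCtx B G Q qt D P root n J inf) (σ : St) (hQ : σ.a .Q = Q)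
    (hqt : σ.v .qt = qt) (hup : σ.a .up = P) (hn : σ.v .n = n) (hJ : σ.v .J = J)
    (hinf : σ.v .inf = inf) :
    wp B jumpTables (fun σ' => UpTo Q qt P n (J + 1) (σ'.a .up) ∧
      (∀ j ≤ J, ∀ i < qt, σ'.a .M (j * n + Q i) = inf) ∧
      σ'.t ≤ σ.t + ((J + 1) * (qt * 8 + 6) + 3)) σ := by
  have hcap := h.cap
  have hW := h.cap_le
  have hqt' := h.qt_lt
  refine wp_forTo (I := fun k a => UpTo Q qt P n k (a .up) ∧
      (∀ j < k, ∀ i < qt, a .M (j * n + Q i) = inf))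
    (b := J + 1) (τ := qt * 8 + 3) rfl (by omega) ⟨?_, fun j hj => absurd hj (Nat.not_lt_zero j)⟩
    ?_ ?_ ?_
  · intro j hj i hi
    obtain rfl : j = 0 := by omega
    simp [hup]
  · intro σ' hv ha
    have := hv .J (by decide) rfl
    simp [this, hJ]; omega
  · rintro k hk σ₁ ⟨hI1, hI2⟩ hk' hv ha
    have e1 : σ₁.v .qt = qt := (hv .qt (by decide) rfl).trans hqt
    have e2 : σ₁.v .n = n := (hv .n (by decide) rfl).trans hn
    have e3 : σ₁.v .inf = inf := (hv .inf (by decide) rfl).trans hinf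
    have e4 : σ₁.a .Q = Q := (ha .Q rfl).trans hQ
    refine wp_forTo (I := fun i' a => UpTo Q qt P n k (a .up) ∧
        (∀ i < i', a .up ((k + 1) * n + Q i) = P^[2 ^ (k + 1)] (Q i)) ∧
        (∀ j < k, ∀ i < qt, a .M (j * n + Q i) = inf) ∧
        (∀ i < i', a .M (k * n + Q i) = inf)) (b := qt) (τ := 5) rfl (by omega)
      ⟨hI1, by simp, hI2, by simp⟩ ?_ ?_ ?_
    · intro σ' hv ha
      have := hv .qt (by decide) rfl
      simp [this, e1]
    · rintro i hi σ₂ ⟨hI1, hI2, hI3, hI4⟩ hi' hv ha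
      have e1 := (hv .j (by decide) rfl).trans hk'
      have e2 := (hv .n (by decide) rfl).trans e2
      have e3 := (hv .inf (by decide) rfl).trans e3
      have e4 := (ha .Q rfl).trans e4
      have hlt := h.lt_n i hi
      have i1 := h.idx (j := k) (by omega) hlt
      have i2 := h.idx (j := k + 1) (by omega) hlt
      have r1 := hI1 k le_rfl i hi
      have hvis := h.tree.vis_iter ⟨i, hi, rfl⟩ (2 ^ k)
      have r2 := h.lt hvis
      obtain ⟨i', hi'1, hi'2⟩ := hvis
      have i3 := h.idx (j := k) (by omega) r2
      have r3 := hI1 k le_rfl i' hi'1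
      rw [hi'2, ← Function.iterate_add_apply, ← two_mul, ← pow_succ'] at r3
      simp [inRange_iff, e1, e2, e3, e4, hi', r1, r3]
      refine ⟨by omega, by omega, by omega, ?_, ?_, ?_, ?_⟩
      · intro j hj l hl
        rw [Function.update_of_ne]
        · exact hI1 j hj l hl
        · intro e
          have := (mul_add_inj (h.lt_n l hl) hlt e).1
          omega
      · intro l hl
        rw [Function.update_apply]
        split_ifs with e
        · rw [(mul_add_inj (h.lt_n l (by omega)) hlt e).2]
        · exact hI2 l (lt_of_le_of_ne hl fun e' => e (by rw [e']))
      · intro j hj l hl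
        rw [Function.update_of_ne]
        · exact hI3 j hj l hl
        · intro e
          have := (mul_add_inj (h.lt_n l hl) hlt e).1
          omega
      · intro l hl
        rw [Function.update_apply]
        split_ifs with e
        · rfl
        · exact hI4 l (lt_of_le_of_ne hl fun e' => e (by rw [e']))
    · rintro σ₂ ⟨hI1, hI2, hI3, hI4⟩ hv ha ht
      refine ⟨⟨?_, ?_⟩, by omega⟩
      · intro j hj i hi
        rcases Nat.lt_or_ge j (k + 1) with hlt | hge
        · exact hI1 j (by omega) i hi
        · obtain rfl : j = k + 1 := by omega
          exact hI2 i hi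
      · intro j hj i hi
        rcases Nat.lt_or_ge j k with hlt | hge
        · exact hI3 j hlt i hi
        · obtain rfl : j = k := by omega
          exact hI4 i hi
  · rintro σ' ⟨hI1, hI2⟩ hv ha ht
    exact ⟨hI1, fun j hj => hI2 j (by omega), by omega⟩

theorem climb_spec (h : CoverCtx B G Q qt D P root n J inf) (σ : St)
    (hup : UpTo Q qt P n (J + 1) (σ.a .up)) (hn : σ.v .n = n) (hj : σ.v .j = J + 1)
    {a b a₁ : ℕ} (e : NonTree G (fun y => ∃ i < qt, Q i = y) D P a b a₁)
    (hw : σ.v .w = D a + D b + 1) {M₀ : ℕ → ℕ}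
    (hI : ClimbInv G (fun y => ∃ i < qt, Q i = y) P n J inf (D a + D b + 1) a₁ b M₀ (J + 1)
      (σ.a .M) (σ.v .a) (σ.v .b)) :
    wp B climb (fun σ' => ClimbInv G (fun y => ∃ i < qt, Q i = y) P n J inf (D a + D b + 1) a₁ b M₀
      0 (σ'.a .M) (σ'.v .a) (σ'.v .b) ∧ σ'.t ≤ σ.t + ((J + 1) * 20 + 1)) σ := by
  have hcap := h.cap
  have hW := h.cap_le
  refine wp_whl (I := fun σ' => ClimbInv G (fun y => ∃ i < qt, Q i = y) P n J inf (D a + D b + 1)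
      a₁ b M₀ (σ'.v .j) (σ'.a .M) (σ'.v .a) (σ'.v .b) ∧ σ'.v .j ≤ J + 1 ∧
      σ'.t + σ'.v .j * 20 ≤ σ.t + (J + 1) * 20) (μ := fun σ' => σ'.v .j) ?_ ?_ ?_ ?_
  · exact ⟨hj ▸ hI, hj.le, by rw [hj]⟩
  · intro σ' _ _; trivial
  · rintro σ' ⟨hI, hjJ, ht⟩ hF hne
    simp only [Ex.eval_var] at hne
    obtain ⟨hx, hy⟩ := hI.vis h.tree e
    have hxn := h.lt hx
    have hyn := h.lt hy
    obtain ⟨j, hj'⟩ : ∃ j, σ'.v .j = j + 1 := ⟨σ'.v .j - 1, by omega⟩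
    rw [hj'] at hI ht hjJ
    have e1 : σ'.v .n = n := (hF.v .n rfl).trans hn
    have e2 : σ'.v .w = D a + D b + 1 := (hF.v .w rfl).trans hw
    have e3 : σ'.a .up = σ.a .up := hF.a .up rfl
    have u1 : σ.a .up (j * n + σ'.v .a) = P^[2 ^ j] (σ'.v .a) := by
      obtain ⟨i, hi, e⟩ := hx
      rw [← e]; exact hup j (by omega) i hi
    have u2 : σ.a .up (j * n + σ'.v .b) = P^[2 ^ j] (σ'.v .b) := by
      obtain ⟨i, hi, e⟩ := hy
      rw [← e]; exact hup j (by omega) i hi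
    have i1 := h.idx (j := j) (by omega) hxn
    have i2 := h.idx (j := j) (by omega) hyn
    simp [inRange_iff, e1, e2, e3, hj', u1, u2]
    refine ⟨by omega, ⟨by omega, by omega⟩, fun heq => ?_, fun hne => ?_⟩
    · exact ⟨hI.skip heq, by omega, by omega⟩
    · exact ⟨⟨by omega, by omega⟩, ⟨by omega, by omega⟩, by omega, by omega,
        hI.step h.tree (fun y hy => h.lt hy) e (by omega) hne, by omega, by omega⟩
  · rintro σ' ⟨hI, hjJ, ht⟩ hF h0
    simp only [Ex.eval_var] at h0
    rw [h0] at hI ht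
    exact ⟨hI, by simp only [St.tick_t]; omega⟩

theorem coverEdge_spec (h : CoverCtx B G Q qt D P root n J inf) (σ : St)
    (hup : UpTo Q qt P n (J + 1) (σ.a .up)) (hD : σ.a .D = D) (hn : σ.v .n = n)
    (hJ : σ.v .J = J) (hVa : ∃ i < qt, Q i = σ.v .a) (hab : G.Adj (σ.v .a) (σ.v .b))
    (hM : Sound G (fun y => ∃ i < qt, Q i = y) P n J inf (σ.a .M)) :
    wp B coverEdge (fun σ' => Sound G (fun y => ∃ i < qt, Q i = y) P n J inf (σ'.a .M) ∧
      (∀ z, σ'.a .M z ≤ σ.a .M z) ∧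
      (D (σ.v .b) ≤ D (σ.v .a) → P (σ.v .a) ≠ σ.v .b →
        EdgeDone (fun y => ∃ i < qt, Q i = y) D P n J (σ'.a .M) (σ.v .a) (σ.v .b)) ∧
      σ'.t ≤ σ.t + ((J + 1) * 20 + 40)) σ := by
  have hcap := h.cap
  have hW := h.cap_le
  obtain ⟨hVb, hDb⟩ := h.tree.adj _ _ hVa hab
  have hDa := (h.tree.adj _ _ hVb hab.symm).2
  have han := h.lt hVa
  have hbn := h.lt hVb
  have hDa' := h.D_lt_pow hVa
  have hDb' := h.D_lt_pow hVb
  have hcap2 : 3 * n ≤ (J + 3) * n := Nat.mul_le_mul_right n (by omega)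
  have hupP : ∀ y, (∃ i < qt, Q i = y) → σ.a .up y = P y := by
    rintro _ ⟨i, hi, rfl⟩
    have := hup 0 (Nat.zero_le _) i hi
    simpa using this
  rw [coverEdge, wp_ite]
  refine ⟨by simp [inRange_iff]; omega, fun hlt => ?_, fun hle => ?_⟩
  · simp [hD] at hlt
    rw [wp_skip]
    exact ⟨hM, fun z => le_rfl, fun hle => absurd hlt (by omega), by simp⟩
  · simp [hD] at hle
    -- The common continuation after `a` has, or has not, been lifted to the level of `b`.
    have main : ∀ (a₁ : ℕ) (σ₁ : St), (a₁ = if D (σ.v .b) < D (σ.v .a) then P (σ.v .a) else σ.v .a) →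
        σ₁.a = σ.a → σ₁.v .a = a₁ → σ₁.v .b = σ.v .b → σ₁.v .y = σ.v .a → σ₁.v .n = n →
        σ₁.v .J = J → σ₁.v .w = D (σ.v .a) + D (σ.v .b) + 1 → σ₁.t ≤ σ.t + 12 →
        wp B (.ite (Ex.eq V.a V.b) .skip
          (.chmin .M V.y V.w ;; .asg .j (V.J + 1) ;; climb ;;
          .chmin .M V.a V.w ;; .chmin .M V.b V.w ;; .chmin .M (.rd .up V.a) V.w))
        (fun σ' => Sound G (fun y => ∃ i < qt, Q i = y) P n J inf (σ'.a .M) ∧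
          (∀ z, σ'.a .M z ≤ σ.a .M z) ∧
          (D (σ.v .b) ≤ D (σ.v .a) → P (σ.v .a) ≠ σ.v .b →
            EdgeDone (fun y => ∃ i < qt, Q i = y) D P n J (σ'.a .M) (σ.v .a) (σ.v .b)) ∧
          σ'.t ≤ σ.t + ((J + 1) * 20 + 40)) σ₁ := by
      intro a₁ σ₁ ha₁ ea ev1 ev2 ev3 ev4 ev5 ev6 ht
      rw [wp_ite]
      refine ⟨by simp, fun heq => ?_, fun hne => ?_⟩
      · simp [ev1, ev2] at heq
        rw [wp_skip]
        refine ⟨by simpa [ea] using hM, fun z => by simp [ea], fun hle hP => ?_, by simp; omega⟩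
        have := (NonTree.of_ne (G := G) (Vis := fun y => ∃ i < qt, Q i = y) (D := D) (P := P) hVa hab hle hP).ne
        exact absurd (ha₁.symm.trans heq) this
      · simp [ev1, ev2] at hne
        have e : NonTree G (fun y => ∃ i < qt, Q i = y) D P (σ.v .a) (σ.v .b) a₁ :=
          ⟨hVa, hab, hle, ha₁, hne⟩
        have hstart := ClimbInv.start h.tree (fun y hy => h.lt hy) (fun y hy => (h.D_lt_pow hy).2)
          e hM
        have hJn : J + 1 < B.W := by omega
        simp only [wp_seq, wp_chmin, wp_asg]
        simp [inRange_iff, ea, ev3, ev5, ev6]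
        refine ⟨by omega, ⟨by omega, hJn⟩, ?_⟩
        refine (climb_spec h _ (by simpa [ea] using hup) (by simpa using ev4) (by simp) e
          (by simpa using ev6) (M₀ := chminAt (σ.a .M) (σ.v .a) (D (σ.v .a) + D (σ.v .b) + 1))
          (by simpa [chminAt, ea, ev1, ev2, ev3, ev6] using hstart)).mono ?_
        rintro σ₂ hF ⟨hI, ht₂⟩
        obtain ⟨hx, hy⟩ := hI.vis h.tree e
        have hfin := hI.finish h.tree (fun y hy => h.lt hy) e
        have eup : σ₂.a .up = σ.a .up := by simpa [ea] using hF.a .up rfl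
        have ew : σ₂.v .w = D (σ.v .a) + D (σ.v .b) + 1 := by simpa [ev6] using hF.v .w rfl
        have hxn := h.lt hx
        have hyn := h.lt hy
        have hPn := h.lt (h.tree.vis_P hx)
        simp [inRange_iff, eup, ew, hupP _ hx]
        simp at ht₂
        exact ⟨by omega, by omega, ⟨by omega, by omega⟩, hfin.1, hfin.2.1, fun _ _ => hfin.2.2,
          by omega⟩
    have hPn := h.lt (h.tree.vis_P hVa)
    rw [wp_seq, wp_asg]
    refine ⟨by simp [inRange_iff, hD]; omega, ?_⟩
    rw [wp_seq, wp_asg]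
    refine ⟨trivial, ?_⟩
    rw [wp_seq, wp_ite]
    refine ⟨by simp [inRange_iff, hD]; omega, fun hlt => ?_, fun hge => ?_⟩
    · rw [wp_asg]
      refine ⟨by simp [inRange_iff]; omega, ?_⟩
      simp [hD] at hlt
      refine main (P (σ.v .a)) _ (by rw [if_pos hlt]) ?_ ?_ ?_ ?_ ?_ ?_ ?_ ?_ <;>
        simp [hn, hJ, hupP _ hVa, hD]
    · rw [wp_skip]
      simp [hD] at hge
      refine main (σ.v .a) _ (by rw [if_neg (by omega)]) ?_ ?_ ?_ ?_ ?_ ?_ ?_ ?_ <;>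
        simp [hn, hJ, hD]

end

end WordRAM.HL

namespace WordRAM.HL

open ANSC

section

variable {B : Bounds} {G : SimpleGraph ℕ} {Q : ℕ → ℕ} {qt : ℕ} {D P : ℕ → ℕ} {root n J inf : ℕ}

/-- Slots that lead to a deeper vertex are skipped; their reversals do the work. Tree edges are
recognized by `a₁ = b` and add nothing. -/
theorem coverEdges_spec (h : CoverCtx B G Q qt D P root n J inf) (g : Bool) (σ : St)
    (hup : UpTo Q qt P n (J + 1) (σ.a .up)) (hD : σ.a .D = D) (hn : σ.v .n = n)
    (hJ : σ.v .J = J) (hM : Sound G (fun y => ∃ i < qt, Q i = y) P n J inf (σ.a .M))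
    (hc : σ.v .c + 1 < B.cap)
    (hSL : ∀ i < σ.v .c, σ.a .SL i < B.cap ∧ (∃ i' < qt, Q i' = σ.a (.src g) (σ.a .SL i)) ∧
      G.Adj (σ.a (.src g) (σ.a .SL i)) (σ.a (.tgt g) (σ.a .SL i))) :
    wp B (coverEdges g) (fun σ' => Sound G (fun y => ∃ i < qt, Q i = y) P n J inf (σ'.a .M) ∧
      (∀ i < σ.v .c, D (σ.a (.tgt g) (σ.a .SL i)) ≤ D (σ.a (.src g) (σ.a .SL i)) →
        P (σ.a (.src g) (σ.a .SL i)) ≠ σ.a (.tgt g) (σ.a .SL i) →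
        EdgeDone (fun y => ∃ i < qt, Q i = y) D P n J (σ'.a .M) (σ.a (.src g) (σ.a .SL i))
          (σ.a (.tgt g) (σ.a .SL i))) ∧
      σ'.t ≤ σ.t + (σ.v .c * ((J + 1) * 20 + 53) + 3)) σ := by
  have hcap := h.cap
  have hW := h.cap_le
  refine wp_forTo (I := fun k a => Sound G (fun y => ∃ i < qt, Q i = y) P n J inf (a .M) ∧
      ∀ i < k, D (σ.a (.tgt g) (σ.a .SL i)) ≤ D (σ.a (.src g) (σ.a .SL i)) →
        P (σ.a (.src g) (σ.a .SL i)) ≠ σ.a (.tgt g) (σ.a .SL i) →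
        EdgeDone (fun y => ∃ i < qt, Q i = y) D P n J (a .M) (σ.a (.src g) (σ.a .SL i))
          (σ.a (.tgt g) (σ.a .SL i)))
    (b := σ.v .c) (τ := (J + 1) * 20 + 50) rfl (by omega)
    ⟨hM, fun i hi => absurd hi (Nat.not_lt_zero i)⟩ ?_ ?_ ?_
  · intro σ' hv ha
    simp [hv .c (by decide) rfl]
  · rintro k hk σ₁ ⟨hI1, hI2⟩ hk' hv ha
    have e1 := ha .SL (by simp [Cmd.wa, coverEdge, climb, Cmd.chmin])
    have e2 := ha (.src g) (by simp [Cmd.wa, coverEdge, climb, Cmd.chmin])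
    have e3 := ha (.tgt g) (by simp [Cmd.wa, coverEdge, climb, Cmd.chmin])
    have e4 := ha .up rfl
    have e5 := (ha .D rfl).trans hD
    have e6 := (hv .n (by decide) rfl).trans hn
    have e7 := (hv .J (by decide) rfl).trans hJ
    obtain ⟨s1, s2, s3⟩ := hSL k hk
    simp only [wp_seq, wp_asg]
    refine ⟨by simp [inRange_iff, hk', e1]; omega, by simp [inRange_iff, hk', e1]; omega, ?_⟩
    refine (coverEdge_spec h _ (by simpa [e4] using hup) (by simpa using e5) (by simpa using e6)
      (by simpa using e7) (by simpa [hk', e1, e2] using s2)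
      (by simpa [hk', e1, e2, e3] using s3) (by simpa using hI1)).mono ?_
    rintro σ₂ hF ⟨h1, h2, h3, h4⟩
    simp [hk', e1, e2, e3] at h2 h3 h4
    refine ⟨⟨h1, fun i hi => ?_⟩, by omega⟩
    rcases Nat.lt_or_ge i k with hlt | hge
    · exact fun a1 a2 => (hI2 i hlt a1 a2).mono h2
    · obtain rfl : i = k := by omega
      exact h3
  · rintro σ' ⟨hI1, hI2⟩ hv ha ht
    exact ⟨hI1, hI2, ht⟩

theorem pushDown_spec (h : CoverCtx B G Q qt D P root n J inf) (σ : St) (hQ : σ.a .Q = Q)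
    (hqt : σ.v .qt = qt)
    (hup : UpTo Q qt P n (J + 1) (σ.a .up)) (hn : σ.v .n = n) (hJ : σ.v .J = J)
    (hM : Sound G (fun y => ∃ i < qt, Q i = y) P n J inf (σ.a .M)) :
    wp B pushDown (fun σ' => Sound G (fun y => ∃ i < qt, Q i = y) P n J inf (σ'.a .M) ∧
      (∀ y w, Cov (fun y => ∃ i < qt, Q i = y) P n J (σ.a .M) y w →
        Cov (fun y => ∃ i < qt, Q i = y) P n 0 (σ'.a .M) y w) ∧
      σ'.t ≤ σ.t + (J * (qt * 12 + 6) + 3)) σ := by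
  have hcap := h.cap
  have hW := h.cap_le
  have hqt' := h.qt_lt
  set Vis : ℕ → Prop := fun y => ∃ i < qt, Q i = y with hVis
  refine wp_forTo (I := fun k a => Sound G Vis P n J inf (a .M) ∧
      ∀ y w, Cov Vis P n J (σ.a .M) y w → Cov Vis P n (J - k) (a .M) y w)
    (b := J) (τ := qt * 12 + 3) rfl (by omega) ⟨hM, fun y w hc => hc⟩ ?_ ?_ ?_
  · intro σ' hv ha
    simp [hv .J (by decide) rfl, hJ]
  · rintro k hk σ₁ ⟨hI1, hI2⟩ hk' hv ha
    have e1 : σ₁.v .qt = qt := (hv .qt (by decide) rfl).trans hqt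
    have e2 : σ₁.v .n = n := (hv .n (by decide) rfl).trans hn
    have e3 : σ₁.v .J = J := (hv .J (by decide) rfl).trans hJ
    have e4 : σ₁.a .Q = Q := (ha .Q rfl).trans hQ
    have e5 : σ₁.a .up = σ.a .up := ha .up rfl
    -- Round `k` pushes level `l + 1 = J - k` down to level `l`. It leaves level `l + 1` unchanged,
    -- so the order of the vertices is irrelevant.
    obtain ⟨l, hl⟩ : ∃ l, J - k = l + 1 := ⟨J - k - 1, by omega⟩
    refine wp_forTo (I := fun i a => Sound G Vis P n J inf (a .M) ∧ (∀ z, a .M z ≤ σ₁.a .M z) ∧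
        (∀ z, Vis z → a .M ((l + 1) * n + z) = σ₁.a .M ((l + 1) * n + z)) ∧
        (∀ i' < i, a .M (l * n + Q i') ≤ σ₁.a .M ((l + 1) * n + Q i') ∧
          a .M (l * n + P^[2 ^ l] (Q i')) ≤ σ₁.a .M ((l + 1) * n + Q i')))
      (b := qt) (τ := 9) rfl (by omega)
      ⟨hI1, fun z => le_rfl, fun z _ => rfl, fun i' hi' => absurd hi' (Nat.not_lt_zero _)⟩ ?_ ?_ ?_
    · intro σ' hv ha
      simp [hv .qt (by decide) rfl, e1]
    · rintro i hi σ₂ ⟨hI1, hI2, hI3, hI4⟩ hi' hv ha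
      have e1 := (hv .j (by decide) rfl).trans hk'
      have e2 := (hv .n (by decide) rfl).trans e2
      have e3 := (hv .J (by decide) rfl).trans e3
      have e4 := (ha .Q rfl).trans e4
      have e5 := (ha .up rfl).trans e5
      have hlt := h.lt_n i hi
      have i1 := h.idx (j := l) (by omega) hlt
      have i2 := h.idx (j := l + 1) (by omega) hlt
      have r1 := hup l (by omega) i hi
      have hvis := h.tree.vis_iter ⟨i, hi, rfl⟩ (2 ^ l)
      have r2 := h.lt hvis
      have i3 := h.idx (j := l) (by omega) r2
      have hl' : l + 1 - 1 = l := rfl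
      have r3 := hI3 (Q i) ⟨i, hi, rfl⟩
      have hp := hI1.push (fun y hy => h.lt hy) (fun y i hy => h.tree.vis_iter hy i) (j := l)
        (y := Q i) (by omega) ⟨i, hi, rfl⟩
      rw [r3] at hp
      simp [inRange_iff, e1, e2, e3, e4, e5, hi', r1, hl, r3]
      have hle : ∀ z, chminAt (chminAt (σ₂.a .M) (l * n + Q i) (σ₁.a .M ((l + 1) * n + Q i)))
          (l * n + P^[2 ^ l] (Q i)) (σ₁.a .M ((l + 1) * n + Q i)) z ≤
          chminAt (σ₂.a .M) (l * n + Q i) (σ₁.a .M ((l + 1) * n + Q i)) z :=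
        fun z => chminAt_le _ _ _ z
      have hle' : ∀ z, chminAt (σ₂.a .M) (l * n + Q i) (σ₁.a .M ((l + 1) * n + Q i)) z ≤
          σ₂.a .M z := fun z => chminAt_le _ _ _ z
      refine ⟨by omega, by omega, by omega, by omega, hp, fun z => ((hle z).trans (hle' z)).trans (hI2 z), ?_, ?_⟩
      · intro z hz
        rw [Function.update_of_ne, Function.update_of_ne]
        · exact hI3 z hz
        · intro e
          have := (mul_add_inj (h.lt hz) hlt e).1
          omega
        · intro e
          have := (mul_add_inj (h.lt hz) r2 e).1
          omega
      · intro i' hi'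
        rcases Nat.lt_or_ge i' i with hlt | hge
        · exact ⟨((hle _).trans (hle' _)).trans (hI4 i' hlt).1,
            ((hle _).trans (hle' _)).trans (hI4 i' hlt).2⟩
        · obtain rfl : i' = i := by omega
          exact ⟨(hle _).trans (chminAt_self_le _ _ _), chminAt_self_le _ _ _⟩
    · rintro σ₂ ⟨hI1', hI2', hI3', hI4'⟩ hv ha ht
      refine ⟨⟨hI1', fun y w hc => ?_⟩, ht⟩
      have := hI2 y w hc
      rw [hl] at this
      rw [show J - (k + 1) = l by omega]
      refine this.push hI2' (fun z hz => h.tree.vis_iter hz _) ?_ ?_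
      · rintro _ ⟨i, hi, rfl⟩; exact (hI4' i hi).1
      · rintro _ ⟨i, hi, rfl⟩; exact (hI4' i hi).2
  · rintro σ' ⟨hI1, hI2⟩ hv ha ht
    refine ⟨hI1, fun y w hc => ?_, ht⟩
    simpa using hI2 y w hc

theorem updateEst_spec (h : CoverCtx B G Q qt D P root n J inf) (σ : St) (hQ : σ.a .Q = Q)
    (hqt : σ.v .qt = qt) :
    wp B updateEst (fun σ' => (∀ y, σ'.a .est y ≤ σ.a .est y) ∧
      (∀ i < qt, σ'.a .est (Q i) ≤ σ.a .M (Q i)) ∧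
      (∀ y, σ'.a .est y = σ.a .est y ∨ (∃ i < qt, Q i = y) ∧ σ'.a .est y = σ.a .M y) ∧
      σ'.t ≤ σ.t + (qt * 5 + 3)) σ := by
  have hcap := h.cap
  have hW := h.cap_le
  have hqt' := h.qt_lt
  refine wp_forTo (I := fun k a => (∀ y, a .est y ≤ σ.a .est y) ∧
      (∀ i < k, a .est (Q i) ≤ σ.a .M (Q i)) ∧
      (∀ y, a .est y = σ.a .est y ∨ (∃ i < qt, Q i = y) ∧ a .est y = σ.a .M y))
    (b := qt) (τ := 2) rfl (by omega)
    ⟨fun y => le_rfl, fun i hi => absurd hi (Nat.not_lt_zero i), fun y => .inl rfl⟩ ?_ ?_ ?_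
  · intro σ' hv ha
    simp [hv .qt (by decide) rfl, hqt]
  · rintro k hk σ₁ ⟨hI1, hI2, hI3⟩ hk' hv ha
    have e1 : σ₁.a .Q = Q := (ha .Q rfl).trans hQ
    have e2 : σ₁.a .M = σ.a .M := ha .M rfl
    have hlt := h.lt_n k hk
    have i1 := h.idx (j := 0) (by omega) hlt
    simp [inRange_iff, e1, e2, hk']
    refine ⟨by omega, fun y => (chminAt_le (σ₁.a .est) (Q k) (σ.a .M (Q k)) y).trans (hI1 y),
      fun i hi => ?_, fun y => ?_⟩
    · rcases Nat.lt_or_ge i k with hlt | hge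
      · exact (chminAt_le (σ₁.a .est) (Q k) (σ.a .M (Q k)) _).trans (hI2 i hlt)
      · obtain rfl : i = k := by omega
        exact chminAt_self_le (σ₁.a .est) _ _
    · rw [Function.update_apply]
      split_ifs with hy
      · subst hy
        rcases min_choice (σ.a .M (Q k)) (σ₁.a .est (Q k)) with e | e
        · exact .inr ⟨⟨k, hk, rfl⟩, e⟩
        · rw [e]; exact hI3 _
      · exact hI3 y
  · rintro σ' ⟨hI1, hI2, hI3⟩ hv ha ht
    exact ⟨hI1, hI2, hI3, ht⟩

/-- Covering improves the estimates of all vertices on short cycles near the root. -/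
theorem cover_spec (h : CoverCtx B G Q qt D P root n J inf) (g : Bool) (σ : St) (hQ : σ.a .Q = Q)
    (hqt : σ.v .qt = qt) (hD : σ.a .D = D) (hup : σ.a .up = P) (hn : σ.v .n = n) (hJ : σ.v .J = J)
    (hinf : σ.v .inf = inf) (hc : σ.v .c + 1 < B.cap)
    (hSL : ∀ i < σ.v .c, σ.a .SL i < B.cap ∧ (∃ i' < qt, Q i' = σ.a (.src g) (σ.a .SL i)) ∧
      G.Adj (σ.a (.src g) (σ.a .SL i)) (σ.a (.tgt g) (σ.a .SL i)))
    (hall : ∀ a b, (∃ i < qt, Q i = a) → G.Adj a b →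
      ∃ i < σ.v .c, σ.a (.src g) (σ.a .SL i) = a ∧ σ.a (.tgt g) (σ.a .SL i) = b) :
    wp B (cover g) (fun σ' => (∀ y, σ'.a .est y ≤ σ.a .est y) ∧
      (∀ y, σ'.a .est y = σ.a .est y ∨ (σ'.a .est y < inf → CycleLe G y (σ'.a .est y))) ∧
      (∀ (v x r : ℕ) (p : G.Walk v v), p.IsCycle → x ∈ p.support → Near G root x r →
        σ'.a .est v ≤ p.length + 2 * r) ∧
      σ'.t ≤ σ.t + (σ.v .c + qt + 1) * (J + 1) * 100) σ := by
  rw [cover, wp_seq]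
  refine (jumpTables_spec h σ.tick hQ hqt hup hn hJ hinf).mono ?_
  rintro σ₁ hF₁ ⟨hup₁, hM₁, ht₁⟩
  have c1 : σ₁.v .c = σ.v .c := hF₁.v .c rfl
  have c2 : σ₁.a .SL = σ.a .SL := hF₁.a .SL rfl
  have c3 : σ₁.a (.src g) = σ.a (.src g) := hF₁.a (.src g) rfl
  have c4 : σ₁.a (.tgt g) = σ.a (.tgt g) := hF₁.a (.tgt g) rfl
  rw [wp_seq]
  -- All entries equal `inf`, so there is nothing to check.
  have hS₁ : Sound G (fun y => ∃ i < qt, Q i = y) P n J inf (σ₁.a .M) := by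
    rintro j hj _ ⟨i, hi, rfl⟩ hlt
    exact absurd hlt (by rw [hM₁ j hj i hi]; exact lt_irrefl _)
  refine (coverEdges_spec h g σ₁.tick hup₁ ((hF₁.a .D rfl).trans hD) ((hF₁.v .n rfl).trans hn)
    ((hF₁.v .J rfl).trans hJ) hS₁ (by simpa [c1] using hc) (by simpa [c1, c2, c3, c4] using hSL)).mono ?_
  rintro σ₂ hF₂ ⟨hS₂, hE₂, ht₂⟩
  have q1 : σ₂.a .Q = Q :=
    (hF₂.a .Q rfl).trans ((hF₁.a .Q rfl).trans hQ)
  have q2 : σ₂.v .qt = qt := (hF₂.v .qt rfl).trans ((hF₁.v .qt rfl).trans hqt)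
  rw [wp_seq]
  refine (pushDown_spec h σ₂.tick q1 q2 (by
      have : σ₂.a .up = σ₁.a .up := hF₂.a .up rfl
      simpa [this] using hup₁) ((hF₂.v .n rfl).trans ((hF₁.v .n rfl).trans hn))
    ((hF₂.v .J rfl).trans ((hF₁.v .J rfl).trans hJ)) hS₂).mono ?_
  rintro σ₃ hF₃ ⟨hS₃, hC₃, ht₃⟩
  refine (updateEst_spec h σ₃ ((hF₃.a .Q rfl).trans q1) ((hF₃.v .qt rfl).trans q2)).mono ?_
  rintro σ₄ hF₄ ⟨h1, h2, h3, ht₄⟩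
  have e3 : σ₃.a .est = σ.a .est := (hF₃.a .est rfl).trans ((hF₂.a .est rfl).trans (hF₁.a .est rfl))
  simp only [St.tick_v, St.tick_a, St.tick_t, c1, c2, c3, c4, e3] at ht₁ ht₂ ht₃ ht₄ hE₂ hC₃ h1 h3
  refine ⟨h1, fun y => ?_, fun v x r p hp hx hr => ?_, ?_⟩
  · rcases h3 y with e | ⟨hv, e⟩
    · exact .inl e
    · refine .inr fun hlt => ?_
      rw [e] at hlt ⊢
      have := hS₃ 0 (Nat.zero_le _) y hv (by simpa using hlt) 0 (by simp)
      simpa using this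
  · obtain ⟨a, b, ha, hab, hPa, hPb, hlen, c, ⟨i₁, hi₁⟩, hb, hv⟩ :=
      h.tree.exists_fundamental p hp hx hr
    have hcov : Cov (fun y => ∃ i < qt, Q i = y) P n J (σ₂.a .M) c (D a + D b + 1) ∧
        Cov (fun y => ∃ i < qt, Q i = y) P n J (σ₂.a .M) (P c) (D a + D b + 1) := by
      -- Both orientations of the edge are among the scanned slots; take the one that starts at the
      -- deeper end.
      rcases le_total (D b) (D a) with hle | hle
      · obtain ⟨i, hi, rfl, rfl⟩ := hall a b ha hab
        exact hE₂ i hi hle hPa c (.inl ⟨⟨i₁, hi₁⟩, hb⟩)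
      · obtain ⟨i, hi, rfl, rfl⟩ := hall b a (h.tree.adj a b ha hab).1 hab.symm
        have := hE₂ i hi hle hPb c (.inr ⟨⟨i₁, hi₁⟩, hb⟩)
        rwa [add_comm (D (σ.a (.src g) (σ.a .SL i)))] at this
    have key : ∀ u, Cov (fun y => ∃ i < qt, Q i = y) P n J (σ₂.a .M) u (D a + D b + 1) →
        σ₄.a .est u ≤ D a + D b + 1 := by
      intro u hu
      obtain ⟨j', hj', z, ⟨i', hi', rfl⟩, i, hi, rfl, hw⟩ := hC₃ u _ hu
      obtain rfl : j' = 0 := by omega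
      obtain rfl : i = 0 := by omega
      exact (h2 i' hi').trans (by simpa using hw)
    rcases hv with rfl | rfl
    · exact (key _ hcov.1).trans hlen
    · exact (key _ hcov.2).trans hlen
  · nlinarith [Nat.zero_le (σ.v .c * J), Nat.zero_le (qt * J)]

end

end WordRAM.HL

/-! ### Searches without cutoff, followed by covering -/

namespace ANSC

section

variable {S : Slots} {n lim root st : ℕ} {b : BFSState}

theorem BFSInv.c_le_cnt (h : BFSInv S n lim root st b) : b.c ≤ S.cnt := by
  have := Finset.card_le_card_of_injOn (s := Finset.range b.c) (t := Finset.Icc 1 S.cnt) b.SL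
    (fun i hi => Finset.mem_coe.2 (Finset.mem_Icc.2 (h.SL_spec i (Finset.mem_range.1 hi)).1))
    (fun i hi j hj e => h.SL_inj i (Finset.mem_range.1 hi) j (Finset.mem_range.1 hj) e)
  simpa using this

theorem BFSInv.qt_le (h : BFSInv S n lim root st b) : b.qt ≤ n := by
  have := Finset.card_le_card_of_injOn (s := Finset.range b.qt) (t := Finset.range n) b.Q
    (fun i hi => Finset.mem_coe.2 (Finset.mem_range.2 (h.Q_lt i (Finset.mem_range.1 hi))))
    (fun i hi j hj e => h.Q_inj i (Finset.mem_range.1 hi) j (Finset.mem_range.1 hj) e)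
  simpa using this

end

end ANSC

namespace WordRAM.HL

open ANSC

/-- Search the graph from `root` and cover the fundamental cycles. -/
def search (g : Bool) : Cmd := bfs g ;; cover g

/-- The limit is one more than the number of slots and is never reached, so the search ends with an
exhausted queue and the tree is complete. -/
theorem search_spec {B : Bounds} {n J inf : ℕ} (hW : B.cap ≤ B.W) (g : Bool) (σ : St)
    {S : Slots} (hSg : σ.slots g = S) (hS : S.Good n)
    (hC : Chain (σ.v (.cnt g)) (σ.a (.src g)) (σ.a (.hd g)) (σ.a (.nx g)))
    (hroot : σ.v .root < n) (hvis : ∀ y, σ.a .vis y ≤ σ.v .st) (hst : σ.v .st + 1 < B.W)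
    (hlim : σ.v .lim = σ.v (.cnt g) + 1) (hcnt : σ.v (.cnt g) + 4 < B.cap)
    (hn : σ.v .n = n) (hJ : σ.v .J = J) (hinf : σ.v .inf = inf) (hnJ : n ≤ 2 ^ J)
    (hcap : (J + 3) * n + J + 3 < B.cap) (hinfW : inf < B.W) :
    wp B (search g) (fun σ' => (∀ y, σ'.a .est y ≤ σ.a .est y) ∧
      (∀ y, σ'.a .est y = σ.a .est y ∨
        (σ'.a .est y < inf → CycleLe S.graph y (σ'.a .est y))) ∧
      (∀ (v x r : ℕ) (p : S.graph.Walk v v), p.IsCycle → x ∈ p.support →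
        Near S.graph (σ.v .root) x r → σ'.a .est v ≤ p.length + 2 * r) ∧
      (∀ y, σ'.a .vis y ≤ σ'.v .st) ∧ σ'.v .st = σ.v .st + 1 ∧
      σ'.t ≤ σ.t + (σ.v (.cnt g) + 1) * (J + 1) * 400) σ := by
  subst hSg
  have hnc : n ≤ (J + 3) * n := Nat.le_mul_of_pos_left n (by omega)
  rw [search, wp_seq]
  refine (bfs_spec hW g σ.tick hS hC hroot hvis hst (by simp; omega) (by omega)
    (by simp; omega)).mono ?_
  rintro σ₁ hF ⟨hI, hend, hqt, hst₁, ht₁⟩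
  simp only [St.tick_v, St.tick_t] at hI hend hqt hst₁ ht₁
  rw [show σ.tick.slots g = σ.slots g from rfl] at hI
  have hcc : σ₁.v .c ≤ σ.v (.cnt g) := hI.c_le_cnt
  have hqn : σ₁.v .qt ≤ n := hI.qt_le
  have hfull : σ₁.v .qh = σ₁.v .qt := by
    have : σ₁.v .qh ≤ σ₁.v .qt := hI.qh_le
    omega
  have htree := hI.isBFSTree hS hfull
  have e1 : σ₁.a (.src g) = σ.a (.src g) := hF.a (.src g) (by simp [Cmd.wa, bfs])
  have e2 : σ₁.a (.tgt g) = σ.a (.tgt g) := hF.a (.tgt g) (by simp [Cmd.wa, bfs])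
  have hctx : CoverCtx B (σ.slots g).graph (σ₁.a .Q) (σ₁.v .qt) (σ₁.a .D) (σ₁.a .up)
      (σ.v .root) n J inf :=
    ⟨htree, hI.Q_lt, fun i hi => by
      have : σ₁.a .D (σ₁.a .Q i) ≤ i := hI.D_le i hi
      omega, hnJ, hcap, hW, hinfW, by omega⟩
  refine (cover_spec hctx g σ₁ rfl rfl rfl rfl ((hF.v .n rfl).trans hn) ((hF.v .J rfl).trans hJ)
    ((hF.v .inf rfl).trans hinf) (by omega) ?_ ?_).mono ?_
  · intro i hi
    obtain ⟨h1, h2, -⟩ := hI.SL_spec i hi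
    have hb : σ₁.a .SL i ≤ σ.v (.cnt g) := h1.2
    rw [e1, e2]
    refine ⟨by omega, ?_, hS.adj_iff.2 ⟨_, h1, rfl, rfl⟩⟩
    rcases h2 with ⟨i', hi', e⟩ | ⟨hlt, -⟩
    · exact ⟨i', hi'.trans_eq hfull, e.symm⟩
    · exact absurd hfull (show σ₁.v .qh < σ₁.v .qt from hlt).ne
  · rintro a b ⟨i, hi, rfl⟩ hab
    obtain ⟨q, h1, h2, rfl⟩ := hS.adj_iff.1 hab
    obtain ⟨j, hj, rfl⟩ := hI.done q h1 (.inl ⟨i, hi.trans_eq hfull.symm, h2⟩)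
    exact ⟨j, hj, by rw [e1]; exact h2, by rw [e2]; rfl⟩
  · rintro σ₂ hF₂ ⟨h1, h2, h3, h4⟩
    have e3 : σ₁.a .est = σ.a .est := hF.a .est rfl
    have e4 : σ₂.a .vis = σ₁.a .vis := hF₂.a .vis rfl
    have e5 : σ₂.v .st = σ₁.v .st := hF₂.v .st rfl
    rw [e3] at h1 h2
    refine ⟨h1, h2, h3, fun y => ?_, e5.trans hst₁, ?_⟩
    · rw [e4, e5, hst₁]; exact hI.vis_le y
    · have : (σ₁.v .c + σ₁.v .qt + 1) * (J + 1) * 100 ≤ (2 * (σ.v (.cnt g) + 1)) * (J + 1) * 100 := by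
        gcongr; omega
      nlinarith [Nat.zero_le (σ.v (.cnt g) * J)]

end WordRAM.HL

namespace ANSC

/-! ### Exploring the neighbourhood of a vertex by repeated bounded searches -/

/-- At least `A` slots start at distance at most `r` from `x`. -/
def Dense (S : Slots) (A x r : ℕ) : Prop :=
  ∃ U : Finset ℕ, A ≤ U.card ∧ ∀ q ∈ U, S.Mem q ∧ Near S.graph x (S.src q) r

/-- The slots of `H` have been collected from `S` by bounded searches from the first `eh` vertices
in the sequence `v = H.tgt 0, H.tgt 2, H.tgt 4, …`. -/
structure ExploreInv (S : Slots) (n A v eh : ℕ) (H : Slots) : Prop where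
  good : H.Good n
  sub : ∀ q, H.Mem q → ∃ q', S.Mem q' ∧ S.src q' = H.src q ∧ S.tgt q' = H.tgt q
  even : H.cnt % 2 = 0
  cnt_le : H.cnt ≤ 2 * (A * eh)
  zero : H.tgt 0 = v
  -- The item with number `e` is `H.tgt (2 * e)`. The bound `e ≤ A * (p + 1)` says that items found
  -- from item `p` have positions as in a complete `A`-ary tree, which is why `levels` measures the
  -- progress.
  proc : ∀ p < eh, ∀ r, (∀ q, S.Mem q → Near S.graph (H.tgt (2 * p)) (S.src q) r →
    ∃ e, 1 ≤ e ∧ 2 * e ≤ H.cnt ∧ e ≤ A * (p + 1) ∧ H.src (2 * e) = S.src q ∧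
      H.tgt (2 * e) = S.tgt q) ∨ Dense S A (H.tgt (2 * p)) r
  le : ∀ p < eh, 2 * p ≤ H.cnt

section

variable {S H : Slots} {n A v eh : ℕ}

theorem exploreInv_init (S : Slots) (n A v : ℕ) (src tgt : ℕ → ℕ) (h : tgt 0 = v) :
    ExploreInv S n A v 0 ⟨0, src, tgt⟩ := by
  have hm : ∀ q, ¬ Slots.Mem ⟨0, src, tgt⟩ q := fun q hq => by
    have h1 := hq.1
    have h2 := hq.2
    simp only at h2
    omega
  exact ⟨⟨fun q hq => absurd hq (hm q), fun q hq => absurd hq (hm q),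
    fun q hq => absurd hq (hm q)⟩, fun q hq => absurd hq (hm q), rfl, Nat.zero_le _, h,
    fun p hp => absurd hp (Nat.not_lt_zero p), fun p hp => absurd hp (Nat.not_lt_zero p)⟩

theorem ExploreInv.item_lt (h : ExploreInv S n A v eh H) (hv : v < n) {e : ℕ} (he : 2 * e ≤ H.cnt) :
    H.tgt (2 * e) < n := by
  rcases Nat.eq_zero_or_pos e with rfl | h0
  · rw [mul_zero, h.zero]; exact hv
  · exact h.good.tgt_lt ⟨by omega, he⟩

theorem ExploreInv.graph_le (hS : S.Good n) (h : ExploreInv S n A v eh H) :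
    H.graph ≤ S.graph := by
  intro a b hab
  obtain ⟨q, h1, rfl, rfl⟩ := h.good.adj_iff.1 hab
  obtain ⟨q', h2, h3, h4⟩ := h.sub q h1
  exact hS.adj_iff.2 ⟨q', h2, h3, h4⟩

/-- The slots in `SL` are appended in both directions. -/
structure Appended (S : Slots) (SL : ℕ → ℕ) (c : ℕ) (H : Slots) (src tgt : ℕ → ℕ) : Prop where
  src_old : ∀ q ≤ H.cnt, src q = H.src q
  tgt_old : ∀ q ≤ H.cnt, tgt q = H.tgt q
  src_odd : ∀ i < c, src (H.cnt + 2 * i + 1) = S.tgt (SL i)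
  tgt_odd : ∀ i < c, tgt (H.cnt + 2 * i + 1) = S.src (SL i)
  src_even : ∀ i < c, src (H.cnt + 2 * i + 2) = S.src (SL i)
  tgt_even : ∀ i < c, tgt (H.cnt + 2 * i + 2) = S.tgt (SL i)

theorem Appended.succ {SL : ℕ → ℕ} {c : ℕ} {src tgt : ℕ → ℕ} (h : Appended S SL c H src tgt) :
    Appended S SL (c + 1) H
      (Function.update (Function.update src (H.cnt + 2 * c + 1) (S.tgt (SL c)))
        (H.cnt + 2 * c + 2) (S.src (SL c)))
      (Function.update (Function.update tgt (H.cnt + 2 * c + 1) (S.src (SL c)))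
        (H.cnt + 2 * c + 2) (S.tgt (SL c))) := by
  constructor
  · intro q hq
    rw [Function.update_of_ne (by omega), Function.update_of_ne (by omega), h.src_old q hq]
  · intro q hq
    rw [Function.update_of_ne (by omega), Function.update_of_ne (by omega), h.tgt_old q hq]
  all_goals
    intro i hi
    rcases Nat.lt_or_ge i c with hlt | hge
  · rw [Function.update_of_ne (by omega), Function.update_of_ne (by omega), h.src_odd i hlt]
  · obtain rfl : i = c := by omega
    rw [Function.update_of_ne (by omega), Function.update_self]
  · rw [Function.update_of_ne (by omega), Function.update_of_ne (by omega), h.tgt_odd i hlt]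
  · obtain rfl : i = c := by omega
    rw [Function.update_of_ne (by omega), Function.update_self]
  · rw [Function.update_of_ne (by omega), Function.update_of_ne (by omega), h.src_even i hlt]
  · obtain rfl : i = c := by omega
    rw [Function.update_self]
  · rw [Function.update_of_ne (by omega), Function.update_of_ne (by omega), h.tgt_even i hlt]
  · obtain rfl : i = c := by omega
    rw [Function.update_self]

/-- The dichotomy `BFSInv.ball` for the new item. Of the two copies of a scanned slot, the forward
one gets the even number, so its target becomes an item from which to search later. -/
theorem ExploreInv.step (hS : S.Good n) (h : ExploreInv S n A v eh H) (heh : 2 * eh ≤ H.cnt)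
    {st : ℕ} {b : BFSState} (hb : BFSInv S n A (H.tgt (2 * eh)) st b)
    (hend : ¬ (b.qh < b.qt ∧ b.c < A)) {src tgt : ℕ → ℕ} (ha : Appended S b.SL b.c H src tgt) :
    ExploreInv S n A v (eh + 1) ⟨H.cnt + 2 * b.c, src, tgt⟩ := by
  set H' : Slots := ⟨H.cnt + 2 * b.c, src, tgt⟩ with hH'
  have hcases : ∀ q, H'.Mem q → H.Mem q ∨ ∃ i < b.c, q = H.cnt + 2 * i + 1 ∨ q = H.cnt + 2 * i + 2 := by
    intro q hq
    have h1 := hq.1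
    have h2 : q ≤ H.cnt + 2 * b.c := hq.2
    by_cases hle : q ≤ H.cnt
    · exact .inl ⟨h1, hle⟩
    · exact .inr ⟨(q - H.cnt - 1) / 2, by omega, by omega⟩
  have hold : ∀ q, H.Mem q → H'.Mem q := fun q hq => ⟨hq.1, hq.2.trans (Nat.le_add_right _ _)⟩
  have hodd : ∀ i < b.c, H'.Mem (H.cnt + 2 * i + 1) := fun i hi =>
    ⟨by omega, show _ ≤ H.cnt + 2 * b.c by omega⟩
  have heven : ∀ i < b.c, H'.Mem (H.cnt + 2 * i + 2) := fun i hi =>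
    ⟨by omega, show _ ≤ H.cnt + 2 * b.c by omega⟩
  have hsub : ∀ q, H'.Mem q → ∃ q', S.Mem q' ∧ S.src q' = src q ∧ S.tgt q' = tgt q := by
    intro q hq
    rcases hcases q hq with hm | ⟨i, hi, rfl | rfl⟩
    · rw [ha.src_old q hm.2, ha.tgt_old q hm.2]; exact h.sub q hm
    · rw [ha.src_odd i hi, ha.tgt_odd i hi]
      obtain ⟨q', h1, h2, h3⟩ := hS.symm _ (hb.SL_spec i hi).1
      exact ⟨q', h1, h2, h3⟩
    · rw [ha.src_even i hi, ha.tgt_even i hi]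
      exact ⟨_, (hb.SL_spec i hi).1, rfl, rfl⟩
  have hcA : b.c ≤ A := hb.c_le
  have hcnt := h.cnt_le
  have hAeh : A * (eh + 1) = A * eh + A := by ring
  refine ⟨⟨fun q hq => ?_, fun q hq => ?_, fun q hq => ?_⟩, hsub, ?_, ?_, ?_, ?_, ?_⟩
  · obtain ⟨q', h1, h2, -⟩ := hsub q hq
    exact h2.symm.trans_lt (hS.src_lt q' h1)
  · obtain ⟨q', h1, h2, h3⟩ := hsub q hq
    have := hS.ne q' h1
    rwa [h2, h3] at this
  · rcases hcases q hq with hm | ⟨i, hi, rfl | rfl⟩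
    · obtain ⟨q', h1, h2, h3⟩ := h.good.symm q hm
      refine ⟨q', hold q' h1, ?_, ?_⟩
      · simp only [hH', ha.src_old q' h1.2, ha.tgt_old q hm.2, h2]
      · simp only [hH', ha.tgt_old q' h1.2, ha.src_old q hm.2, h3]
    · exact ⟨_, heven i hi, by simp only [hH', ha.src_even i hi, ha.tgt_odd i hi],
        by simp only [hH', ha.tgt_even i hi, ha.src_odd i hi]⟩
    · exact ⟨_, hodd i hi, by simp only [hH', ha.src_odd i hi, ha.tgt_even i hi],
        by simp only [hH', ha.tgt_odd i hi, ha.src_even i hi]⟩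
  · have := h.even
    simp only [hH']; omega
  · simp only [hH', hAeh]; omega
  · simp only [hH', ha.tgt_old 0 (Nat.zero_le _), h.zero]
  · intro p hp r
    have hpc : 2 * p ≤ H.cnt := by
      rcases Nat.lt_or_ge p eh with hlt | hge
      · exact h.le p hlt
      · obtain rfl : p = eh := by omega
        exact heh
    simp only [hH', ha.tgt_old _ hpc]
    rcases Nat.lt_or_ge p eh with hlt | hge
    · refine (h.proc p hlt r).imp_left fun hl q hq hn => ?_
      obtain ⟨e, h1, h2, h3, h4, h5⟩ := hl q hq hn
      exact ⟨e, h1, by omega, h3, by rw [ha.src_old _ h2, h4], by rw [ha.tgt_old _ h2, h5]⟩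
    · obtain rfl : p = eh := by omega
      refine (hb.ball hS hend r).imp_left fun hl q hq hn => ?_
      obtain ⟨j, hj, rfl⟩ := hl q hq hn
      have hev := h.even
      have he : 2 * (H.cnt / 2 + j + 1) = H.cnt + 2 * j + 2 := by omega
      refine ⟨H.cnt / 2 + j + 1, by omega, by omega, by rw [hAeh]; omega, ?_, ?_⟩
      · rw [he, ha.src_even j hj]
      · rw [he, ha.tgt_even j hj]
  · intro p hp
    simp only [hH']
    rcases Nat.lt_or_ge p eh with hlt | hge
    · have := h.le p hlt; omega
    · omega

/-- The number of vertices in a complete `A`-ary tree with `h` levels. -/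
def levels (A h : ℕ) : ℕ := ∑ j ∈ Finset.range h, A ^ j

/-- The first `levels A h` items have their children among the first `levels A (h + 1)` items. -/
theorem levels_succ (A h : ℕ) : levels A (h + 1) = A * levels A h + 1 := by
  rw [levels, Finset.sum_range_succ', levels, Finset.mul_sum]
  simp [pow_succ']

theorem levels_mono (A : ℕ) {h h' : ℕ} (hh : h ≤ h') : levels A h ≤ levels A h' :=
  Finset.sum_le_sum_of_subset (Finset.range_mono hh)

/-- Walks through sparse regions are contained in the explored part. -/
theorem ExploreInv.adj_of_mem_darts (hS : S.Good n) (hH : ExploreInv S n A v eh H) {h ρ : ℕ}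
    (hend : ¬ (2 * eh ≤ H.cnt ∧ eh < levels A h)) {y u : ℕ} (p : S.graph.Walk y u) :
    ∀ (i l e : ℕ), i ≤ h → l < ρ → p.length + l ≤ i * ρ → 2 * e ≤ H.cnt →
      e < levels A (h - i + 1) → Near S.graph (H.tgt (2 * e)) y l →
      ¬ Dense S A (H.tgt (2 * e)) (ρ - 1) → (∀ x ∈ p.support, ¬ Dense S A x (ρ - 1)) →
      ∀ d ∈ p.darts, H.graph.Adj d.fst d.snd := by
  -- Here `e` is the item whose search is responsible for `y`, at distance at most `l < ρ`, and `i`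
  -- is the number of generations left, enough for the rest of the walk by `p.length + l ≤ i * ρ`.
  induction p with
  | nil => intro i l e _ _ _ _ _ _ _ _ d hd; simp at hd
  | @cons y z u hyz p ih =>
    intro i l e hi hl hlen he heZ hnear hd hsup d hdd
    rw [SimpleGraph.Walk.length_cons] at hlen
    obtain ⟨i, rfl⟩ : ∃ i', i = i' + 1 := by
      cases i with
      | zero => rw [zero_mul] at hlen; omega
      | succ i' => exact ⟨i', rfl⟩
    -- As `i ≥ 1`, item `e` is among the first `levels A h` items, all of which, if they exist, have
    -- been processed when the exploration ends.
    have heeh : e < eh := by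
      by_contra hcon
      have := levels_mono A (show h - (i + 1) + 1 ≤ h by omega)
      exact hend ⟨by omega, by omega⟩
    have hadd := (hH.proc e heeh (ρ - 1)).resolve_right hd
    obtain ⟨q, hq1, hq2, hq3⟩ := hS.adj_iff.1 hyz
    obtain ⟨p₀, hp₀⟩ := hnear
    obtain ⟨e', h1, h2, h3, h4, h5⟩ := hadd q hq1 ⟨p₀.copy rfl hq2.symm, by
      rw [SimpleGraph.Walk.length_copy]; omega⟩
    rw [hq2] at h4
    rw [hq3] at h5
    rw [SimpleGraph.Walk.darts_cons, List.mem_cons] at hdd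
    rw [SimpleGraph.Walk.support_cons] at hsup
    have hsup' : ∀ x ∈ p.support, ¬ Dense S A x (ρ - 1) := fun x hx =>
      hsup x (List.mem_cons_of_mem _ hx)
    rcases hdd with rfl | hdd
    · exact hH.good.adj_iff.2 ⟨2 * e', ⟨by omega, h2⟩, h4, h5⟩
    -- Either the same item remains responsible, or the walk is `ρ` steps away from it; then `z`,
    -- the target of slot `2 * e'`, is an item of the next generation and takes over.
    · by_cases hlast : l + 1 < ρ
      · exact ih (i + 1) (l + 1) e hi hlast (by omega) he heZ
          ⟨p₀.concat hyz, by rw [SimpleGraph.Walk.length_concat]; omega⟩ hd hsup' d hdd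
      · rw [Nat.succ_mul] at hlen
        refine ih i 0 e' (by omega) (by omega) (by omega) h2 ?_ ?_ ?_ hsup' d hdd
        · rw [show h - i + 1 = (h - (i + 1) + 1) + 1 by omega, levels_succ]
          exact Nat.lt_succ_of_le (h3.trans (Nat.mul_le_mul_left A heZ))
        · rw [h5]; exact ⟨.nil, le_rfl⟩
        · rw [h5]; exact hsup' z p.start_mem_support

/-- Cut the cycle after `h * ρ` steps. Both parts, the second one reversed, are walks from `v` of
length at most `h * ρ` through sparse vertices, so `adj_of_mem_darts` applies to each. -/
theorem ExploreInv.cycleLe (hS : S.Good n) (hH : ExploreInv S n A v eh H) {h ρ : ℕ}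
    (hend : ¬ (2 * eh ≤ H.cnt ∧ eh < levels A h)) (hρ : 1 ≤ ρ) (p : S.graph.Walk v v)
    (hp : p.IsCycle) (hlen : p.length ≤ 2 * h * ρ) (hd : ∀ x ∈ p.support, ¬ Dense S A x (ρ - 1)) :
    ∃ p' : H.graph.Walk v v, p'.IsCycle ∧ p'.length = p.length := by
  have key : ∀ {u : ℕ} (q : S.graph.Walk v u), q.length ≤ h * ρ →
      (∀ x ∈ q.support, x ∈ p.support) → ∀ d ∈ q.darts, H.graph.Adj d.fst d.snd := by
    intro u q hq hqs
    refine hH.adj_of_mem_darts hS hend q h 0 0 le_rfl (by omega) (by omega) (Nat.zero_le _) ?_ ?_ ?_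
      fun x hx => hd x (hqs x hx)
    · rw [Nat.sub_self, levels_succ]; omega
    · rw [mul_zero, hH.zero]; exact ⟨.nil, le_rfl⟩
    · rw [mul_zero, hH.zero]; exact hd v p.start_mem_support
  have hadj : ∀ d ∈ p.darts, H.graph.Adj d.fst d.snd := by
    intro d hdd
    have hlen' : p.length ≤ h * ρ + h * ρ := by rw [← two_mul, ← mul_assoc]; exact hlen
    rw [← p.append_take_drop_eq (h * ρ), SimpleGraph.Walk.darts_append, List.mem_append] at hdd
    rcases hdd with hdd | hdd
    · exact key _ (by rw [SimpleGraph.Walk.take_length]; exact min_le_left _ _)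
        (fun x hx => (p.isSubwalk_take _).support_subset hx) d hdd
    · refine (key (p.drop (h * ρ)).reverse ?_ (fun x hx => ?_) d.symm ?_).symm
      · rw [SimpleGraph.Walk.length_reverse, SimpleGraph.Walk.drop_length]; omega
      · rw [SimpleGraph.Walk.support_reverse, List.mem_reverse] at hx
        exact (p.isSubwalk_drop _).support_subset hx
      · rw [SimpleGraph.Walk.darts_reverse, List.mem_reverse, List.mem_map]
        exact ⟨d, hdd, rfl⟩
  have hedge : ∀ e ∈ p.edges, e ∈ H.graph.edgeSet := by
    intro e he
    obtain ⟨d, hdd, rfl⟩ := List.mem_map.1 he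
    exact hadj d hdd
  exact ⟨p.transfer H.graph hedge, hp.transfer hedge, SimpleGraph.Walk.length_transfer _ _⟩

end

end ANSC

/-! ### The exploration as a program -/

namespace WordRAM.HL

open ANSC

/-- Append the scanned slots to the second graph, in both directions. -/
def append : Cmd :=
  .forTo .i V.c
    (.asg .p (.rd .SL V.i) ;; .asg .y (V.cnt true + 2 * V.i) ;;
     .st (.src true) (V.y + 1) (.rd (.tgt false) V.p) ;;
     .st (.src true) (V.y + 2) (.rd (.src false) V.p) ;;
     .st (.tgt true) (V.y + 1) (.rd (.src false) V.p) ;;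
     .st (.tgt true) (V.y + 2) (.rd (.tgt false) V.p))

/-- Collect slots around the vertex `v`. -/
def explore : Cmd :=
  .asg (.cnt true) 0 ;; .st (.tgt true) 0 V.v ;; .asg .eh 0 ;; .asg .lim V.A ;;
  .whl ((2 * V.eh : Ex).lt (V.cnt true + 1) * (Ex.var .eh).lt V.Z)
    (.asg .root (.rd (.tgt true) (2 * V.eh)) ;; bfs false ;; append ;;
     .asg (.cnt true) (V.cnt true + 2 * V.c) ;; .asg .eh (V.eh + 1))

variable {B : Bounds}

theorem append_spec (hW : B.cap ≤ B.W) (σ : St) (hc : σ.v (.cnt true) + 2 * σ.v .c + 4 < B.cap)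
    (hSL : ∀ i < σ.v .c, σ.a .SL i < B.cap) :
    wp B append (fun σ' => Appended (σ.slots false) (σ.a .SL) (σ.v .c) (σ.slots true)
      (σ'.a (.src true)) (σ'.a (.tgt true)) ∧ σ'.t ≤ σ.t + (σ.v .c * 14 + 3)) σ := by
  refine wp_forTo (I := fun k a => Appended (σ.slots false) (σ.a .SL) k (σ.slots true)
      (a (.src true)) (a (.tgt true))) (b := σ.v .c) (τ := 11) rfl (by omega) ?_ ?_ ?_ ?_
  · constructor
    · intro q _; rfl
    · intro q _; rfl
    all_goals exact fun i hi => absurd hi (Nat.not_lt_zero i)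
  · intro σ' hv ha
    simp [hv .c (by decide) rfl]
  · intro k hk σ' hI hk' hv ha
    have e1 : σ'.a .SL = σ.a .SL := ha .SL rfl
    have e2 : σ'.a (.src false) = σ.a (.src false) := ha (.src false) rfl
    have e3 : σ'.a (.tgt false) = σ.a (.tgt false) := ha (.tgt false) rfl
    have e4 : σ'.v (.cnt true) = σ.v (.cnt true) := hv (.cnt true) (by decide) rfl
    have := hSL k hk
    simp [inRange_iff, hk', e1, e2, e3, e4]
    and_intros <;> try omega
    exact hI.succ
  · intro σ' hI hv ha ht
    exact ⟨hI, by omega⟩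

-- At most `Z` searches, each scanning at most `A` slots and costing time of order `A + 1`. The
-- stamp `st` grows by at most `Z`, which is recorded because it must fit into a word over the whole
-- run.
set_option maxHeartbeats 1000000 in
theorem explore_spec (hW : B.cap ≤ B.W) (σ : St) {n : ℕ} (hS : (σ.slots false).Good n)
    (hC : Chain (σ.v (.cnt false)) (σ.a (.src false)) (σ.a (.hd false)) (σ.a (.nx false)))
    (hv : σ.v .v < n) (hvis : ∀ y, σ.a .vis y ≤ σ.v .st) (hst : σ.v .st + σ.v .Z + 1 < B.W)
    (hA : σ.v .A + 3 < B.cap) (hn : n < B.cap) (hcnt : σ.v (.cnt false) + 1 < B.cap)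
    (hZ : 2 * ((σ.v .A + 1) * (σ.v .Z + 1)) + 4 < B.cap) :
    wp B explore (fun σ' => ∃ eh,
      ExploreInv (σ.slots false) n (σ.v .A) (σ.v .v) eh (σ'.slots true) ∧
      ¬ (2 * eh ≤ σ'.v (.cnt true) ∧ eh < σ.v .Z) ∧ σ'.v (.cnt true) ≤ 2 * (σ.v .A * σ.v .Z) ∧
      (∀ y, σ'.a .vis y ≤ σ'.v .st) ∧ σ'.v .st ≤ σ.v .st + σ.v .Z ∧
      σ'.t ≤ σ.t + (σ.v .Z * ((σ.v .A + 1) * 100) + 20)) σ := by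
  set S := σ.slots false with hSdef
  set A := σ.v .A with hAdef
  set Z := σ.v .Z with hZdef
  have hbound : 2 * (A * Z) + 2 * A + 2 * Z + 6 < B.cap := by nlinarith
  simp only [explore, wp_seq, wp_asg, wp_st]
  refine ⟨by simp; omega, by simp [inRange_iff]; omega, by simp; omega, trivial, ?_⟩
  refine wp_whl (I := fun σ' => ExploreInv S n A (σ.v .v) (σ'.v .eh) (σ'.slots true) ∧
      σ'.v .eh ≤ Z ∧ (∀ y, σ'.a .vis y ≤ σ'.v .st) ∧ σ'.v .st ≤ σ.v .st + σ'.v .eh ∧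
      σ'.t ≤ σ.t + σ'.v .eh * ((A + 1) * 100) + 16) (μ := fun σ' => Z - σ'.v .eh) ?_ ?_ ?_ ?_
  · refine ⟨?_, ?_, ?_, ?_, ?_⟩
    · exact exploreInv_init _ _ _ _ _ _ (by simp)
    · simp
    · simpa using hvis
    · simp
    · simp
  · rintro σ' ⟨hI, heh, -⟩ hF
    have hc := hI.cnt_le
    have : A * σ'.v .eh ≤ A * Z := Nat.mul_le_mul_left A heh
    have hc' : σ'.v (.cnt true) ≤ 2 * (A * Z) := by
      refine le_trans hc ?_; omega
    simp only [Ex.ok_lt, Ex.ok_mul, Ex.ok_var, Ex.ok_lit2, Ex.ok_add, Ex.ok_lit1, Ex.eval_lt, Ex.eval_var,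
      Ex.eval_lit1, Ex.eval_lit2, Ex.eval_mul, Ex.eval_add, true_and, and_true]
    exact ⟨⟨⟨by omega, by omega⟩, by omega, by omega⟩, indicator_mul_lt (by omega)⟩
  · rintro σ' ⟨hI, heh, hvis', hst', ht⟩ hF hlt
    have hS' : σ'.slots false = S := by
      have h1 := hF.v (.cnt false) rfl
      have h2 := hF.a (.src false) rfl
      have h3 := hF.a (.tgt false) rfl
      simp at h1 h2 h3
      simp [hSdef, St.slots, h1, h2, h3]
    have e1 : σ'.v (.cnt false) = σ.v (.cnt false) := by simpa using hF.v (.cnt false) rfl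
    have e2 : σ'.a (.src false) = σ.a (.src false) := by simpa using hF.a (.src false) rfl
    have e3 : σ'.a (.hd false) = σ.a (.hd false) := by simpa using hF.a (.hd false) rfl
    have e4 : σ'.a (.nx false) = σ.a (.nx false) := by simpa using hF.a (.nx false) rfl
    have e5 : σ'.v .lim = A := by simpa using hF.v .lim rfl
    have e6 : σ'.v .Z = Z := by simpa using hF.v .Z rfl
    have hlt' : 2 * σ'.v .eh < σ'.v (.cnt true) + 1 ∧ σ'.v .eh < Z := by
      have h := indicator_mul_ne_zero.1 hlt
      simp only [Ex.eval_var, e6] at h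
      exact h
    have hc := hI.cnt_le
    have hAe : A * (σ'.v .eh + 1) ≤ A * Z := Nat.mul_le_mul_left A hlt'.2
    rw [Nat.mul_succ] at hAe
    have hc' : σ'.v (.cnt true) ≤ 2 * (A * σ'.v .eh) := hc
    have hitem := hI.item_lt hv (e := σ'.v .eh) (by have := hlt'.1; simp only [St.slots]; omega)
    simp only [St.slots] at hitem
    rw [wp_seq, wp_asg]
    refine ⟨by simp [inRange_iff]; omega, ?_⟩
    rw [wp_seq]
    refine (bfs_spec hW false _ (n := n) (by
      change (σ'.slots false).Good n
      rw [hS']; exact hS) (by simpa [e1, e2, e3, e4] using hC) (by simpa using hitem)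
      (by simpa using hvis') (by simp; omega) (by simpa [e5] using hA) hn
      (by simpa [e1] using hcnt)).mono ?_
    rintro σ₁ hF₁ ⟨hb, hend, hqt, hst₁, ht₁⟩
    have f1 : σ₁.v (.cnt true) = σ'.v (.cnt true) := by simpa using hF₁.v (.cnt true) rfl
    have f2 : σ₁.v .eh = σ'.v .eh := by simpa using hF₁.v .eh rfl
    have f3 : σ₁.slots false = S := by
      rw [← hS']
      have h1 := hF₁.v (.cnt false) rfl
      have h2 := hF₁.a (.src false) rfl
      have h3 := hF₁.a (.tgt false) rfl
      simp at h1 h2 h3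
      simp [St.slots, h1, h2, h3]
    have f4 : σ₁.slots true = σ'.slots true := by
      have h1 := hF₁.v (.cnt true) rfl
      have h2 := hF₁.a (.src true) rfl
      have h3 := hF₁.a (.tgt true) rfl
      simp at h1 h2 h3
      simp [St.slots, h1, h2, h3]
    simp [e5] at hb hend hst₁ ht₁
    change BFSInv (σ'.slots false) _ _ _ _ _ at hb
    rw [hS'] at hb
    have hcA : σ₁.v .c ≤ A := hb.c_le
    have hcc : σ₁.v .c ≤ σ.v (.cnt false) := hb.c_le_cnt
    rw [wp_seq]
    refine (append_spec hW _ (by simp [f1]; omega) fun i hi => ?_).mono ?_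
    · have : σ₁.a .SL i ≤ σ.v (.cnt false) := (hb.SL_spec i hi).1.2
      simp; omega
    rintro σ₂ hF₂ ⟨happ, ht₂⟩
    have g1 : σ₂.v (.cnt true) = σ'.v (.cnt true) := (hF₂.v (.cnt true) rfl).trans f1
    have g2 : σ₂.v .eh = σ'.v .eh := (hF₂.v .eh rfl).trans f2
    have g3 : σ₂.v .c = σ₁.v .c := hF₂.v .c rfl
    have g4 : σ₂.v .st = σ₁.v .st := hF₂.v .st rfl
    have g5 : σ₂.a .vis = σ₁.a .vis := hF₂.a .vis rfl
    change Appended (σ₁.slots false) (σ₁.a .SL) (σ₁.v .c) (σ₁.slots true) _ _ at happ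
    rw [f3, f4] at happ
    have hstep := hI.step hS (by have := hlt'.1; simp only [St.slots]; omega) hb (by
      rintro ⟨h1, h2⟩
      exact absurd (hend h1) (not_le.2 h2)) happ
    simp only [wp_seq, wp_asg]
    refine ⟨by simp [g1, g3]; omega, by simp [g2]; omega, ⟨?_, ?_, ?_, ?_, ?_⟩, ?_⟩
    · simpa [St.slots, St.bfsState, g1, g2, g3] using hstep
    · simp [g2]; omega
    · intro y
      simp [g5, g4, hst₁]
      exact hb.vis_le y
    · simp [g4, hst₁, g2]; omega
    · simp [g2] at ht₂ ⊢
      nlinarith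
    · simp [g2]; omega
  · rintro σ' ⟨hI, heh, hvis', hst', ht⟩ hF hlt
    have e6 : σ'.v .Z = Z := by simpa using hF.v .Z rfl
    have hc := hI.cnt_le
    have hAe : A * σ'.v .eh ≤ A * Z := Nat.mul_le_mul_left A heh
    have hc' : σ'.v (.cnt true) ≤ 2 * (A * σ'.v .eh) := hc
    have hZe : σ'.v .eh * ((A + 1) * 100) ≤ Z * ((A + 1) * 100) := Nat.mul_le_mul_right _ heh
    have hlt' : ¬ (2 * σ'.v .eh < σ'.v (.cnt true) + 1 ∧ σ'.v .eh < Z) := by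
      intro h
      refine indicator_mul_ne_zero.2 ?_ hlt
      simp only [Ex.eval_var, e6]
      exact h
    exact ⟨_, hI, fun h => hlt' ⟨by have := h.1; simp only [St.tick_v] at this; omega, h.2⟩,
      by simp only [St.tick_v]; omega, hvis', by simp only [St.tick_v]; omega,
      by simp only [St.tick_t]; omega⟩

end WordRAM.HL

/-! ### The state between searches, and the improvement of one vertex -/

namespace WordRAM.HL

open ANSC

/-- The graph has been stored and everything is prepared for searching. -/
structure Ready (B : Bounds) (S : Slots) (n J inf : ℕ) (σ : St) : Prop where
  cap_le : B.cap ≤ B.W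
  good : S.Good n
  n_le : n ≤ 2 ^ J
  cap : (J + 3) * n + J + 3 < B.cap
  inf_lt : inf < B.W
  cnt_lt : S.cnt + 4 < B.cap
  slots : σ.slots false = S
  chain : Chain S.cnt S.src (σ.a (.hd false)) (σ.a (.nx false))
  vis : ∀ y, σ.a .vis y ≤ σ.v .st
  n_eq : σ.v .n = n
  J_eq : σ.v .J = J
  inf_eq : σ.v .inf = inf

/-- The estimates are upper bounds. -/
def EstSound (G : SimpleGraph ℕ) (n inf : ℕ) (est : ℕ → ℕ) : Prop :=
  ∀ y < n, est y < inf → CycleLe G y (est y)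

variable {B : Bounds} {S : Slots} {n J inf : ℕ}

theorem Ready.n_lt {σ : St} (h : Ready B S n J inf σ) : n < B.cap := by
  have := h.cap
  have : n ≤ (J + 3) * n := Nat.le_mul_of_pos_left n (by omega)
  omega

theorem Ready.cnt_eq {σ : St} (h : Ready B S n J inf σ) : σ.v (.cnt false) = S.cnt :=
  congrArg Slots.cnt h.slots

theorem Ready.src_eq {σ : St} (h : Ready B S n J inf σ) : σ.a (.src false) = S.src :=
  congrArg Slots.src h.slots

/-- Commands that do not touch the data keep the machine ready. -/
theorem Ready.frame {σ σ' : St} (h : Ready B S n J inf σ) {c : Cmd} (hF : Frame c σ σ')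
    (hc : c.wv (.cnt false) = false ∧ c.wa (.src false) = false ∧ c.wa (.tgt false) = false ∧
      c.wa (.hd false) = false ∧ c.wa (.nx false) = false ∧ c.wv .n = false ∧ c.wv .J = false ∧
      c.wv .inf = false) (hvis : ∀ y, σ'.a .vis y ≤ σ'.v .st) : Ready B S n J inf σ' := by
  obtain ⟨h1, h2, h3, h4, h5, h6, h7, h8⟩ := hc
  refine { h with
    slots := ?_
    chain := ?_
    vis := hvis
    n_eq := (hF.v _ h6).trans h.n_eq
    J_eq := (hF.v _ h7).trans h.J_eq
    inf_eq := (hF.v _ h8).trans h.inf_eq }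
  · rw [← h.slots]
    simp [St.slots, hF.v _ h1, hF.a _ h2, hF.a _ h3]
  · rw [hF.a _ h4, hF.a _ h5]; exact h.chain

/-- A search of the whole graph. -/
theorem Ready.search_spec {σ : St} (h : Ready B S n J inf σ) (hroot : σ.v .root < n)
    (hst : σ.v .st + 1 < B.W) (hlim : σ.v .lim = S.cnt + 1)
    (hest : EstSound S.graph n inf (σ.a .est)) :
    wp B (search false) (fun σ' => Ready B S n J inf σ' ∧ (∀ y, σ'.a .est y ≤ σ.a .est y) ∧
      EstSound S.graph n inf (σ'.a .est) ∧
      (∀ (v x r : ℕ) (p : S.graph.Walk v v), p.IsCycle → x ∈ p.support →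
        Near S.graph (σ.v .root) x r → σ'.a .est v ≤ p.length + 2 * r) ∧
      σ'.v .st = σ.v .st + 1 ∧ σ'.t ≤ σ.t + (S.cnt + 1) * (J + 1) * 400) σ := by
  have hc := h.cnt_eq
  have hcl := h.cnt_lt
  refine (HL.search_spec (inf := inf) h.cap_le false σ h.slots h.good
    (by rw [hc, h.src_eq]; exact h.chain) hroot h.vis hst (by rw [hlim, hc]) (by omega) h.n_eq h.J_eq
    h.inf_eq h.n_le h.cap h.inf_lt).mono ?_
  rw [hc]
  rintro σ' hF ⟨h1, h2, h3, h4, h5, h6⟩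
  refine ⟨h.frame hF ⟨rfl, rfl, rfl, rfl, rfl, rfl, rfl, rfl⟩ h4, h1, fun y hyn hy => ?_, h3, h5, h6⟩
  rcases h2 y with e | e
  · rw [e] at hy ⊢; exact hest y hyn hy
  · exact e hy

/-- Improve the estimate of the vertex `v` by searching the explored part of the graph. -/
def localRound : Cmd :=
  explore ;; build true ;; .asg .root V.v ;; .asg .lim (V.cnt true + 1) ;; search true ;; reset true

/-- The explored graph is a subgraph, so its cycles are legitimate bounds; a sparse cycle through
`v` survives in it, and searching from `v`, a vertex at distance 0 from the cycle, finds its length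
without error. The final reset restores the empty lists that the next round expects. -/
theorem localRound_spec {σ : St} {A h v : ℕ} (hR : Ready B S n J inf σ) (hv : σ.v .v = v)
    (hvn : v < n) (hA : σ.v .A = A) (hZ : σ.v .Z = levels A h)
    (hst : σ.v .st + levels A h + 2 < B.W) (hcap : 2 * ((A + 1) * (levels A h + 1)) + 4 < B.cap)
    (hhd : ∀ u, σ.a (.hd true) u = 0) (hest : EstSound S.graph n inf (σ.a .est)) :
    wp B localRound (fun σ' => Ready B S n J inf σ' ∧ (∀ y, σ'.a .est y ≤ σ.a .est y) ∧
      EstSound S.graph n inf (σ'.a .est) ∧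
      (∀ (ρ : ℕ) (p : S.graph.Walk v v), 1 ≤ ρ → p.IsCycle → p.length ≤ 2 * h * ρ →
        (∀ x ∈ p.support, ¬ Dense S A x (ρ - 1)) → σ'.a .est v ≤ p.length) ∧
      (∀ u, σ'.a (.hd true) u = 0) ∧ σ'.v .st ≤ σ.v .st + levels A h + 1 ∧
      σ'.t ≤ σ.t + (A + 1) * (levels A h + 1) * (J + 1) * 2000) σ := by
  have hcl := hR.cnt_lt
  have hcw := hR.cap_le
  set Z := levels A h with hZdef
  have hbound : 2 * (A * Z) + 2 * A + 2 * Z + 6 < B.cap := by nlinarith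
  rw [localRound, wp_seq]
  refine (explore_spec hR.cap_le σ.tick (n := n) (by
      change (σ.slots false).Good n
      rw [hR.slots]; exact hR.good) (by
      simp only [St.tick_v, St.tick_a]; rw [hR.cnt_eq, hR.src_eq]; exact hR.chain)
    (by simpa [hv] using hvn) hR.vis (by simp [hZ]; omega) (by simp [hA]; omega) hR.n_lt
    (by simp [hR.cnt_eq]; omega) (by simp [hA, hZ]; omega)).mono ?_
  rintro σ₁ hF₁ ⟨eh, hE, hend, hcnt, hvis₁, hst₁, ht₁⟩
  simp only [St.tick_v, St.tick_t, hA, hZ, hv] at hE hend hcnt hst₁ ht₁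
  change ExploreInv (σ.slots false) _ _ _ _ _ at hE
  rw [hR.slots] at hE
  have hR₁ := hR.frame (c := explore) ⟨hF₁.v, hF₁.a⟩ ⟨rfl, rfl, rfl, rfl, rfl, rfl, rfl, rfl⟩ hvis₁
  have a1 : σ₁.a (.hd true) = σ.a (.hd true) := hF₁.a (.hd true) rfl
  have a2 : σ₁.a .est = σ.a .est := hF₁.a .est rfl
  have a3 : σ₁.v .v = v := (hF₁.v .v rfl).trans hv
  have hsrc : ∀ q, (σ₁.slots true).Mem q → σ₁.a (.src true) q < B.cap := fun q hq =>
    (hE.good.src_lt q hq).trans hR.n_lt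
  rw [wp_seq]
  refine (build_spec hR.cap_le true σ₁.tick (by simp only [St.tick_v]; omega) hsrc
    (by simpa [a1] using hhd)).mono ?_
  rintro σ₂ hF₂ ⟨hC, ht₂⟩
  have b1 : σ₂.slots true = σ₁.slots true := by
    simp [St.slots, hF₂.v (.cnt true) rfl, hF₂.a (.src true) rfl, hF₂.a (.tgt true) rfl]
  have b2 : σ₂.v (.cnt true) = σ₁.v (.cnt true) := hF₂.v (.cnt true) rfl
  have b3 : σ₂.a (.src true) = σ₁.a (.src true) := hF₂.a (.src true) rfl
  have b4 : σ₂.a .vis = σ₁.a .vis := hF₂.a .vis rfl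
  have b5 : σ₂.v .st = σ₁.v .st := hF₂.v .st rfl
  have b6 : σ₂.a .est = σ.a .est := (hF₂.a .est rfl).trans a2
  have b7 : σ₂.v .v = v := (hF₂.v .v rfl).trans a3
  have hR₂ := hR₁.frame (c := build true) ⟨hF₂.v, hF₂.a⟩
    ⟨rfl, rfl, rfl, rfl, rfl, rfl, rfl, rfl⟩ (by rw [b4, b5]; exact hvis₁)
  simp only [St.tick_v, St.tick_a, St.tick_t] at hC ht₂
  rw [wp_seq, wp_asg]
  refine ⟨trivial, ?_⟩
  rw [wp_seq, wp_asg]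
  refine ⟨by simp [b2]; omega, ?_⟩
  rw [wp_seq]
  refine (HL.search_spec (n := n) (J := J) (inf := inf) hR.cap_le true _
    (S := σ₁.slots true) (by exact b1) hE.good (by simpa [b2, b3] using hC) (by simpa [b7] using hvn)
    (by simpa [b4, b5] using hvis₁) (by simp [b5]; omega) (by simp) (by simp [b2]; omega)
    (by simpa using hR₂.n_eq) (by simpa using hR₂.J_eq) (by simpa using hR₂.inf_eq) hR.n_le hR.cap
    hR.inf_lt).mono ?_
  rintro σ₃ hF₃ ⟨h1, h2, h3, h4, h5, h6⟩
  simp [b2, b5, b6, b7] at h1 h2 h3 h5 h6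
  have c1 : σ₃.slots true = σ₁.slots true := by
    rw [← b1]
    have h1 := hF₃.v (.cnt true) rfl
    have h2 := hF₃.a (.src true) rfl
    have h3 := hF₃.a (.tgt true) rfl
    simp at h1 h2 h3
    simp [St.slots, h1, h2, h3]
  have c2 : σ₃.v (.cnt true) = σ₁.v (.cnt true) := congrArg Slots.cnt c1
  have c3 : σ₃.a (.src true) = σ₁.a (.src true) := congrArg Slots.src c1
  have hR₃ := hR₂.frame (c := .asg .root V.v ;; .asg .lim (V.cnt true + 1) ;; search true)
    (σ' := σ₃) ⟨fun x hx => ?_, fun j hj => ?_⟩ ⟨rfl, rfl, rfl, rfl, rfl, rfl, rfl, rfl⟩ h4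
  rotate_left
  · simp only [Cmd.wv, Bool.or_eq_false_iff, decide_eq_false_iff_not] at hx
    rw [hF₃.v x hx.2.2]
    simp [hx.1, hx.2.1]
  · simp only [Cmd.wa, Bool.or_eq_false_iff] at hj
    rw [hF₃.a j hj.2.2]
    rfl
  have hC₃ : Chain (σ₃.v (.cnt true)) (σ₃.a (.src true)) (σ₃.a (.hd true)) (σ₃.a (.nx true)) := by
    have e1 : σ₃.a (.hd true) = σ₂.a (.hd true) := by simpa using hF₃.a (.hd true) rfl
    have e2 : σ₃.a (.nx true) = σ₂.a (.nx true) := by simpa using hF₃.a (.nx true) rfl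
    rw [c2, c3, e1, e2]; exact hC
  refine (reset_spec hR.cap_le true σ₃ (by omega) (by
    rw [c1, c3]; exact hsrc) hC₃).mono ?_
  rintro σ₄ hF₄ ⟨hhd', ht₄⟩
  have d1 : σ₄.a .est = σ₃.a .est := hF₄.a .est rfl
  have d2 : σ₄.v .st = σ₃.v .st := hF₄.v .st rfl
  have d3 : σ₄.a .vis = σ₃.a .vis := hF₄.a .vis rfl
  refine ⟨hR₃.frame hF₄ ⟨rfl, rfl, rfl, rfl, rfl, rfl, rfl, rfl⟩ (by rw [d2, d3]; exact h4), ?_, ?_, ?_, hhd',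
    by omega, ?_⟩
  · rw [d1]; exact h1
  · rw [d1]
    intro y hyn hy
    rcases h2 y with e | e
    · rw [e] at hy ⊢; exact hest y hyn hy
    · exact (e hy).mono_graph (hE.graph_le hR.good)
  · intro ρ p hρ hp hlen hd
    rw [d1]
    obtain ⟨p', hp', hl⟩ := hE.cycleLe hR.good hend hρ p hp hlen hd
    rw [← hl]
    exact h3 v v 0 p' hp' p'.start_mem_support ⟨.nil, le_rfl⟩
  · rw [c2] at ht₄
    have e1 : (σ₁.v (.cnt true) + 1) * (J + 1) * 400 ≤ (2 * (A * Z) + 1) * (J + 1) * 400 := by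
      gcongr
    nlinarith [Nat.zero_le (A * Z * J), Nat.zero_le (A * J), Nat.zero_le (Z * J), Nat.zero_le (A * Z)]

end WordRAM.HL

/-! ### The loop over all vertices, one random search, and the output -/

namespace WordRAM.HL

open ANSC

/-- Improve the estimates of all vertices by local searches. -/
def localLoop : Cmd := .asg .v 0 ;; .whl ((Ex.var .v).lt V.n) (localRound ;; .asg .v (V.v + 1))

/-- Improve the estimates by a search from the source of a slot that is given by the word `r`. -/
def globalRound : Cmd :=
  .asg .root (.rd (.src false) (V.r - V.r / V.cnt false * V.cnt false + 1)) ;;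
  .asg .lim (V.cnt false + 1) ;; search false ;; .asg .T (V.T - 1)

/-- Write the output. -/
def output : Cmd :=
  .forTo .i V.n (.st .low V.i (.rd .est V.i * (Ex.rd .est V.i).lt V.inf))

variable {B : Bounds} {S : Slots} {n J inf : ℕ}

/-- The estimates are exact for all vertices on short cycles in sparse regions. -/
def LocalDone (S : Slots) (A h v : ℕ) (est : ℕ → ℕ) : Prop :=
  ∀ (ρ : ℕ) (p : S.graph.Walk v v), 1 ≤ ρ → p.IsCycle → p.length ≤ 2 * h * ρ →
    (∀ x ∈ p.support, ¬ Dense S A x (ρ - 1)) → est v ≤ p.length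

theorem LocalDone.mono {A h v : ℕ} {est est' : ℕ → ℕ} (hd : LocalDone S A h v est)
    (he : ∀ y, est' y ≤ est y) : LocalDone S A h v est' :=
  fun ρ p h1 h2 h3 h4 => (he v).trans (hd ρ p h1 h2 h3 h4)

theorem localLoop_spec {σ : St} {A h : ℕ} (hR : Ready B S n J inf σ) (hA : σ.v .A = A)
    (hZ : σ.v .Z = levels A h) (hst : σ.v .st + n * (levels A h + 1) + 1 < B.W)
    (hcap : 2 * ((A + 1) * (levels A h + 1)) + 4 < B.cap)
    (hhd : ∀ u, σ.a (.hd true) u = 0) (hest : EstSound S.graph n inf (σ.a .est)) :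
    wp B localLoop (fun σ' => Ready B S n J inf σ' ∧ EstSound S.graph n inf (σ'.a .est) ∧
      (∀ v < n, LocalDone S A h v (σ'.a .est)) ∧
      σ'.v .st ≤ σ.v .st + n * (levels A h + 1) ∧
      σ'.t ≤ σ.t + n * ((A + 1) * (levels A h + 1) * (J + 1) * 2100) + 5) σ := by
  have hnlt := hR.n_lt
  have hcw := hR.cap_le
  set Z := levels A h with hZdef
  simp only [localLoop, wp_seq, wp_asg]
  refine ⟨by simp; omega, ?_⟩
  have hR₀ := hR.frame (c := .asg .v 0) (σ' := (σ.tick.setV .v 0).tick)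
    ⟨fun x hx => by
      have : x ≠ .v := by simpa [Cmd.wv] using hx
      simp [this], fun _ _ => rfl⟩ ⟨rfl, rfl, rfl, rfl, rfl, rfl, rfl, rfl⟩ hR.vis
  refine wp_whl (I := fun σ' => Ready B S n J inf σ' ∧ σ'.v .v ≤ n ∧
      EstSound S.graph n inf (σ'.a .est) ∧ (∀ v < σ'.v .v, LocalDone S A h v (σ'.a .est)) ∧
      (∀ u, σ'.a (.hd true) u = 0) ∧ σ'.v .st ≤ σ.v .st + σ'.v .v * (Z + 1) ∧
      σ'.t ≤ σ.t + σ'.v .v * ((A + 1) * (Z + 1) * (J + 1) * 2100) + 3)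
    (μ := fun σ' => n - σ'.v .v) ?_ ?_ ?_ ?_
  · exact ⟨hR₀, Nat.zero_le _, hest, fun v hv => absurd hv (Nat.not_lt_zero v), hhd,
      by simp, by simp⟩
  · rintro σ' - -
    simp
  · rintro σ' ⟨hR', hvn, hest', hdone, hhd', hst', ht⟩ hF hlt
    have hlt' : σ'.v .v < n := by
      by_contra hcon
      simp [hR'.n_eq, hcon] at hlt
    have hmul : (σ'.v .v + 1) * (Z + 1) ≤ n * (Z + 1) := Nat.mul_le_mul_right _ hlt'
    rw [Nat.succ_mul] at hmul
    rw [wp_seq]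
    refine (localRound_spec (σ := σ'.tick.tick) (A := A) (h := h) (v := σ'.v .v)
      (hR'.frame (c := .skip) (σ' := σ'.tick.tick) ⟨fun _ _ => rfl, fun _ _ => rfl⟩
        ⟨rfl, rfl, rfl, rfl, rfl, rfl, rfl, rfl⟩ hR'.vis) rfl hlt'
      ((hF.v .A rfl).trans (by simpa using hA)) ((hF.v .Z rfl).trans (by simpa using hZ))
      (by simp only [St.tick_v]; omega) hcap hhd' hest').mono ?_
    rintro σ₁ hF₁ ⟨hR₁, h1, h2, h3, h4, h5, h6⟩
    have e1 : σ₁.v .v = σ'.v .v := hF₁.v .v rfl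
    have hR₂ := hR₁.frame (c := .asg .v 0) (σ' := (σ₁.setV .v (σ'.v .v + 1)).tick)
      ⟨fun x hx => by
        have : x ≠ .v := by simpa [Cmd.wv] using hx
        simp [this], fun _ _ => rfl⟩ ⟨rfl, rfl, rfl, rfl, rfl, rfl, rfl, rfl⟩ hR₁.vis
    rw [wp_asg]
    simp only [Ex.ok_add, Ex.ok_var, Ex.ok_lit1, Ex.eval_add, Ex.eval_var, Ex.eval_lit1, e1, true_and]
    refine ⟨⟨by omega, by omega⟩, ⟨hR₂, by simp; omega, h2, ?_, h4, ?_, ?_⟩, ?_⟩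
    · intro v hv
      simp at hv
      rcases Nat.lt_or_ge v (σ'.v .v) with hlt | hge
      · exact (hdone v hlt).mono h1
      · obtain rfl : v = σ'.v .v := by omega
        exact h3
    · simp only [St.tick_v, ← hZdef] at h5
      simp
      rw [Nat.succ_mul]
      omega
    · simp only [St.tick_t, ← hZdef] at h6
      simp
      have : 1 ≤ (A + 1) * (Z + 1) * (J + 1) := Nat.mul_pos (Nat.mul_pos (by omega) (by omega)) (by omega)
      rw [Nat.succ_mul]
      omega
    · simp; omega
  · rintro σ' ⟨hR', hvn, hest', hdone, hhd', hst', ht⟩ hF hlt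
    have hlt' : σ'.v .v = n := by
      by_contra hcon
      have : σ'.v .v < n := by omega
      simp [hR'.n_eq, this] at hlt
    rw [hlt'] at hdone hst' ht
    refine ⟨hR'.frame (c := .skip) (σ' := σ'.tick) ⟨fun _ _ => rfl, fun _ _ => rfl⟩
        ⟨rfl, rfl, rfl, rfl, rfl, rfl, rfl, rfl⟩ hR'.vis, hest', hdone, hst', ?_⟩
    simp only [St.tick_t]
    omega

theorem globalRound_spec {σ : St} {i : ℕ} (hR : Ready B S n J inf σ) (hcnt : 0 < S.cnt)
    (hr : σ.v .r < B.W) (hT : σ.v .T = i + 1) (hst : σ.v .st + 1 < B.W)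
    (hest : EstSound S.graph n inf (σ.a .est)) :
    wp B globalRound (fun σ' => Ready B S n J inf σ' ∧ (∀ y, σ'.a .est y ≤ σ.a .est y) ∧
      EstSound S.graph n inf (σ'.a .est) ∧
      (∀ (v x r : ℕ) (p : S.graph.Walk v v), p.IsCycle → x ∈ p.support →
        Near S.graph (S.src (σ.v .r % S.cnt + 1)) x r → σ'.a .est v ≤ p.length + 2 * r) ∧
      σ'.v .T = i ∧ σ'.v .st = σ.v .st + 1 ∧
      σ'.t ≤ σ.t + ((S.cnt + 1) * (J + 1) * 400 + 10)) σ := by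
  have hcl := hR.cnt_lt
  have hcw := hR.cap_le
  -- The small language has division but no remainder.
  have hmod : σ.v .r - σ.v .r / S.cnt * S.cnt = σ.v .r % S.cnt := by
    rw [mul_comm]; exact (Nat.mod_eq_sub_mul_div).symm
  have hle : σ.v .r / S.cnt * S.cnt ≤ σ.v .r := Nat.div_mul_le_self _ _
  have hmlt := Nat.mod_lt (σ.v .r) hcnt
  have hmem : S.Mem (σ.v .r % S.cnt + 1) := ⟨by omega, hmlt⟩
  have hroot := hR.good.src_lt _ hmem
  simp only [globalRound, wp_seq, wp_asg]
  refine ⟨by simp [inRange_iff, hR.cnt_eq, hmod]; omega, by simp [hR.cnt_eq]; omega, ?_⟩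
  have hR₁ := hR.frame (c := .asg .root 0 ;; .asg .lim 0) (σ' :=
    (((σ.tick.setV .root (S.src (σ.v .r % S.cnt + 1))).tick.tick).setV .lim (S.cnt + 1)).tick.tick)
    ⟨fun x hx => by
      simp only [Cmd.wv, Bool.or_eq_false_iff, decide_eq_false_iff_not] at hx
      simp [hx.1, hx.2], fun _ _ => rfl⟩ ⟨rfl, rfl, rfl, rfl, rfl, rfl, rfl, rfl⟩ hR.vis
  simp [hR.cnt_eq, hR.src_eq, hmod]
  refine (hR₁.search_spec (by simpa using hroot) (by simpa using hst) (by simp) hest).mono ?_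
  rintro σ₁ hF ⟨h1, h2, h3, h4, h5, h6⟩
  have e1 : σ₁.v .T = i + 1 := by simpa [hT] using hF.v .T rfl
  have hR₂ := h1.frame (c := .asg .T 0) (σ' := (σ₁.setV .T i).tick)
    ⟨fun x hx => by
      have : x ≠ .T := by simpa [Cmd.wv] using hx
      simp [this], fun _ _ => rfl⟩ ⟨rfl, rfl, rfl, rfl, rfl, rfl, rfl, rfl⟩ h1.vis
  simp at h2 h4 h5 h6
  simp [e1]
  exact ⟨by omega, hR₂, h2, h3, fun v x r p hp hx hn => h4 v x r p hp hx hn, h5, by omega⟩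

/-- Multiplication with the indicator of being below `inf` turns missing estimates into 0, the code
for infinity. -/
theorem output_spec {σ : St} (hR : Ready B S n J inf σ) (hN : n ≤ B.N) (hNW : B.N ≤ B.W)
    (hest : ∀ v < n, σ.a .est v < B.W) :
    wp B output (fun σ' => (∀ v < n, σ'.a .low v = if σ.a .est v < inf then σ.a .est v else 0) ∧
      σ'.t ≤ σ.t + (n * 4 + 3)) σ := by
  have hnlt := hR.n_lt
  have hcw := hR.cap_le
  have hcap := hR.cap
  have h3n : 3 * n ≤ (J + 3) * n := Nat.mul_le_mul_right n (by omega)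
  refine wp_forTo (I := fun k a => ∀ v < k, a .low v = if σ.a .est v < inf then σ.a .est v else 0)
    (b := n) (τ := 1) rfl (by omega) (fun v hv => absurd hv (Nat.not_lt_zero v)) ?_ ?_ ?_
  · intro σ' hv ha
    simp [hv .n (by decide) rfl, hR.n_eq]
  · intro k hk σ' hI hk' hv ha
    have e1 : σ'.a .est = σ.a .est := ha .est rfl
    have e2 : σ'.v .inf = inf := (hv .inf (by decide) rfl).trans hR.inf_eq
    have := hest k hk
    simp only [wp_st, Ex.ok_var, Ex.ok_mul, Ex.ok_rd, Ex.ok_lt, Ex.eval_var, Ex.eval_rd, Ex.eval_lt,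
      Ex.eval_mul, hk', e1, e2, inRange_iff, ne_eq, reduceCtorEq, not_false_eq_true, true_and,
      and_true, St.tick_a, St.tick_t, St.setA_a, St.setA_t, if_true]
    refine ⟨⟨⟨by omega, by omega, ?_⟩, ?_⟩, ?_, le_rfl⟩
    · split_ifs <;> omega
    · simp only [Bounds.inRange, if_true]; omega
    · intro v hv
      rw [Function.update_apply]
      by_cases h1 : v = k
      · subst h1
        rw [if_pos rfl]
        split_ifs <;> simp
      · rw [if_neg h1]
        exact hI v (by omega)
  · intro σ' hI hv ha ht
    exact ⟨hI, ht⟩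

end WordRAM.HL

/-! ### The choice of the threshold and of the number of generations -/

namespace ANSC

/-- `A` is the size of the neighbourhoods, and `h` is the number of rounds of the exploration. -/
def Params (n m k A h : ℕ) : Prop :=
  -- In the second alternative `A` is the integer part of `(m²/n)^(1/k)`. If that is below 2, then
  -- `A = 2m + 1` exceeds the number of slots: no ball is dense, and one generation explores
  -- everything.
  (m * m < n * 2 ^ k ∧ A = 2 * m + 1 ∧ h = 1) ∨
    (2 ≤ A ∧ n * A ^ k ≤ m * m ∧ m * m < n * (A + 1) ^ k ∧ h = k - 1)

/-- The geometric sum, with base `a + 2` to avoid subtraction. -/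
theorem levels_eq (a h : ℕ) : (a + 1) * levels (a + 2) h + 1 = (a + 2) ^ h := by
  induction h with
  | zero => simp [levels]
  | succ h ih =>
    rw [levels_succ, pow_succ, ← ih]
    ring

theorem mul_levels_le {A : ℕ} (hA : 2 ≤ A) (h : ℕ) : A * levels A h ≤ 2 * A ^ h := by
  obtain ⟨a, rfl⟩ : ∃ a, A = a + 2 := ⟨A - 2, by omega⟩
  have := levels_eq a h
  nlinarith [Nat.zero_le (a * levels (a + 2) h)]

theorem one_le_levels {A h : ℕ} (hh : 1 ≤ h) : 1 ≤ levels A h := by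
  obtain ⟨h, rfl⟩ : ∃ h', h = h' + 1 := ⟨h - 1, by omega⟩
  rw [levels_succ]; omega

section

variable {n m k A h : ℕ}

theorem Params.two_le (hP : Params n m k A h) (hm : 1 ≤ m) : 2 ≤ A := by
  rcases hP with ⟨-, rfl, -⟩ | ⟨h1, -⟩ <;> omega

theorem Params.h_pos (hP : Params n m k A h) (hk : 2 ≤ k) : 1 ≤ h := by
  rcases hP with ⟨-, -, rfl⟩ | ⟨-, -, -, rfl⟩ <;> omega

/-- Multiplied by `A`, the cost `n A · levels A h` of all explorations is bounded by `2 n A^k ≤ 2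
m²`, as `h = k - 1`. -/
theorem Params.mul_levels (hP : Params n m k A h) (hk : 2 ≤ k) :
    (A = 2 * m + 1 ∧ levels A h = 1) ∨ n * (A * (A * levels A h)) ≤ 2 * (m * m) := by
  rcases hP with ⟨-, h1, rfl⟩ | ⟨h1, h2, -, rfl⟩
  · exact .inl ⟨h1, by simp [levels]⟩
  · right
    obtain ⟨k, rfl⟩ : ∃ k', k = k' + 1 := ⟨k - 1, by omega⟩
    have := mul_levels_le h1 k
    rw [pow_succ] at h2
    rw [Nat.add_sub_cancel]
    calc n * (A * (A * levels A k)) ≤ n * (A * (2 * A ^ k)) := by gcongr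
      _ = 2 * (n * (A ^ k * A)) := by ring
      _ ≤ 2 * (m * m) := by omega

/-- A crude polynomial bound that holds in both alternatives; it only ensures that nothing
overflows. -/
theorem Params.levels_le (hP : Params n m k A h) (hk : 2 ≤ k) (hn : 1 ≤ n) (hm : 1 ≤ m) :
    n * ((A + 1) * (levels A h + 1)) ≤ n * (8 * m + 8) + 4 * (m * m) := by
  have h1 := hP.two_le hm
  have h2 := one_le_levels (A := A) (hP.h_pos hk)
  rcases hP.mul_levels hk with ⟨rfl, h3⟩ | h3
  · rw [h3]; nlinarith
  · have h4 : (A + 1) * (levels A h + 1) ≤ 2 * (A * (A * levels A h)) + 0 := by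
      have : A * levels A h * 2 ≤ A * levels A h * A := Nat.mul_le_mul_left _ h1
      have h5 : A * 1 ≤ A * levels A h := Nat.mul_le_mul_left _ h2
      have h6 : 2 * levels A h ≤ A * levels A h := Nat.mul_le_mul_right _ h1
      nlinarith
    have := Nat.mul_le_mul_left n h4
    nlinarith

/-- In the second alternative `2 ^ k ≤ n A ^ k ≤ m²`, so `k` is logarithmic. This keeps the time for
computing `levels A h` independent of `k`. -/
theorem Params.h_le (hP : Params n m k A h) (hn : 1 ≤ n) {e : ℕ} (he : m * m < 2 ^ e) (he1 : 1 ≤ e) :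
    h ≤ e := by
  rcases hP with ⟨-, -, rfl⟩ | ⟨h1, h2, -, rfl⟩
  · exact he1
  · have : 2 ^ k < 2 ^ e := by
      calc 2 ^ k ≤ A ^ k := Nat.pow_le_pow_left h1 k
        _ ≤ n * A ^ k := Nat.le_mul_of_pos_left _ hn
        _ < 2 ^ e := h2.trans_lt he
    have := (Nat.pow_lt_pow_iff_right (by omega)).1 this
    omega

end

end ANSC

/-! ### Computing the parameters -/

namespace WordRAM.HL

open ANSC

variable {B : Bounds}

/-- Compute `n (A + 1) ^ k`, or some value that exceeds `b` if this does. -/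
def power : Cmd :=
  .asg .p V.n ;; .asg .i 0 ;;
  .whl ((Ex.var .i).lt V.k * (Ex.var .p).lt (V.b + 1)) (.asg .p (V.p * (V.A + 1)) ;; .asg .i (V.i + 1))

/-- Compute the parameters `A` and `h`. -/
def calcA : Cmd :=
  .asg .b (V.m * V.m) ;; .asg .A 1 ;; power ;;
  .whl ((Ex.var .p).lt (V.b + 1)) (.asg .A (V.A + 1) ;; power) ;;
  .ite (Ex.eq V.A 1) (.asg .A (2 * V.m + 1) ;; .asg .h 1) (.asg .h (V.k - 1))

/-- Compute the number `Z` of vertices to be explored. -/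
def calcZ : Cmd :=
  .asg .Z 0 ;; .asg .i 0 ;; .whl ((Ex.var .i).lt V.h) (.asg .Z (V.A * V.Z + 1) ;; .asg .i (V.i + 1))

/-- Compute the logarithm `J` of `n`. -/
def calcJ : Cmd :=
  .asg .J 0 ;; .asg .p 1 ;; .whl ((Ex.var .p).lt V.n) (.asg .p (2 * V.p) ;; .asg .J (V.J + 1))

/-- The loop multiplies only while the value is at most `b`, so nothing overflows; each factor is at
least 2, so there are at most `e` rounds even if `k` is huge. -/
theorem power_spec {σ : St} {n k A b e : ℕ} (hn : σ.v .n = n) (hk : σ.v .k = k) (hA : σ.v .A = A)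
    (hb : σ.v .b = b) (hn1 : 1 ≤ n) (hA1 : 1 ≤ A) (he : b < 2 ^ e) (hkW : k < B.W)
    (hbW : b * (A + 1) + n + A + b + 2 < B.W) :
    wp B power (fun σ' => (σ'.v .p ≤ b ↔ n * (A + 1) ^ k ≤ b) ∧ σ'.t ≤ σ.t + (e * 6 + 10)) σ := by
  simp only [power, wp_seq, wp_asg]
  refine ⟨by simp, by simp; omega, ?_⟩
  refine wp_whl (I := fun σ' => σ'.v .p = n * (A + 1) ^ σ'.v .i ∧ σ'.v .i ≤ k ∧ σ'.v .i ≤ e ∧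
      σ'.t ≤ σ.t + (σ'.v .i * 6 + 6)) (μ := fun σ' => k - σ'.v .i) ?_ ?_ ?_ ?_
  · simp [hn]
  · rintro σ' - hF
    have e1 : σ'.v .b = b := (hF.v .b rfl).trans (by simpa using hb)
    simp only [Ex.ok_mul, Ex.ok_lt, Ex.ok_var, Ex.ok_add, Ex.ok_lit1, Ex.eval_lt, Ex.eval_var,
      Ex.eval_lit1, Ex.eval_add, true_and, and_true, e1]
    exact ⟨by omega, indicator_mul_lt (by omega)⟩
  · rintro σ' ⟨h1, h2, h3, h4⟩ hF hlt
    have e1 : σ'.v .b = b := (hF.v .b rfl).trans (by simpa using hb)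
    have e2 : σ'.v .k = k := (hF.v .k rfl).trans (by simpa using hk)
    have e3 : σ'.v .A = A := (hF.v .A rfl).trans (by simpa using hA)
    have hlt' := indicator_mul_ne_zero.1 hlt
    simp only [Ex.eval_var, Ex.eval_add, Ex.eval_lit1, e1, e2] at hlt'
    have hie : σ'.v .i < e := by
      refine (Nat.pow_lt_pow_iff_right (a := 2) (by omega)).1 (lt_of_le_of_lt ?_ he)
      calc 2 ^ σ'.v .i ≤ (A + 1) ^ σ'.v .i := Nat.pow_le_pow_left (by omega) _
        _ ≤ n * (A + 1) ^ σ'.v .i := Nat.le_mul_of_pos_left _ hn1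
        _ ≤ b := by rw [← h1]; omega
    have hpb : σ'.v .p * (A + 1) ≤ b * (A + 1) := Nat.mul_le_mul_right _ (by omega)
    simp [e3]
    refine ⟨by omega, by omega, ⟨?_, by omega, by omega, by omega⟩, by omega⟩
    rw [h1, pow_succ, mul_assoc]
  · rintro σ' ⟨h1, h2, h3, h4⟩ hF hlt
    have e1 : σ'.v .b = b := (hF.v .b rfl).trans (by simpa using hb)
    have e2 : σ'.v .k = k := (hF.v .k rfl).trans (by simpa using hk)
    have hlt' : ¬ (σ'.v .i < k ∧ σ'.v .p < b + 1) := by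
      intro h
      refine indicator_mul_ne_zero.2 ?_ hlt
      simpa [e1, e2] using h
    simp only [St.tick_v, St.tick_t]
    refine ⟨?_, by omega⟩
    by_cases hik : σ'.v .i < k
    · have hle : n * (A + 1) ^ σ'.v .i ≤ n * (A + 1) ^ k :=
        Nat.mul_le_mul_left n (Nat.pow_le_pow_right (by omega) hik.le)
      rw [← h1] at hle
      constructor
      · intro h; exact absurd ⟨hik, by omega⟩ hlt'
      · intro h; omega
    · rw [h1, show σ'.v .i = k by omega]

/-- A linear search for the largest `A` with `n A ^ k ≤ m²`. It stops at `A ≤ m`, and time of order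
`m log n` is affordable. -/
theorem calcA_spec {σ : St} {n m k e : ℕ} (hn : σ.v .n = n) (hm : σ.v .m = m) (hk : σ.v .k = k)
    (hn1 : 1 ≤ n) (hm1 : 1 ≤ m) (hk2 : 2 ≤ k) (he : m * m < 2 ^ e) (hkW : k < B.W)
    (hbW : m * m * (m + 1) + n + 2 * m + m * m + 2 < B.W) :
    wp B calcA (fun σ' => Params n m k (σ'.v .A) (σ'.v .h) ∧ σ'.t ≤ σ.t + (m * (e * 6 + 20) + 20)) σ := by
  simp only [calcA, wp_seq, wp_asg]
  refine ⟨by simp [hm]; omega, by simp; omega, ?_⟩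
  have hmm : m * m * 2 ≤ m * m * (m + 1) := Nat.mul_le_mul_left _ (by omega)
  refine (power_spec (A := 1) (b := m * m) (by simpa using hn) (by simpa using hk) (by simp)
    (by simp [hm]) hn1 le_rfl he hkW (by omega)).mono ?_
  rintro σ₁ hF₁ ⟨hp, ht₁⟩
  have e1 : σ₁.v .A = 1 := by simpa using hF₁.v .A rfl
  have e2 : σ₁.v .b = m * m := by simpa [hm] using hF₁.v .b rfl
  have e3 : σ₁.v .n = n := by simpa [hn] using hF₁.v .n rfl
  have e4 : σ₁.v .k = k := by simpa [hk] using hF₁.v .k rfl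
  have e5 : σ₁.v .m = m := by simpa [hm] using hF₁.v .m rfl
  simp at ht₁
  refine wp_whl (I := fun σ' => 1 ≤ σ'.v .A ∧ σ'.v .A ≤ m ∧ (σ'.v .A = 1 ∨ n * σ'.v .A ^ k ≤ m * m) ∧
      (σ'.v .p ≤ m * m ↔ n * (σ'.v .A + 1) ^ k ≤ m * m) ∧ σ'.t ≤ σ.t + (σ'.v .A * (e * 6 + 20)))
    (μ := fun σ' => m - σ'.v .A) ?_ ?_ ?_ ?_
  · refine ⟨e1.ge, by simpa [e1] using hm1, .inl e1, by simpa [e1] using hp, ?_⟩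
    simp [e1]; omega
  · rintro σ' - hF
    have f2 : σ'.v .b = m * m := (hF.v .b rfl).trans (by simpa using e2)
    simp [f2]; omega
  · rintro σ' ⟨h1, h2, h3, h4, h5⟩ hF hlt
    have f2 : σ'.v .b = m * m := (hF.v .b rfl).trans (by simpa using e2)
    have f3 : σ'.v .n = n := (hF.v .n rfl).trans (by simpa using e3)
    have f4 : σ'.v .k = k := (hF.v .k rfl).trans (by simpa using e4)
    have hlt' : σ'.v .p ≤ m * m := by
      by_contra hcon
      have : ¬ σ'.v .p < m * m + 1 := by omega
      simp [f2, this] at hlt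
    have hpow := h4.1 hlt'
    have hAm : σ'.v .A + 1 ≤ m := by
      -- Otherwise `(m + 1) ^ 2 ≤ n (A + 1) ^ k ≤ m ^ 2`, since `k ≥ 2`.
      by_contra hcon
      have h6 : (m + 1) ^ 2 ≤ n * (σ'.v .A + 1) ^ k := by
        calc (m + 1) ^ 2 ≤ (m + 1) ^ k := Nat.pow_le_pow_right (by omega) hk2
          _ ≤ (σ'.v .A + 1) ^ k := Nat.pow_le_pow_left (by omega) _
          _ ≤ n * (σ'.v .A + 1) ^ k := Nat.le_mul_of_pos_left _ hn1
      nlinarith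
    have hmul : m * m * (σ'.v .A + 1 + 1) ≤ m * m * (m + 1) := Nat.mul_le_mul_left _ (by omega)
    rw [wp_seq, wp_asg]
    refine ⟨by simp; omega, ?_⟩
    refine (power_spec (A := σ'.v .A + 1) (b := m * m) (by simpa using f3) (by simpa using f4) (by simp)
      (by simpa using f2) hn1 (by omega) he hkW (by omega)).mono ?_
    rintro σ₂ hF₂ ⟨hp₂, ht₂⟩
    have g1 : σ₂.v .A = σ'.v .A + 1 := by simpa using hF₂.v .A rfl
    simp at ht₂
    simp only [g1]
    refine ⟨⟨by omega, hAm, .inr hpow, hp₂, ?_⟩, by omega⟩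
    rw [Nat.succ_mul]; omega
  · rintro σ' ⟨h1, h2, h3, h4, h5⟩ hF hlt
    have f2 : σ'.v .b = m * m := (hF.v .b rfl).trans (by simpa using e2)
    have f4 : σ'.v .k = k := (hF.v .k rfl).trans (by simpa using e4)
    have f5 : σ'.v .m = m := (hF.v .m rfl).trans (by simpa using e5)
    have hlt' : ¬ σ'.v .p ≤ m * m := by
      intro hcon
      have : σ'.v .p < m * m + 1 := by omega
      simp [f2, this] at hlt
    rw [h4, not_le] at hlt'
    have hmul : σ'.v .A * (e * 6 + 20) ≤ m * (e * 6 + 20) := Nat.mul_le_mul_right _ h2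
    simp [f4, f5]
    refine ⟨by omega, fun hA => ⟨by omega, by omega, ?_, by omega⟩, fun hA => ⟨by omega, ?_, by omega⟩⟩
    · have hA : σ'.v .A = 1 := by by_contra hcon; exact hA (if_neg hcon)
      rw [hA] at hlt'
      exact .inl ⟨hlt', rfl, rfl⟩
    · have hA : σ'.v .A ≠ 1 := fun hcon => one_ne_zero ((if_pos hcon).symm.trans hA)
      exact .inr ⟨by omega, h3.resolve_left hA, hlt', rfl⟩

theorem calcZ_spec {σ : St} {A h : ℕ} (hA : σ.v .A = A) (hh : σ.v .h = h)
    (hhW : h + 1 < B.W) (hAZ : A * levels A h + 1 < B.W) :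
    wp B calcZ (fun σ' => σ'.v .Z = levels A h ∧ σ'.t ≤ σ.t + (h * 6 + 10)) σ := by
  simp only [calcZ, wp_seq, wp_asg]
  refine ⟨by simp; omega, by simp; omega, ?_⟩
  refine wp_whl (I := fun σ' => σ'.v .Z = levels A (σ'.v .i) ∧ σ'.v .i ≤ h ∧
      σ'.t ≤ σ.t + (σ'.v .i * 6 + 6)) (μ := fun σ' => h - σ'.v .i) ?_ ?_ ?_ ?_
  · simp [levels]
  · rintro σ' - -
    simp
  · rintro σ' ⟨h1, h2, h3⟩ hF hlt
    have e1 : σ'.v .A = A := (hF.v .A rfl).trans (by simpa using hA)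
    have e2 : σ'.v .h = h := (hF.v .h rfl).trans (by simpa using hh)
    have hlt' : σ'.v .i < h := by
      by_contra hcon
      simp [e2, hcon] at hlt
    have := Nat.mul_le_mul_left A (levels_mono A h2)
    simp [e1, h1, levels_succ]
    exact ⟨by omega, by omega, by omega, by omega⟩
  · rintro σ' ⟨h1, h2, h3⟩ hF hlt
    have e2 : σ'.v .h = h := (hF.v .h rfl).trans (by simpa using hh)
    have hlt' : σ'.v .i = h := by
      by_contra hcon
      have : σ'.v .i < h := by omega
      simp [e2, this] at hlt
    rw [hlt'] at h1 h3
    exact ⟨h1, by simp only [St.tick_t]; omega⟩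

theorem calcJ_spec {σ : St} {n : ℕ} (hn : σ.v .n = n) (hnW : 2 * n + 2 < B.W) :
    wp B calcJ (fun σ' => n ≤ 2 ^ σ'.v .J ∧ (σ'.v .J = 0 ∨ 2 ^ (σ'.v .J - 1) < n) ∧
      σ'.t ≤ σ.t + (σ'.v .J * 6 + 10)) σ := by
  simp only [calcJ, wp_seq, wp_asg]
  refine ⟨by simp; omega, by simp; omega, ?_⟩
  refine wp_whl (I := fun σ' => σ'.v .p = 2 ^ σ'.v .J ∧ (σ'.v .J = 0 ∨ 2 ^ (σ'.v .J - 1) < n) ∧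
      σ'.t ≤ σ.t + (σ'.v .J * 6 + 6)) (μ := fun σ' => n - σ'.v .p) ?_ ?_ ?_ ?_
  · simp
  · rintro σ' - -
    simp
  · rintro σ' ⟨h1, h2, h3⟩ hF hlt
    have e1 : σ'.v .n = n := (hF.v .n rfl).trans (by simpa using hn)
    have hlt' : σ'.v .p < n := by
      by_contra hcon
      simp [e1, hcon] at hlt
    have hJ : σ'.v .J < 2 ^ σ'.v .J := Nat.lt_two_pow_self
    have hp : 0 < 2 ^ σ'.v .J := by positivity
    simp [h1]
    refine ⟨⟨by omega, by omega⟩, by omega, ⟨by rw [pow_succ'], by omega, by omega⟩, by omega⟩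
  · rintro σ' ⟨h1, h2, h3⟩ hF hlt
    have e1 : σ'.v .n = n := (hF.v .n rfl).trans (by simpa using hn)
    have hlt' : n ≤ σ'.v .p := by
      by_contra hcon
      have : σ'.v .p < n := by omega
      simp [e1, this] at hlt
    exact ⟨h1 ▸ hlt', h2, by simp only [St.tick_t, St.tick_v]; omega⟩

end WordRAM.HL

/-! ### Reading the input -/

namespace WordRAM.HL

open ANSC

/-- Read the list of edges. -/
def readEdges : Cmd :=
  .forTo .i V.m
    (.asg .y (2 * V.i) ;;
     .st (.src false) (V.y + 1) (.rd .low (V.y + 3)) ;;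
     .st (.src false) (V.y + 2) (.rd .low (V.y + 4)) ;;
     .st (.tgt false) (V.y + 1) (.rd .low (V.y + 4)) ;;
     .st (.tgt false) (V.y + 2) (.rd .low (V.y + 3)))

/-- Initialize the estimates. -/
def initEst : Cmd := .forTo .i V.n (.st .est V.i V.inf)

/-- Read the input. -/
def readInput : Cmd :=
  .asg .n (.rd .low 0) ;; .asg .m (.rd .low 1) ;; .asg .k (.rd .low 2) ;;
  -- The value `4n + 1` is a safe infinity: a cycle has at most `n` vertices, so an estimate within
  -- the guarantee is at most `3n`.
  .asg (.cnt false) (2 * V.m) ;; readEdges ;; build false ;; .asg .inf (4 * V.n + 1) ;; initEst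

/-- Compute the parameters. -/
def calcParams (d : ℕ) : Cmd :=
  -- A round misses a given dense ball with probability at most `1 - A / (4m)`; this number of
  -- rounds makes the failure probability at most `exp (-(d + 3) J) ≤ n ^ (-(d + 3))`.
  calcJ ;; calcA ;; calcZ ;; .asg .T (4 * V.m * .lit (d + 3) * V.J / V.A + 1)

/-- The slots that are described by the input. -/
structure InputSlots (low : ℕ → ℕ) (m : ℕ) (S : Slots) : Prop where
  cnt : S.cnt = 2 * m
  src_odd : ∀ i < m, S.src (2 * i + 1) = low (2 * i + 3)
  src_even : ∀ i < m, S.src (2 * i + 2) = low (2 * i + 4)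
  tgt_odd : ∀ i < m, S.tgt (2 * i + 1) = low (2 * i + 4)
  tgt_even : ∀ i < m, S.tgt (2 * i + 2) = low (2 * i + 3)

theorem InputSlots.succ {low src tgt : ℕ → ℕ} {c : ℕ} (h : InputSlots low c ⟨2 * c, src, tgt⟩) :
    InputSlots low (c + 1) ⟨2 * (c + 1),
      Function.update (Function.update src (2 * c + 1) (low (2 * c + 3))) (2 * c + 2) (low (2 * c + 4)),
      Function.update (Function.update tgt (2 * c + 1) (low (2 * c + 4))) (2 * c + 2)
        (low (2 * c + 3))⟩ := by
  obtain ⟨-, h1, h2, h3, h4⟩ := h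
  refine ⟨rfl, ?_, ?_, ?_, ?_⟩
  all_goals
    intro i hi
    simp only at h1 h2 h3 h4 ⊢
    rcases Nat.lt_or_ge i c with hlt | hge
  · rw [Function.update_of_ne (by omega), Function.update_of_ne (by omega), h1 i hlt]
  · obtain rfl : i = c := by omega
    rw [Function.update_of_ne (by omega), Function.update_self]
  · rw [Function.update_of_ne (by omega), Function.update_of_ne (by omega), h2 i hlt]
  · obtain rfl : i = c := by omega
    rw [Function.update_self]
  · rw [Function.update_of_ne (by omega), Function.update_of_ne (by omega), h3 i hlt]
  · obtain rfl : i = c := by omega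
    rw [Function.update_of_ne (by omega), Function.update_self]
  · rw [Function.update_of_ne (by omega), Function.update_of_ne (by omega), h4 i hlt]
  · obtain rfl : i = c := by omega
    rw [Function.update_self]

/-- The machine is large enough. -/
structure Sizes (B : Bounds) (n m k d : ℕ) : Prop where
  two_le : 2 ≤ n
  n_le : n ≤ 2 * m
  m_lt : m < n * n
  two_le_k : 2 ≤ k
  k_lt : k < B.W
  N : B.N = 2 * m + 3
  cap : n ^ 10 ≤ B.cap
  cap_le : B.cap + B.N ≤ B.W
  d_lt : 4 * m * (d + 3) * n + n ^ 10 < B.W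

variable {B : Bounds} {n m k d : ℕ}

/-- This and the next three bounds relate the monomials in `n` and `m` linearly, so that `omega` can
settle the capacity conditions. -/
theorem Sizes.pow_ge (h : Sizes B n m k d) : 64 * (n * n * (n * n)) ≤ n ^ 10 := by
  have h1 : 2 ^ 6 ≤ n ^ 6 := Nat.pow_le_pow_left h.two_le 6
  calc 64 * (n * n * (n * n)) = 2 ^ 6 * (n * n * (n * n)) := by norm_num
    _ ≤ n ^ 6 * (n * n * (n * n)) := Nat.mul_le_mul_right _ h1
    _ = n ^ 10 := by ring

theorem Sizes.mm_lt (h : Sizes B n m k d) : m * m ≤ n * n * (n * n) :=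
  Nat.mul_le_mul h.m_lt.le h.m_lt.le

theorem Sizes.nn_le (h : Sizes B n m k d) : 4 * (n * n) ≤ n * n * (n * n) :=
  Nat.mul_le_mul_right _ (by nlinarith [h.two_le])

theorem Sizes.n_le' (h : Sizes B n m k d) : 2 * n ≤ n * n := Nat.mul_le_mul_right _ h.two_le

theorem readEdges_spec {σ : St} (hs : Sizes B n m k d) (hm : σ.v .m = m) :
    wp B readEdges (fun σ' => InputSlots (σ.a .low) m ⟨2 * m, σ'.a (.src false), σ'.a (.tgt false)⟩ ∧
      σ'.t ≤ σ.t + (m * 12 + 3)) σ := by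
  have h1 := hs.pow_ge
  have h2 := hs.mm_lt
  have h3 := hs.nn_le
  have h4 := hs.n_le'
  have h5 := hs.cap
  have h6 := hs.cap_le
  have h7 := hs.m_lt
  have h8 := hs.N
  have h9 := hs.n_le
  have h10 := hs.two_le
  refine wp_forTo (I := fun i a => InputSlots (σ.a .low) i ⟨2 * i, a (.src false), a (.tgt false)⟩)
    (b := m) (τ := 9) rfl (by omega) ?_ ?_ ?_ ?_
  · constructor
    · rfl
    all_goals exact fun i hi => absurd hi (Nat.not_lt_zero i)
  · intro σ' hv ha
    simp [hv .m (by decide) rfl, hm]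
  · intro i hi σ' hI hi' hv ha
    have e1 : σ'.a .low = σ.a .low := ha .low rfl
    simp [inRange_iff, Bounds.inRange, hi', e1, -Bounds.inRange]
    have r1 : ∀ q, B.inRange .low q ↔ q < B.N := fun q => by simp [Bounds.inRange]
    have r2 : ∀ g q, B.inRange (.src g) q ↔ q < B.cap := fun g q => by simp [Bounds.inRange]
    have r3 : ∀ g q, B.inRange (.tgt g) q ↔ q < B.cap := fun g q => by simp [Bounds.inRange]
    try simp only [r1, r2, r3]
    and_intros <;> try omega
    exact hI.succ
  · intro σ' hI hv ha ht
    exact ⟨hI, ht⟩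

theorem initEst_spec {σ : St} (hs : Sizes B n m k d) (hn : σ.v .n = n) :
    wp B initEst (fun σ' => (∀ v < n, σ'.a .est v = σ.v .inf) ∧ σ'.t ≤ σ.t + (n * 4 + 3)) σ := by
  have h1 := hs.pow_ge
  have h3 := hs.nn_le
  have h4 := hs.n_le'
  have h5 := hs.cap
  have h6 := hs.cap_le
  have h10 := hs.two_le
  refine wp_forTo (I := fun k a => ∀ v < k, a .est v = σ.v .inf) (b := n) (τ := 1) rfl (by omega)
    (fun v hv => absurd hv (Nat.not_lt_zero v)) ?_ ?_ ?_
  · intro σ' hv ha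
    simp [hv .n (by decide) rfl, hn]
  · intro k hk σ' hI hk' hv ha
    have e1 : σ'.v .inf = σ.v .inf := hv .inf (by decide) rfl
    simp [inRange_iff, hk', e1]
    refine ⟨by omega, fun v hv => ?_⟩
    rw [Function.update_apply]
    split_ifs with h
    · rfl
    · exact hI v (by omega)
  · intro σ' hI hv ha ht
    exact ⟨hI, ht⟩

/-- All arrays other than `low` start as zero, which makes the linked lists empty and all visit
stamps old. -/
theorem readInput_spec {σ : St} (hs : Sizes B n m k d) (hlow0 : σ.a .low 0 = n)
    (hlow1 : σ.a .low 1 = m) (hlow2 : σ.a .low 2 = k) (hv : ∀ x, σ.v x = 0)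
    (ha : ∀ j, j ≠ .low → ∀ i, σ.a j i = 0) (hgood : ∀ S, InputSlots (σ.a .low) m S → S.Good n) :
    wp B readInput (fun σ' => InputSlots (σ.a .low) m (σ'.slots false) ∧
      Chain (2 * m) (σ'.a (.src false)) (σ'.a (.hd false)) (σ'.a (.nx false)) ∧
      σ'.v .n = n ∧ σ'.v .m = m ∧ σ'.v .k = k ∧ σ'.v .inf = 4 * n + 1 ∧ σ'.v .st = 0 ∧
      (∀ y, σ'.a .vis y = 0) ∧ (∀ u, σ'.a (.hd true) u = 0) ∧
      (∀ v < n, σ'.a .est v = 4 * n + 1) ∧ σ'.t ≤ σ.t + (m * 40 + 40)) σ := by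
  have h1 := hs.pow_ge
  have h2 := hs.mm_lt
  have h3 := hs.nn_le
  have h4 := hs.n_le'
  have h5 := hs.cap
  have h6 := hs.cap_le
  have h7 := hs.m_lt
  have h8 := hs.N
  have h9 := hs.n_le
  have h10 := hs.two_le
  have r1 : ∀ q, B.inRange .low q ↔ q < B.N := fun q => by simp [Bounds.inRange]
  have hBW : 3 < B.W := by omega
  rw [readInput, wp_seq, wp_asg]
  refine ⟨by simp [r1]; omega, ?_⟩
  rw [wp_seq, wp_asg]
  refine ⟨by simp [r1]; omega, ?_⟩
  rw [wp_seq, wp_asg]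
  refine ⟨by simp [r1]; omega, ?_⟩
  rw [wp_seq, wp_asg]
  refine ⟨by simp [hlow1]; omega, ?_⟩
  rw [wp_seq]
  refine (readEdges_spec hs (by simp [hlow1])).mono ?_
  rintro σ₁ hF₁ ⟨hI, ht₁⟩
  simp at hI ht₁
  have hS := hgood _ hI
  have a1 : σ₁.v .n = n := by simpa [hlow0] using hF₁.v .n rfl
  have a2 : σ₁.v .m = m := by simpa [hlow1] using hF₁.v .m rfl
  have a3 : σ₁.v .k = k := by simpa [hlow2] using hF₁.v .k rfl
  have a4 : σ₁.v (.cnt false) = 2 * m := by simpa [hlow1] using hF₁.v (.cnt false) rfl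
  have a5 : ∀ u, σ₁.a (.hd false) u = 0 := fun u => by
    rw [hF₁.a (.hd false) rfl]; exact ha _ (by decide) u
  have a6 : ∀ u, σ₁.a (.hd true) u = 0 := fun u => by
    rw [hF₁.a (.hd true) rfl]; exact ha _ (by decide) u
  have a7 : ∀ u, σ₁.a .vis u = 0 := fun u => by
    rw [hF₁.a .vis rfl]; exact ha _ (by decide) u
  have a8 : σ₁.v .st = 0 := by simpa [hv] using hF₁.v .st rfl
  have hsl : σ₁.slots false = ⟨2 * m, σ₁.a (.src false), σ₁.a (.tgt false)⟩ := by
    simp [St.slots, a4]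
  rw [wp_seq]
  refine (build_spec (by omega) false σ₁.tick (by simp [a4]; omega) (fun q hq => ?_) a5).mono ?_
  · have := hS.src_lt q (by
      change (σ₁.slots false).Mem q at hq
      rwa [hsl] at hq)
    exact lt_of_lt_of_le this (by omega)
  rintro σ₂ hF₂ ⟨hC, ht₂⟩
  simp [a4] at hC ht₂
  have b1 : σ₂.v .n = n := (hF₂.v .n rfl).trans a1
  have b2 : σ₂.v .m = m := (hF₂.v .m rfl).trans a2
  have b3 : σ₂.v .k = k := (hF₂.v .k rfl).trans a3
  rw [wp_seq, wp_asg]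
  refine ⟨by simp [b1]; omega, ?_⟩
  refine (initEst_spec hs (by simpa using b1)).mono ?_
  rintro σ₃ hF₃ ⟨hE, ht₃⟩
  simp [b1] at hE ht₃
  have c1 : σ₃.v .n = n := by simpa [b1] using hF₃.v .n rfl
  have c2 : σ₃.v .m = m := by simpa [b2] using hF₃.v .m rfl
  have c3 : σ₃.v .k = k := by simpa [b3] using hF₃.v .k rfl
  have c4 : σ₃.v .inf = 4 * n + 1 := by simpa [b1] using hF₃.v .inf rfl
  have c5 : σ₃.v (.cnt false) = 2 * m := by
    simpa [hF₂.v (.cnt false) rfl, a4] using hF₃.v (.cnt false) rfl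
  have c6 : σ₃.a (.src false) = σ₁.a (.src false) := by
    simpa [hF₂.a (.src false) rfl] using hF₃.a (.src false) rfl
  have c7 : σ₃.a (.tgt false) = σ₁.a (.tgt false) := by
    simpa [hF₂.a (.tgt false) rfl] using hF₃.a (.tgt false) rfl
  have c8 : σ₃.a (.hd false) = σ₂.a (.hd false) := by simpa using hF₃.a (.hd false) rfl
  have c9 : σ₃.a (.nx false) = σ₂.a (.nx false) := by simpa using hF₃.a (.nx false) rfl
  have c10 : σ₃.a (.hd true) = σ₁.a (.hd true) := by
    simpa [hF₂.a (.hd true) rfl] using hF₃.a (.hd true) rfl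
  have c11 : σ₃.a .vis = σ₁.a .vis := by simpa [hF₂.a .vis rfl] using hF₃.a .vis rfl
  have c12 : σ₃.v .st = 0 := by simpa [hF₂.v .st rfl, a8] using hF₃.v .st rfl
  refine ⟨?_, by rw [c6, c8, c9]; exact hC, c1, c2, c3, c4, c12, by rw [c11]; exact a7,
    by rw [c10]; exact a6, hE, by omega⟩
  rw [St.slots, c5, c6, c7]
  exact hI

theorem calcParams_spec {σ : St} (hs : Sizes B n m k d) (hn : σ.v .n = n) (hm : σ.v .m = m)
    (hk : σ.v .k = k) :
    wp B (calcParams d) (fun σ' => ∃ h, n ≤ 2 ^ σ'.v .J ∧ 2 ^ (σ'.v .J - 1) < n ∧ 1 ≤ σ'.v .J ∧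
      Params n m k (σ'.v .A) h ∧ σ'.v .Z = levels (σ'.v .A) h ∧
      σ'.v .T = 4 * m * (d + 3) * σ'.v .J / σ'.v .A + 1 ∧
      σ'.t ≤ σ.t + σ'.v .J * m * 200) σ := by
  have h1 := hs.pow_ge
  have h2 := hs.mm_lt
  have h3 := hs.nn_le
  have h4 := hs.n_le'
  have h5 := hs.cap
  have h6 := hs.cap_le
  have h7 := hs.m_lt
  have h8 := hs.N
  have h9 := hs.n_le
  have h10 := hs.two_le
  rw [calcParams, wp_seq]
  refine (calcJ_spec (n := n) (by simpa using hn) (by omega)).mono ?_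
  rintro σ₄ hF₄ ⟨hJ1, hJ2, ht₄⟩
  simp only [St.tick_t] at ht₄
  obtain ⟨J, hJ⟩ : ∃ J, σ₄.v .J = J := ⟨_, rfl⟩
  rw [hJ] at hJ1 hJ2 ht₄
  have hJpos : 1 ≤ J := by
    by_contra hcon
    obtain rfl : J = 0 := by omega
    simp at hJ1; omega
  have hJn : J ≤ n := by
    rcases hJ2 with h0 | h0
    · omega
    · have : J - 1 < 2 ^ (J - 1) := Nat.lt_two_pow_self
      omega
  -- From `m < n²` and `n ≤ 2 ^ J`: this bounds the number of rounds of `power` and the parameter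
  -- `h` by `4 J`.
  have hJ4 : m * m < 2 ^ (4 * J) := by
    calc m * m < (n * n) * (n * n) := Nat.mul_lt_mul'' h7 h7
      _ ≤ (2 ^ J * 2 ^ J) * (2 ^ J * 2 ^ J) := by gcongr
      _ = 2 ^ (4 * J) := by rw [← pow_add, ← pow_add]; congr 1; ring
  have d1 : σ₄.v .n = n := (hF₄.v .n rfl).trans hn
  have d2 : σ₄.v .m = m := (hF₄.v .m rfl).trans hm
  have d3 : σ₄.v .k = k := (hF₄.v .k rfl).trans hk
  have hmm1 : m * m * (m + 1) ≤ n ^ 6 := by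
    calc m * m * (m + 1) ≤ n * n * (n * n) * (n * n) := Nat.mul_le_mul h2 h7
      _ = n ^ 6 := by ring
  have hn6 : 16 * n ^ 6 ≤ n ^ 10 := by
    calc 16 * n ^ 6 = 2 ^ 4 * n ^ 6 := by norm_num
      _ ≤ n ^ 4 * n ^ 6 := Nat.mul_le_mul_right _ (Nat.pow_le_pow_left h10 4)
      _ = n ^ 10 := by ring
  rw [wp_seq]
  refine (calcA_spec (n := n) (m := m) (k := k) (e := 4 * J) (by simpa using d1) (by simpa using d2)
    (by simpa using d3) (by omega) (by omega) hs.two_le_k hJ4 hs.k_lt (by omega)).mono ?_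
  rintro σ₅ hF₅ ⟨hP, ht₅⟩
  simp only [St.tick_t] at ht₅
  have hh := hP.h_le (by omega) hJ4 (by omega)
  have hL := hP.levels_le hs.two_le_k (by omega) (by omega)
  have hA2 := hP.two_le (by omega)
  have hAL : (σ₅.v .A + 1) * (levels (σ₅.v .A) (σ₅.v .h) + 1) ≤
      n * ((σ₅.v .A + 1) * (levels (σ₅.v .A) (σ₅.v .h) + 1)) := Nat.le_mul_of_pos_left _ (by omega)
  have hnm : n * m ≤ n * (n * n) := Nat.mul_le_mul_left _ h7.le
  have hn3 : 2 * (n * (n * n)) ≤ n * n * (n * n) := by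
    rw [mul_assoc n n]; exact Nat.mul_le_mul_right _ h10
  have hAL' : (σ₅.v .A + 1) * (levels (σ₅.v .A) (σ₅.v .h) + 1) =
      σ₅.v .A * levels (σ₅.v .A) (σ₅.v .h) + σ₅.v .A + levels (σ₅.v .A) (σ₅.v .h) + 1 := by ring
  have hnm8 : n * (8 * m + 8) = 8 * (n * m) + 8 * n := by ring
  rw [wp_seq]
  refine (calcZ_spec (σ := σ₅.tick) (A := σ₅.v .A) (h := σ₅.v .h) rfl rfl (by omega) (by omega)).mono ?_
  rintro σ₆ hF₆ ⟨hZ, ht₆⟩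
  simp only [St.tick_t] at ht₆
  have f1 : σ₆.v .m = m := (hF₆.v .m rfl).trans ((hF₅.v .m rfl).trans d2)
  have f2 : σ₆.v .J = J := (hF₆.v .J rfl).trans ((hF₅.v .J rfl).trans hJ)
  have f3 : σ₆.v .A = σ₅.v .A := hF₆.v .A rfl
  have hdJ : 4 * m * (d + 3) * J ≤ 4 * m * (d + 3) * n := Nat.mul_le_mul_left _ hJn
  have hd1 : 4 * m * (d + 3) ≤ 4 * m * (d + 3) * n := Nat.le_mul_of_pos_right _ (by omega)
  have hd2 : 4 * m ≤ 4 * m * (d + 3) := Nat.le_mul_of_pos_right _ (by omega)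
  have hd3 : d + 3 ≤ 4 * m * (d + 3) := Nat.le_mul_of_pos_left _ (by omega)
  have hdW := hs.d_lt
  have hdiv : 4 * m * (d + 3) * J / σ₅.v .A ≤ 4 * m * (d + 3) * J := Nat.div_le_self _ _
  rw [wp_asg]
  refine ⟨?_, σ₅.v .h, ?_⟩
  · simp [f1, f2, f3]
    and_intros <;> omega
  · simp [f1, f2, f3]
    refine ⟨hJ1, by omega, hJpos, hP, hZ, ?_⟩
    have : 1 * m ≤ J * m := Nat.mul_le_mul_right _ hJpos
    have : J * 1 ≤ J * m := Nat.mul_le_mul_left _ (by omega)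
    have : m * (4 * J * 6 + 20) = 24 * (J * m) + 20 * m := by ring
    omega

end WordRAM.HL

namespace ANSC

/-! ### Sampling -/

/-- The number of words that select a slot in a given set. -/
theorem card_mul_le_card_filter {c w : ℕ} (U : Finset ℕ)
    (hU : ∀ q ∈ U, 1 ≤ q ∧ q ≤ c) :
    U.card * (2 ^ w / c) ≤
      (Finset.univ.filter fun x : Fin (2 ^ w) => (x : ℕ) % c + 1 ∈ U).card := by
  have hval : ∀ q ∈ U, ∀ j < 2 ^ w / c, j * c + (q - 1) < 2 ^ w := by
    intro q hq j hj
    obtain ⟨h1, h2⟩ := hU q hq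
    have h3 : (j + 1) * c ≤ 2 ^ w := (Nat.mul_le_mul_right c hj).trans (Nat.div_mul_le_self _ _)
    rw [Nat.succ_mul] at h3
    omega
  rw [← Finset.card_range (2 ^ w / c), ← Finset.card_product]
  -- Slot `q` is selected by the words `j * c + (q - 1)`, one for each full block `j` of `c` words.
  refine Finset.card_le_card_of_injOn (fun p => Fin.ofNat (2 ^ w) (p.2 * c + (p.1 - 1))) ?_ ?_
  · rintro ⟨q, j⟩ hp
    simp only [Finset.coe_product, Set.mem_prod, Finset.mem_coe, Finset.mem_range] at hp
    simp only [Finset.coe_filter, Finset.mem_univ, true_and, Set.mem_ofPred_eq, Fin.val_ofNat]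
    obtain ⟨h1, h2⟩ := hU q hp.1
    rw [Nat.mod_eq_of_lt (hval q hp.1 j hp.2), Nat.mul_add_mod_self_right,
      Nat.mod_eq_of_lt (by omega), Nat.sub_add_cancel h1]
    exact hp.1
  · rintro ⟨q, j⟩ hp ⟨q', j'⟩ hp' he
    simp only [Finset.coe_product, Set.mem_prod, Finset.mem_coe, Finset.mem_range] at hp hp'
    have h1 := hU q hp.1
    have h2 := hU q' hp'.1
    have := congrArg Fin.val he
    simp only [Fin.val_ofNat] at this
    rw [Nat.mod_eq_of_lt (hval q hp.1 j hp.2), Nat.mod_eq_of_lt (hval q' hp'.1 j' hp'.2)] at this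
    obtain ⟨rfl, h3⟩ := mul_add_inj (by omega) (by omega) this
    have : q = q' := by omega
    rw [this]

/-- Reduction of a word modulo `c` is not quite uniform, but each residue has at least `⌊2 ^ w / c⌋
≥ 2 ^ w / (2 c)` words, which costs a factor of 2. -/
theorem prob_not_hit_le {c w A : ℕ} (hc : 0 < c) (hcw : c ≤ 2 ^ w) (U : Finset ℕ)
    (hU : ∀ q ∈ U, 1 ≤ q ∧ q ≤ c) (hA : A ≤ U.card) (hit : Fin (2 ^ w) → Prop) [DecidablePred hit]
    (hhit : ∀ x : Fin (2 ^ w), (x : ℕ) % c + 1 ∈ U → hit x) :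
    ((2 : ℝ≥0∞) ^ w)⁻¹ * (Finset.univ.filter fun x => ¬ hit x).card ≤
      ENNReal.ofReal (1 - (A : ℝ) / (2 * c)) := by
  have h1 := card_mul_le_card_filter (w := w) U hU
  have h2 : (Finset.univ.filter fun x : Fin (2 ^ w) => (x : ℕ) % c + 1 ∈ U).card ≤
      (Finset.univ.filter hit).card :=
    Finset.card_le_card fun x hx => by
      simp only [Finset.mem_filter, Finset.mem_univ, true_and] at hx ⊢
      exact hhit x hx
  have h3 := Finset.card_filter_add_card_filter_not (s := (Finset.univ : Finset (Fin (2 ^ w)))) hit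
  rw [Finset.card_univ, Fintype.card_fin] at h3
  have h4 : A * (2 ^ w / c) ≤ U.card * (2 ^ w / c) := Nat.mul_le_mul_right _ hA
  have h5 : 2 ^ w ≤ 2 * c * (2 ^ w / c) := by
    have h6 := Nat.div_add_mod (2 ^ w) c
    have h7 := Nat.mod_lt (2 ^ w) hc
    have h8 : 1 ≤ 2 ^ w / c := (Nat.one_le_div_iff hc).2 hcw
    have h9 : c * 1 ≤ c * (2 ^ w / c) := Nat.mul_le_mul_left c h8
    have h10 : 2 * c * (2 ^ w / c) = 2 * (c * (2 ^ w / c)) := by ring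
    omega
  have key : ((Finset.univ.filter fun x => ¬ hit x).card : ℝ) ≤ 2 ^ w * (1 - (A : ℝ) / (2 * c)) := by
    have hc' : (0 : ℝ) < 2 * c := by positivity
    have h3' : ((Finset.univ.filter hit).card : ℝ) + (Finset.univ.filter fun x => ¬ hit x).card =
      2 ^ w := by exact_mod_cast h3
    have h5' : (2 : ℝ) ^ w ≤ 2 * c * ((2 ^ w / c : ℕ) : ℝ) := by exact_mod_cast h5
    have h6' : (A : ℝ) * ((2 ^ w / c : ℕ) : ℝ) ≤ (Finset.univ.filter hit).card := by
      exact_mod_cast h4.trans (h1.trans h2)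
    have h7 : (A : ℝ) / (2 * c) * 2 ^ w ≤ A * ((2 ^ w / c : ℕ) : ℝ) := by
      rw [div_mul_eq_mul_div, div_le_iff₀ hc']
      nlinarith [Nat.cast_nonneg (α := ℝ) A]
    linarith
  have hpos : (0 : ℝ) < 2 ^ w := by positivity
  have e1 : ((2 : ℝ≥0∞) ^ w)⁻¹ = ENNReal.ofReal ((2 : ℝ) ^ w)⁻¹ := by
    rw [ENNReal.ofReal_inv_of_pos hpos, ENNReal.ofReal_pow (by norm_num)]; simp
  rw [e1, ← ENNReal.ofReal_natCast, ← ENNReal.ofReal_mul (by positivity)]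
  refine ENNReal.ofReal_le_ofReal ?_
  rw [inv_mul_le_iff₀ hpos]
  exact key

/-- By the choice of `T` one has `T A ≥ 4 m (d + 3) J`, so a single target is missed with
probability at most `exp (-(d + 3) J) ≤ 2 ^ (-(d + 3) J) ≤ n ^ (-(d + 3))`. There are at most `n²`
targets, one for each pair of a vertex and a radius. -/
theorem union_bound {n m d J A N : ℕ} (hn : 1 ≤ n) (hm : 1 ≤ m) (hA : 1 ≤ A) (hA4 : A ≤ 4 * m)
    (hJ : n ≤ 2 ^ J) (hN : N ≤ n * n) :
    (N : ℝ≥0∞) * ENNReal.ofReal (1 - (A : ℝ) / (4 * m)) ^ (4 * m * (d + 3) * J / A + 1) ≤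
      ((n : ℝ≥0∞) ^ d)⁻¹ := by
  set T := 4 * m * (d + 3) * J / A + 1 with hT
  have hn' : (0 : ℝ) < n := by exact_mod_cast hn
  have hm' : (0 : ℝ) < m := by exact_mod_cast hm
  have hA' : (0 : ℝ) < A := by exact_mod_cast hA
  have hA4' : (A : ℝ) ≤ 4 * m := by exact_mod_cast hA4
  have hq : (0 : ℝ) ≤ 1 - (A : ℝ) / (4 * m) := by
    rw [sub_nonneg, div_le_one (by positivity)]; exact hA4'
  have hTA : (4 * m * (d + 3) * J : ℝ) ≤ T * A := by
    have : 4 * m * (d + 3) * J < (4 * m * (d + 3) * J / A + 1) * A := by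
      rw [← Nat.div_lt_iff_lt_mul hA]; exact Nat.lt_succ_self _
    exact_mod_cast this.le
  have h1 : (1 - (A : ℝ) / (4 * m)) ^ T ≤ (2⁻¹) ^ ((d + 3) * J) := by
    calc (1 - (A : ℝ) / (4 * m)) ^ T ≤ Real.exp (-((A : ℝ) / (4 * m))) ^ T :=
          pow_le_pow_left₀ hq (Real.one_sub_le_exp_neg _) T
      _ = Real.exp (T * (-((A : ℝ) / (4 * m)))) := (Real.exp_nat_mul _ _).symm
      _ ≤ Real.exp (((d + 3) * J : ℕ) * (-1)) := by
          refine Real.exp_le_exp.2 ?_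
          rw [mul_neg, mul_neg, mul_one, neg_le_neg_iff, ← mul_div_assoc, le_div_iff₀ (by positivity)]
          push_cast
          linarith
      _ = Real.exp (-1) ^ ((d + 3) * J) := Real.exp_nat_mul _ _
      _ ≤ (2⁻¹) ^ ((d + 3) * J) := by
          refine pow_le_pow_left₀ (Real.exp_pos _).le ?_ _
          rw [Real.exp_neg]
          exact inv_anti₀ (by norm_num) (by linarith [Real.add_one_le_exp (1 : ℝ)])
  have h2 : ((2 : ℝ)⁻¹) ^ ((d + 3) * J) ≤ ((n : ℝ) ^ (d + 3))⁻¹ := by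
    rw [inv_pow]
    refine inv_anti₀ (by positivity) ?_
    rw [mul_comm, pow_mul]
    exact pow_le_pow_left₀ hn'.le (by exact_mod_cast hJ) _
  have h3 : (N : ℝ) * (1 - (A : ℝ) / (4 * m)) ^ T ≤ ((n : ℝ) ^ d)⁻¹ := by
    have hN' : (N : ℝ) ≤ n * n := by exact_mod_cast hN
    calc (N : ℝ) * (1 - (A : ℝ) / (4 * m)) ^ T ≤ (n * n) * ((n : ℝ) ^ (d + 3))⁻¹ :=
          mul_le_mul hN' (h1.trans h2) (pow_nonneg hq _) (by positivity)
      _ = ((n : ℝ) ^ d)⁻¹ * (n : ℝ)⁻¹ := by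
          rw [pow_add]; field_simp
      _ ≤ ((n : ℝ) ^ d)⁻¹ * 1 := by
          refine mul_le_mul_of_nonneg_left ?_ (by positivity)
          exact inv_le_one_of_one_le₀ (by exact_mod_cast hn)
      _ = ((n : ℝ) ^ d)⁻¹ := mul_one _
  rw [← ENNReal.ofReal_natCast, ← ENNReal.ofReal_pow hq, ← ENNReal.ofReal_mul (by positivity)]
  refine (ENNReal.ofReal_le_ofReal h3).trans (le_of_eq ?_)
  rw [ENNReal.ofReal_inv_of_pos (by positivity), ENNReal.ofReal_pow hn'.le, ENNReal.ofReal_natCast]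

end ANSC

/-! ### The deterministic preparation -/

namespace WordRAM.HL

open ANSC

/-- Everything that precedes the random searches. -/
def prepare (d : ℕ) : Cmd := readInput ;; calcParams d ;; localLoop

variable {B : Bounds} {n m k d : ℕ}

theorem prepare_spec {σ : St} (hs : Sizes B n m k d) (hlow0 : σ.a .low 0 = n)
    (hlow1 : σ.a .low 1 = m) (hlow2 : σ.a .low 2 = k) (hv : ∀ x, σ.v x = 0)
    (ha : ∀ j, j ≠ .low → ∀ i, σ.a j i = 0) (hgood : ∀ S, InputSlots (σ.a .low) m S → S.Good n) :
    wp B (prepare d) (fun σ' => ∃ S J A h, InputSlots (σ.a .low) m S ∧ S.Good n ∧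
      n ≤ 2 ^ J ∧ 2 ^ (J - 1) < n ∧ 1 ≤ J ∧ Params n m k A h ∧ Ready B S n J (4 * n + 1) σ' ∧
      EstSound S.graph n (4 * n + 1) (σ'.a .est) ∧ (∀ v < n, LocalDone S A h v (σ'.a .est)) ∧
      σ'.v .T = 4 * m * (d + 3) * J / A + 1 ∧ σ'.v .st + σ'.v .T + 1 < B.W ∧
      σ'.t ≤ σ.t + (J + 1) * (m * 300 + n * ((A + 1) * (levels A h + 1)) * 2100)) σ := by
  have h1 := hs.pow_ge
  have h2 := hs.mm_lt
  have h3 := hs.nn_le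
  have h4 := hs.n_le'
  have h5 := hs.cap
  have h6 := hs.cap_le
  have h7 := hs.m_lt
  have h8 := hs.N
  have h9 := hs.n_le
  have h10 := hs.two_le
  have hdW := hs.d_lt
  rw [prepare, wp_seq]
  refine (readInput_spec (σ := σ.tick) hs hlow0 hlow1 hlow2 hv ha hgood).mono ?_
  rintro σ₁ - ⟨hI, hC, e1, e2, e3, e4, e5, e6, e7, e8, ht₁⟩
  simp only [St.tick_a, St.tick_t] at hI ht₁
  obtain ⟨S, hS⟩ : ∃ S, σ₁.slots false = S := ⟨_, rfl⟩
  rw [hS] at hI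
  have hG := hgood S hI
  rw [wp_seq]
  refine (calcParams_spec (σ := σ₁.tick) hs e1 e2 e3).mono ?_
  rintro σ₂ hF₂ ⟨h, hJ1, hJ2, hJ3, hP, hZ, hT, ht₂⟩
  obtain ⟨J, hJ⟩ : ∃ J, σ₂.v .J = J := ⟨_, rfl⟩
  obtain ⟨A, hA⟩ : ∃ A, σ₂.v .A = A := ⟨_, rfl⟩
  simp only [hJ, hA, St.tick_t] at hJ1 hJ2 hJ3 hP hZ hT ht₂
  have hJn : J ≤ n := by
    have : J - 1 < 2 ^ (J - 1) := Nat.lt_two_pow_self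
    omega
  have hL := hP.levels_le hs.two_le_k (by omega) (by omega)
  have hAL : (A + 1) * (levels A h + 1) ≤ n * ((A + 1) * (levels A h + 1)) :=
    Nat.le_mul_of_pos_left _ (by omega)
  have hLL : n * (levels A h + 1) ≤ n * ((A + 1) * (levels A h + 1)) :=
    Nat.mul_le_mul_left _ (Nat.le_mul_of_pos_left _ (by omega))
  have hnm : n * m ≤ n * (n * n) := Nat.mul_le_mul_left _ h7.le
  have hn3 : 2 * (n * (n * n)) ≤ n * n * (n * n) := by
    rw [mul_assoc n n]; exact Nat.mul_le_mul_right _ h10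
  have hnm8 : n * (8 * m + 8) = 8 * (n * m) + 8 * n := by ring
  have hJJ : (J + 3) * n ≤ (n + 3) * n := Nat.mul_le_mul_right _ (by omega)
  have hnn3 : (n + 3) * n = n * n + 3 * n := by ring
  have hdJ : 4 * m * (d + 3) * J ≤ 4 * m * (d + 3) * n := Nat.mul_le_mul_left _ hJn
  have hdiv : 4 * m * (d + 3) * J / A ≤ 4 * m * (d + 3) * J := Nat.div_le_self _ _
  have hsl : σ₂.slots false = S := by
    rw [← hS]
    simp only [St.slots]
    rw [hF₂.v (.cnt false) rfl, hF₂.a (.src false) rfl, hF₂.a (.tgt false) rfl]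
    rfl
  have a1 : σ₂.a .est = σ₁.a .est := hF₂.a .est rfl
  have a2 : σ₂.a .vis = σ₁.a .vis := hF₂.a .vis rfl
  have a3 : σ₂.a (.hd true) = σ₁.a (.hd true) := hF₂.a (.hd true) rfl
  have a4 : σ₂.a (.hd false) = σ₁.a (.hd false) := hF₂.a (.hd false) rfl
  have a5 : σ₂.a (.nx false) = σ₁.a (.nx false) := hF₂.a (.nx false) rfl
  have a6 : σ₂.v .st = 0 := (hF₂.v .st rfl).trans e5
  have hsrc : S.src = σ₁.a (.src false) := by rw [← hS]; rfl
  have hcnt := hI.cnt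
  have hR : Ready B S n J (4 * n + 1) σ₂ :=
    { cap_le := by omega
      good := hG
      n_le := hJ1
      cap := by omega
      inf_lt := by omega
      cnt_lt := by omega
      slots := hsl
      chain := by rw [hcnt, hsrc, a4, a5]; exact hC
      vis := fun y => by rw [a2, e6]; exact Nat.zero_le _
      n_eq := (hF₂.v .n rfl).trans e1
      J_eq := hJ
      inf_eq := (hF₂.v .inf rfl).trans e4 }
  refine (localLoop_spec (σ := σ₂) (A := A) (h := h) hR hA hZ (by omega) (by omega)
    (fun u => by rw [a3]; exact e7 u) (fun y hy hlt => by
      rw [a1, e8 y hy] at hlt; exact absurd hlt (lt_irrefl _))).mono ?_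
  rintro σ₃ hF₃ ⟨hR₃, hE₃, hD₃, hst₃, ht₃⟩
  have hT₃ : σ₃.v .T = 4 * m * (d + 3) * J / A + 1 := (hF₃.v .T rfl).trans hT
  refine ⟨S, J, A, h, hI, hG, hJ1, hJ2, hJ3, hP, hR₃, hE₃, hD₃, hT₃, by omega, ?_⟩
  have ht : n * ((A + 1) * (levels A h + 1) * (J + 1) * 2100) =
    (J + 1) * (n * ((A + 1) * (levels A h + 1)) * 2100) := by ring
  have h300 : (J + 1) * (m * 300) = 300 * (J * m) + 300 * m := by ring
  have hJm : 1 * m ≤ J * m := Nat.mul_le_mul_right _ hJ3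
  have hJm' : J * m * 200 = 200 * (J * m) := by ring
  rw [mul_add, ← ht, h300]
  omega

end WordRAM.HL

/-! ### The random searches and the whole program -/

namespace WordRAM.HL

open ANSC

/-- The estimates are good for all cycles through vertices in dense regions. -/
def Covered (S : Slots) (A n : ℕ) (est : ℕ → ℕ) : Prop :=
  ∀ x < n, ∀ r < n, Dense S A x r → ∀ (v : ℕ) (p : S.graph.Walk v v), p.IsCycle → x ∈ p.support →
    est v ≤ p.length + 2 * r

/-- The rounds of random searches. -/
noncomputable def randomRounds : Program :=
  .loop (rv .T) (.seq (.rand (rv .r)) globalRound.compile)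

variable {B : Bounds} {n m k d w : ℕ}

-- Apply `one_le_haltProb_random_loop` to the pairs `(x, r)` with `x, r < n`. The machine invariant
-- is that some `σ` represents the state and its estimates serve all dense pairs outside `U`;
-- estimates only decrease, so what was achieved persists.
open Classical in
theorem one_le_haltProb_randomRounds {good : State w → Prop} (hB : B.Fits w) {S : Slots} {J A h i t₀ : ℕ}
    {K : List Program} {s : State w} {σ : St} (hs : Rep B s σ) (hm : 1 ≤ m) (hcnt : S.cnt = 2 * m)
    (hR : Ready B S n J (4 * n + 1) σ) (hest : EstSound S.graph n (4 * n + 1) (σ.a .est))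
    (hloc : ∀ v < n, LocalDone S A h v (σ.a .est)) (hT : σ.v .T = i) (hst : σ.v .st + i + 1 < B.W)
    (hend : ∀ (s : State w) (σ : St), Rep B s σ → Ready B S n J (4 * n + 1) σ →
      EstSound S.graph n (4 * n + 1) (σ.a .est) → (∀ v < n, LocalDone S A h v (σ.a .est)) →
      Covered S A n (σ.a .est) → 1 ≤ haltProb good t₀ (K, s)) :
    1 ≤ haltProb good (i * (globalRound.slow * ((2 * m + 1) * (J + 1) * 400 + 10) + 3) + (1 + t₀))
        (randomRounds :: K, s) +
      ((n * n : ℕ) : ℝ≥0∞) * ENNReal.ofReal (1 - (A : ℝ) / (4 * m)) ^ i := by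
  -- Pairs that are not dense count as hit by every word, so all pairs can be treated alike.
  let hit : ℕ × ℕ → Fin (2 ^ w) → Prop := fun u x =>
    Dense S A u.1 u.2 → Near S.graph (S.src ((x : ℕ) % S.cnt + 1)) u.1 u.2
  have hcl := hR.cnt_lt
  have hcw := hR.cap_le
  have hmain := one_le_haltProb_random_loop (good := good) hit
    (ENNReal.ofReal (1 - (A : ℝ) / (4 * m))) (rv .T) (rv .r)
    (globalRound.slow * ((2 * m + 1) * (J + 1) * 400 + 10)) t₀ globalRound.compile K
    (fun i U s => ∃ σ, Rep B s σ ∧ Ready B S n J (4 * n + 1) σ ∧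
      EstSound S.graph n (4 * n + 1) (σ.a .est) ∧ (∀ v < n, LocalDone S A h v (σ.a .est)) ∧
      σ.v .T = i ∧ σ.v .st + i + 1 < B.W ∧
      ∀ x < n, ∀ r < n, Dense S A x r → (x, r) ∉ U → ∀ (v : ℕ) (p : S.graph.Walk v v),
        p.IsCycle → x ∈ p.support → σ.a .est v ≤ p.length + 2 * r) ?_ ?_ ?_ ?_ i
    (Finset.range n ×ˢ Finset.range n) s ?_
  · simpa [randomRounds] using hmain
  · rintro i U s ⟨σ, h1, -, -, -, h5, -⟩
    rw [h1.v .T, Ne, ofNat_eq_zero hB (h1.v_lt .T), h5]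
  · rintro i U s ⟨σ, h1, h2, h3, h4, h5, h6, h7⟩ x
    have hx : (x : ℕ) < B.W := by rw [hB.W]; exact x.isLt
    have hrep := h1.setV .r hx
    have hbv : BitVec.ofNat w (x : ℕ) = BitVec.ofFin x := by
      apply BitVec.eq_of_toNat_eq
      simp [Nat.mod_eq_of_lt x.isLt]
    rw [hbv] at hrep
    have hR' : Ready B S n J (4 * n + 1) (σ.setV .r x) :=
      h2.frame (c := .asg .r 0) ⟨fun y hy => by
        have : y ≠ .r := by simpa [Cmd.wv] using hy
        simp [this], fun _ _ => rfl⟩ ⟨rfl, rfl, rfl, rfl, rfl, rfl, rfl, rfl⟩ (by simpa using h2.vis)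
    obtain ⟨σ', hr, g1, g2, g3, g4, g5, g6, g7⟩ := globalRound_spec (i := i) hR' (by omega)
      (by simpa using hx) (by simpa using h5) (by simp; omega) h3
    obtain ⟨s', t, hd, hrep', ht⟩ := hr.compile_spec hB hrep
    refine ⟨s', t, ?_, hd, σ', hrep', g1, g3, fun v hv => (h4 v hv).mono g2, g5, ?_, ?_⟩
    · have := ht _ le_rfl
      rw [hcnt] at g7
      have h8 := Nat.mul_le_mul_left globalRound.slow g7
      rw [mul_add] at h8
      omega
    · simp at g6; omega
    · intro y hy r hr hD hU v p hp hyp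
      rw [Finset.mem_filter, not_and_not_right] at hU
      by_cases hU' : (y, r) ∈ U
      · have := hU hU' hD
        exact g4 v y r p hp hyp (by simpa using this)
      · exact (g2 v).trans (h7 y hy r hr hD hU' v p hp hyp)
  · rintro s ⟨σ, h1, h2, h3, h4, h5, h6, h7⟩
    exact hend s σ h1 h2 h3 h4 fun x hx r hr hD => h7 x hx r hr hD (Finset.notMem_empty _)
  · rintro ⟨y, r⟩
    by_cases hD : Dense S A y r
    · obtain ⟨U, hU, hmem⟩ := hD
      have := prob_not_hit_le (c := 2 * m) (w := w) (A := A) (by omega)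
        (by rw [← hB.W]; omega) U
        (fun q hq => by
          have h1 := (hmem q hq).1.1
          have h2 := (hmem q hq).1.2
          omega) hU (hit (y, r)) (fun x hx _ => by
          rw [hcnt]
          obtain ⟨p, hp⟩ := (hmem _ hx).2
          exact ⟨p.reverse, by simpa using hp⟩)
      refine this.trans (le_of_eq ?_)
      push_cast
      ring_nf
    · have : (Finset.univ.filter fun x => ¬ hit (y, r) x) = ∅ := by
        rw [Finset.filter_eq_empty_iff]
        intro x _ hx
        exact hx fun h => absurd h hD
      rw [this]
      simp
  · refine ⟨σ, hs, hR, hest, hloc, hT, hst, fun x hx r hr _ hU => ?_⟩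
    exact absurd (by simp [hx, hr]) hU

/-- Computes the distance of the arrays from the beginning of the memory. -/
def prologue : Program :=
  .seq (.const 2 1) (.seq (.load 0 2) (.seq (.op .add 0 0 0) (.seq (.const 2 3) (.op .add 0 0 2))))

/-- The state that is represented by the initial state of the machine. -/
def inputState (input : List ℕ) : St where
  v := fun _ => 0
  a := fun j i => if j = .low then input.getD i 0 else 0
  t := 0

/-- The offset `N = 2m + 3` of the arrays is computed from the input cell 1. Memory behind the input
is zero, so all arrays start as zero. -/
theorem prologue_spec (hB : B.Fits w) {input : List ℕ} (hlen : input.length = B.N)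
    (hlt : ∀ i, input.getD i 0 < B.W) (hm : B.N = 2 * input.getD 1 0 + 3) :
    ∃ s, Det prologue (initial w input) s 9 ∧ Rep B s (inputState input) := by
  have h1W := hB.one_lt
  have hdet := (det_const (initial w input) 2 1).seq ((det_load _ 0 2).seq ((det_op _ .add 0 0 0).seq
    ((det_const _ 2 3).seq (det_op _ .add 0 0 2))))
  refine ⟨_, hdet, ?_, ?_, fun _ => by simp only [inputState]; omega, ?_, ?_⟩
  · have h1 : (BitVec.ofNat w 1).toNat = 1 := by
      rw [BitVec.toNat_ofNat, Nat.mod_eq_of_lt (by rw [← hB.W]; exact h1W)]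
    simp only [State.setReg, initial, BinOp.eval, Function.update_self, Function.update_of_ne,
      ne_eq, OfNat.ofNat_ne_zero, OfNat.zero_ne_ofNat, not_false_eq_true, hm, two_mul, BitVec.ofNat_add]
    rw [h1]
  · intro x
    have h0 : rv x ≠ 0 := by unfold rv; omega
    have h2 : rv x ≠ 2 := by unfold rv; omega
    simp [State.setReg, initial, Function.update_of_ne, h0, h2, inputState]
  · intro j i hj
    have h1 := adr_lt hB hj
    simp only [State.setReg, initial, BitVec.toNat_ofNat, inputState]
    rw [Nat.mod_eq_of_lt (by rw [← hB.W]; exact h1)]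
    unfold adr
    split_ifs with h
    · rfl
    · have := Nat.le_mul_of_pos_right (i + B.N) stride_pos
      rw [List.getD_eq_default _ _ (by omega)]
  · intro j i _
    simp only [inputState]
    split_ifs
    · exact hlt i
    · omega

/-- The algorithm. -/
noncomputable def mainProgram (d : ℕ) : Program :=
  .seq prologue (.seq (prepare d).compile (.seq randomRounds output.compile))

theorem mainProgram_spec (hB : B.Fits w) (hs : Sizes B n m k d) {input : List ℕ}
    (hlen : input.length = B.N) (hlt : ∀ i, input.getD i 0 < B.W) (h0 : input.getD 0 0 = n)
    (h1 : input.getD 1 0 = m) (h2 : input.getD 2 0 = k)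
    (hgood : ∀ S, InputSlots (fun i => input.getD i 0) m S → S.Good n) {good : State w → Prop}
    (H : ∀ S A h s est, InputSlots (fun i => input.getD i 0) m S → S.Good n → Params n m k A h →
      EstSound S.graph n (4 * n + 1) est → (∀ v < n, LocalDone S A h v est) → Covered S A n est →
      (∀ v < n, s.mem (BitVec.ofNat w v) =
        BitVec.ofNat w (if est v < 4 * n + 1 then est v else 0)) → good s) :
    ∃ A h J, Params n m k A h ∧ 2 ^ (J - 1) < n ∧ 1 ≤ J ∧
      1 ≤ haltProb good (20 + ((prepare d).slow * ((J + 1) * (m * 300 +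
          n * ((A + 1) * (levels A h + 1)) * 2100)) +
        (4 * m * (d + 3) * J / A + 1) *
          (globalRound.slow * ((2 * m + 1) * (J + 1) * 400 + 10) + 3) +
        output.slow * (n * 4 + 3))) ([mainProgram d], initial w input) + ((n : ℝ≥0∞) ^ d)⁻¹ := by
  have hm1 : 1 ≤ m := by have := hs.two_le; have := hs.n_le; omega
  have hN := hs.N
  have hnN : n ≤ B.N := by have := hs.n_le; omega
  have hNW : B.N ≤ B.W := by have := hs.cap_le; omega
  obtain ⟨s₁, hd₁, hR₁⟩ := prologue_spec hB hlen hlt (by rw [h1]; exact hN)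
  have elow : (inputState input).a .low = fun i => input.getD i 0 := by
    funext i; simp [inputState]
  obtain ⟨σ₂, hr₂, S, J, A, h, hI, hG, hJ1, hJ2, hJ3, hP, hR, hE, hL, hT, hst, ht⟩ :=
    prepare_spec (σ := inputState input) hs (by rw [elow]; exact h0) (by rw [elow]; exact h1)
      (by rw [elow]; exact h2) (fun _ => rfl) (fun j hj i => by simp [inputState, hj])
      (by rw [elow]; exact hgood)
  rw [elow] at hI
  refine ⟨A, h, J, hP, hJ2, hJ3, ?_⟩
  obtain ⟨s₂, t₂, hd₂, hrep₂, hk₂⟩ := hr₂.compile_spec hB hR₁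
  have ht₂ : t₂ ≤ (prepare d).slow * ((J + 1) * (m * 300 +
      n * ((A + 1) * (levels A h + 1)) * 2100)) := by
    have h3 := hk₂ _ le_rfl
    have h4 : (inputState input).t = 0 := rfl
    rw [h4, zero_add] at ht
    rw [h4] at h3
    have := Nat.mul_le_mul_left (prepare d).slow ht
    omega
  have hloop := one_le_haltProb_randomRounds (good := good) (m := m) (t₀ := output.slow * (n * 4 + 3))
    (K := [output.compile]) hB hrep₂ hm1 hI.cnt hR hE hL hT (by rw [← hT]; exact hst) (by
      intro s σ hrep hR' hE' hL' hC'
      have hlt' : ∀ v < n, σ.a .est v < B.W := fun v hv =>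
        hrep.a_lt .est v (by have := hR'.n_lt; simp [Bounds.inRange]; omega)
      obtain ⟨σ₃, hr₃, hout, ht₃⟩ := output_spec (B := B) hR' hnN hNW hlt'
      obtain ⟨s₃, t₃, hd₃, hrep₃, hk₃⟩ := hr₃.compile_spec hB hrep
      have ht₃' : t₃ ≤ output.slow * (n * 4 + 3) := by
        have h3 := hk₃ _ le_rfl
        have := Nat.mul_le_mul_left output.slow ht₃
        rw [mul_add] at this
        omega
      have hgd : good s₃ := H S A h s₃ _ hI hG hP hE' hL' hC' fun v hv => by
        have := hrep₃.a .low v (by simp [Bounds.inRange]; omega)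
        rw [adr, if_pos rfl] at this
        rw [this, hout v hv]
      refine ((haltProb_nil hgd 0).trans (hd₃.haltProb_le [] 0)).trans (haltProb_mono (by omega) _))
  -- Needed so that `1 - A / (4m)` is nonnegative; in the second alternative `A² ≤ n A ^ k ≤ m²`.
  have hA4 : A ≤ 4 * m := by
    rcases hP with ⟨-, rfl, -⟩ | ⟨g1, g2, -⟩
    · omega
    · have e1 : A * A ≤ A ^ k := by
        rw [← sq]; exact Nat.pow_le_pow_right (by omega) hs.two_le_k
      have e2 : A ^ k ≤ n * A ^ k := Nat.le_mul_of_pos_left _ (by have := hs.two_le; omega)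
      have := Nat.mul_self_le_mul_self_iff.1 ((e1.trans e2).trans g2)
      omega
  have hU := union_bound (n := n) (m := m) (A := A) (d := d) (J := J) (N := n * n)
    (by have := hs.two_le; omega) hm1 (by have := hP.two_le hm1; omega) hA4 hJ1 le_rfl
  refine hloop.trans (add_le_add ?_ hU)
  set T := (4 * m * (d + 3) * J / A + 1) *
    (globalRound.slow * ((2 * m + 1) * (J + 1) * 400 + 10) + 3) + (1 + output.slow * (n * 4 + 3))
    with hTdef
  have e1 : haltProb good T (randomRounds :: [output.compile], s₂) ≤
      haltProb good (T + 1) ([.seq randomRounds output.compile], s₂) := (haltProb_seq _ _ _ _ _).ge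
  have e2 := hd₂.haltProb_le (good := good) [.seq randomRounds output.compile] (T + 1)
  have e3 := (haltProb_seq (good := good) (prepare d).compile (.seq randomRounds output.compile) [] s₁
    (t₂ + (T + 1))).ge
  have e4 := hd₁.haltProb_le (good := good)
    [.seq (prepare d).compile (.seq randomRounds output.compile)] (t₂ + (T + 1) + 1)
  have e5 := (haltProb_seq (good := good) prologue
    (.seq (prepare d).compile (.seq randomRounds output.compile)) [] (initial w input)
    (9 + (t₂ + (T + 1) + 1))).ge
  refine (e1.trans (e2.trans (e3.trans (e4.trans e5)))).trans (haltProb_mono ?_ _)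
  omega

end WordRAM.HL

namespace ANSC

open WordRAM.HL

/-! ### The input and the output -/

theorem getD_flatMap_pair {α : Type*} (f g : α → ℕ) (es : List α) (i : ℕ) (hi : i < es.length) :
    (es.flatMap fun e => [f e, g e]).getD (2 * i) 0 = f es[i] ∧
      (es.flatMap fun e => [f e, g e]).getD (2 * i + 1) 0 = g es[i] := by
  induction es generalizing i with
  | nil => simp at hi
  | cons e es ih =>
    rw [List.flatMap_cons]
    cases i with
    | zero => simp
    | succ i => simpa [mul_add] using ih i (by simpa using hi)

section

variable {n k m : ℕ} {es : List (Fin n × Fin n)}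

theorem length_input : (input n k es).length = 2 * es.length + 3 := by
  have : (es.flatMap fun e => [(e.1 : ℕ), (e.2 : ℕ)]).length = 2 * es.length := by
    induction es with
    | nil => rfl
    | cons e es ih => simp [List.flatMap_cons] at ih ⊢; omega
  simp [input, this, add_assoc]

theorem getD_input {i : ℕ} (hi : i < es.length) :
    (input n k es).getD (2 * i + 3) 0 = es[i].1 ∧ (input n k es).getD (2 * i + 4) 0 = es[i].2 := by
  simpa [input] using getD_flatMap_pair (fun e : Fin n × Fin n => (e.1 : ℕ)) (fun e => (e.2 : ℕ)) es i hi

theorem getD_input_lt {W : ℕ} (hn : n < W) (hm : es.length < W) (hk : k < W) (i : ℕ) :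
    (input n k es).getD i 0 < W := by
  have hmem : ∀ x ∈ input n k es, x < W := by
    intro x hx
    simp only [input, List.cons_append, List.nil_append, List.mem_cons, List.mem_flatMap,
      List.not_mem_nil, or_false] at hx
    rcases hx with rfl | rfl | rfl | ⟨e, -, rfl | rfl⟩
    exacts [hn, hm, hk, e.1.isLt.trans hn, e.2.isLt.trans hn]
  rcases Nat.lt_or_ge i (input n k es).length with h | h
  · rw [List.getD_eq_getElem _ _ h]; exact hmem _ (List.getElem_mem h)
  · rw [List.getD_eq_default _ _ h]; omega

variable {G : SimpleGraph (Fin n)}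

theorem IsEdgeList.length_eq (hes : IsEdgeList G es) : es.length = G.edgeSet.ncard := by
  classical
  have h1 : G.edgeSet = ((es.map fun e => s(e.1, e.2)).toFinset : Set (Sym2 (Fin n))) := by
    ext e
    rw [List.coe_toFinset]
    exact (hes.2 e).symm
  rw [h1, Set.ncard_coe_finset, List.toFinset_card_of_nodup hes.1, List.length_map]

theorem IsEdgeList.adj (hes : IsEdgeList G es) {i : ℕ} (hi : i < es.length) :
    G.Adj es[i].1 es[i].2 := by
  have := (hes.2 s(es[i].1, es[i].2)).1 (List.mem_map_of_mem (List.getElem_mem hi))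
  simpa using this

variable {S : Slots}

theorem _root_.WordRAM.HL.InputSlots.exists_edge (hes : IsEdgeList G es)
    (hI : InputSlots (fun i => (input n k es).getD i 0) es.length S) {q : ℕ} (hq : S.Mem q) :
    ∃ u v : Fin n, G.Adj u v ∧ S.src q = u ∧ S.tgt q = v ∧
      ∃ q', S.Mem q' ∧ S.src q' = v ∧ S.tgt q' = u := by
  obtain ⟨h1, h2⟩ := hq
  rw [hI.cnt] at h2
  have hc := hI.cnt
  rcases Nat.even_or_odd' q with ⟨i, rfl | rfl⟩
  · obtain ⟨i, rfl⟩ : ∃ i', i = i' + 1 := ⟨i - 1, by omega⟩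
    have hi : i < es.length := by omega
    obtain ⟨g1, g2⟩ := getD_input (k := k) hi
    refine ⟨es[i].2, es[i].1, (hes.adj hi).symm, ?_, ?_, 2 * i + 1, ⟨by omega, by omega⟩, ?_, ?_⟩
    · rw [mul_add, mul_one, hI.src_even i hi, g2]
    · rw [mul_add, mul_one, hI.tgt_even i hi, g1]
    · rw [hI.src_odd i hi, g1]
    · rw [hI.tgt_odd i hi, g2]
  · have hi : i < es.length := by omega
    obtain ⟨g1, g2⟩ := getD_input (k := k) hi
    refine ⟨es[i].1, es[i].2, hes.adj hi, ?_, ?_, 2 * i + 2, ⟨by omega, by omega⟩, ?_, ?_⟩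
    · rw [hI.src_odd i hi, g1]
    · rw [hI.tgt_odd i hi, g2]
    · rw [hI.src_even i hi, g2]
    · rw [hI.tgt_even i hi, g1]

theorem _root_.WordRAM.HL.InputSlots.good (hes : IsEdgeList G es)
    (hI : InputSlots (fun i => (input n k es).getD i 0) es.length S) : S.Good n := by
  constructor
  · intro q hq
    obtain ⟨u, v, -, h1, -⟩ := hI.exists_edge hes hq
    rw [h1]; exact u.isLt
  · intro q hq
    obtain ⟨u, v, h0, h1, h2, -⟩ := hI.exists_edge hes hq
    rw [h1, h2]
    exact fun h => h0.ne (Fin.ext h)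
  · intro q hq
    obtain ⟨u, v, h0, h1, h2, h3⟩ := hI.exists_edge hes hq
    rw [h1, h2]; exact h3

theorem _root_.WordRAM.HL.InputSlots.adj_iff (hes : IsEdgeList G es)
    (hI : InputSlots (fun i => (input n k es).getD i 0) es.length S) {a b : ℕ} :
    S.graph.Adj a b ↔ ∃ u v : Fin n, G.Adj u v ∧ a = u ∧ b = v := by
  rw [(InputSlots.good hes hI).adj_iff]
  constructor
  · rintro ⟨q, hq, rfl, rfl⟩
    obtain ⟨u, v, h0, h1, h2, -⟩ := hI.exists_edge hes hq
    exact ⟨u, v, h0, h1, h2⟩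
  · rintro ⟨u, v, h, rfl, rfl⟩
    have h1 := (hes.2 s(u, v)).2 h
    rw [List.mem_map] at h1
    obtain ⟨e, he, h2⟩ := h1
    obtain ⟨i, hi, rfl⟩ := List.getElem_of_mem he
    obtain ⟨g1, g2⟩ := getD_input (k := k) hi
    have hc := hI.cnt
    rcases Sym2.eq_iff.1 h2 with ⟨rfl, rfl⟩ | ⟨rfl, rfl⟩
    · exact ⟨2 * i + 1, ⟨by omega, by omega⟩, (hI.src_odd i hi).trans g1, (hI.tgt_odd i hi).trans g2⟩
    · exact ⟨2 * i + 2, ⟨by omega, by omega⟩, (hI.src_even i hi).trans g2,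
        (hI.tgt_even i hi).trans g1⟩

end

section

variable {n : ℕ} {G : SimpleGraph (Fin n)} {H : SimpleGraph ℕ}
  (hGH : ∀ {a b : ℕ}, H.Adj a b ↔ ∃ u v : Fin n, G.Adj u v ∧ a = u ∧ b = v)
include hGH

/-- The inclusion of a graph on `0, …, n - 1` into its extension by isolated vertices. -/
def valHom : G →g H where
  toFun := Fin.val
  map_rel' {u v} h := hGH.2 ⟨u, v, h, rfl, rfl⟩

theorem exists_map_valHom {a b : ℕ} (p : H.Walk a b) (ha : a < n) :
    ∃ (hb : b < n) (q : G.Walk ⟨a, ha⟩ ⟨b, hb⟩), q.map (valHom hGH) = p := by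
  induction p with
  | nil => exact ⟨ha, .nil, rfl⟩
  | cons h p ih =>
    obtain ⟨u, v, h1, rfl, rfl⟩ := hGH.1 h
    obtain ⟨hb, q, hq⟩ := ih v.isLt
    exact ⟨hb, .cons h1 q, by subst hq; rfl⟩

theorem exists_cycle_of_cycleLe {v : Fin n} {ℓ : ℕ} (h : CycleLe H v ℓ) :
    ∃ p : G.Walk v v, p.IsCycle ∧ p.length ≤ ℓ := by
  obtain ⟨p, h1, h2⟩ := h
  obtain ⟨hb, q, rfl⟩ := exists_map_valHom hGH p v.isLt
  exact ⟨q, SimpleGraph.Walk.IsCycle.of_map h1, (SimpleGraph.Walk.length_map _ q).symm.trans_le h2⟩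

end

theorem length_le_card {n : ℕ} {G : SimpleGraph (Fin n)} {v : Fin n} {p : G.Walk v v} (hp : p.IsCycle) :
    p.length ≤ n := by
  have h1 := hp.isPath_tail.length_lt
  have h2 := SimpleGraph.Walk.length_tail_add_one hp.not_nil
  rw [Fintype.card_fin] at h1
  omega

theorem shortestCycle_le {V : Type*} {G : SimpleGraph V} {v : V} {p : G.Walk v v} (hp : p.IsCycle) :
    shortestCycle G v ≤ p.length := iInf₂_le p hp

/-- A finite infimum of natural numbers is attained. -/
theorem exists_length_eq_of_shortestCycle_eq {V : Type*} {G : SimpleGraph V} {v : V} {ℓ : ℕ}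
    (h : shortestCycle G v = ℓ) : ∃ p : G.Walk v v, p.IsCycle ∧ p.length = ℓ := by
  have h1 : shortestCycle G v < ((ℓ + 1 : ℕ) : ℕ∞) := by
    rw [h]; exact_mod_cast Nat.lt_succ_self ℓ
  simp only [shortestCycle, iInf_lt_iff] at h1
  obtain ⟨p, hp, hlt⟩ := h1
  have h2 := shortestCycle_le hp
  rw [h] at h2
  have h3 : p.length < ℓ + 1 := by exact_mod_cast hlt
  have h4 : ℓ ≤ p.length := by exact_mod_cast h2
  exact ⟨p, hp, by omega⟩

theorem not_dense_of_cnt_lt {S : Slots} {A x r : ℕ} (h : S.cnt < A) : ¬ Dense S A x r := by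
  rintro ⟨U, h1, h2⟩
  have h3 : U ⊆ Finset.Icc 1 S.cnt := fun q hq => Finset.mem_Icc.2 (h2 q hq).1
  have h4 := Finset.card_le_card h3
  rw [Nat.card_Icc] at h4
  omega

/-- With `ρ` the ceiling, the first bound lets `k - 1` generations of reach `ρ` cover half of the
cycle; the second keeps the radius `ρ - 1` below `n`, among the sampled targets. -/
theorem le_mul_ceil {k : ℕ} (hk : 2 ≤ k) (ℓ : ℕ) :
    ℓ ≤ 2 * (k - 1) * ⌈(ℓ : ℝ) / (2 * ((k : ℝ) - 1))⌉₊ ∧ ⌈(ℓ : ℝ) / (2 * ((k : ℝ) - 1))⌉₊ ≤ ℓ := by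
  obtain ⟨k, rfl⟩ : ∃ k', k = k' + 1 := ⟨k - 1, by omega⟩
  have hk' : (1 : ℝ) ≤ k := by exact_mod_cast (by omega : 1 ≤ k)
  rw [Nat.add_sub_cancel]
  push_cast
  rw [add_sub_cancel_right]
  constructor
  · have h1 := Nat.le_ceil ((ℓ : ℝ) / (2 * k))
    rw [div_le_iff₀ (by positivity)] at h1
    have h2 : (ℓ : ℝ) ≤ ((2 * k * ⌈(ℓ : ℝ) / (2 * k)⌉₊ : ℕ) : ℝ) := by
      push_cast; linarith
    exact_mod_cast h2
  · refine Nat.ceil_le.2 (div_le_self (Nat.cast_nonneg ℓ) (by linarith))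

/-- The estimates that the algorithm computes are good. -/
theorem est_le_of_cycle {n m k A h : ℕ} {G : SimpleGraph (Fin n)} {S : Slots} {est : ℕ → ℕ}
    (hGH : ∀ {a b : ℕ}, S.graph.Adj a b ↔ ∃ u v : Fin n, G.Adj u v ∧ a = u ∧ b = v)
    (hcnt : S.cnt = 2 * m) (hP : Params n m k A h) (hloc : ∀ v < n, LocalDone S A h v est)
    (hcov : Covered S A n est) {v : Fin n} {p : G.Walk v v} (hp : p.IsCycle) {ρ : ℕ}
    (hρ : p.length ≤ 2 * (k - 1) * ρ) (hρ' : ρ ≤ p.length) : est v ≤ p.length + 2 * ρ := by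
  have h3 := hp.three_le_length
  have hn := length_le_card hp
  set q : S.graph.Walk v v := p.map (valHom hGH) with hq
  have hql : q.length = p.length := SimpleGraph.Walk.length_map _ p
  have hqc : q.IsCycle := SimpleGraph.Walk.IsCycle.map (fun a b hab => Fin.ext hab) hp
  rcases hP with ⟨-, h1, h2⟩ | ⟨-, -, -, h2⟩
  -- With more than `2m` slots required nothing is dense, so the radius can be taken as long as the
  -- cycle and one generation suffices.
  · refine (hloc v v.isLt p.length q (by omega) hqc (by rw [hql, h2]; omega)
      fun x _ => not_dense_of_cnt_lt (by omega)).trans (by omega)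
  · have hρ1 : 1 ≤ ρ := by
      by_contra hcon
      obtain rfl : ρ = 0 := by omega
      omega
    -- A dense vertex on the cycle costs `2 (ρ - 1)` by sampling; without one the estimate is exact.
    by_cases hd : ∃ x ∈ q.support, Dense S A x (ρ - 1)
    · obtain ⟨x, hx, hD⟩ := hd
      have hxn : x < n := by
        obtain ⟨hb, -⟩ := exists_map_valHom hGH (q.takeUntil x hx) v.isLt
        exact hb
      have := hcov x hxn (ρ - 1) (by omega) hD v q hqc hx
      omega
    · push Not at hd
      exact (hloc v v.isLt ρ q hρ1 hqc (by rw [hql, h2]; exact hρ) hd).trans (by omega)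

/-- A finite estimate comes from an actual cycle, which gives the lower bound; the upper bound is
`est_le_of_cycle`. -/
theorem isApprox_estimate {n m k A h w : ℕ} {G : SimpleGraph (Fin n)} {S : Slots} {est : ℕ → ℕ}
    {s : WordRAM.State w}
    (hGH : ∀ {a b : ℕ}, S.graph.Adj a b ↔ ∃ u v : Fin n, G.Adj u v ∧ a = u ∧ b = v)
    (hcnt : S.cnt = 2 * m) (hk : 2 ≤ k) (hP : Params n m k A h)
    (hsound : EstSound S.graph n (4 * n + 1) est) (hloc : ∀ v < n, LocalDone S A h v est)
    (hcov : Covered S A n est) (hw : 4 * n + 1 < 2 ^ w)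
    (hout : ∀ v < n, s.mem (BitVec.ofNat w v) =
      BitVec.ofNat w (if est v < 4 * n + 1 then est v else 0)) : IsApprox G k (estimate s) := by
  intro v
  by_cases hlt : est v < 4 * n + 1
  · obtain ⟨p, hp, hpl⟩ := exists_cycle_of_cycleLe hGH (hsound v v.isLt hlt)
    have h3 := hp.three_le_length
    have hest : estimate s v = (est v : ℕ∞) := by
      have h1 := hout v v.isLt
      rw [if_pos hlt] at h1
      have h2 : (BitVec.ofNat w (est v)).toNat = est v := by
        rw [BitVec.toNat_ofNat, Nat.mod_eq_of_lt (by omega)]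
      rw [estimate, h1, if_neg, h2]
      -- A finite estimate is at least 3, so it is not confused with the code 0 for infinity.
      intro h0
      rw [h0] at h2
      simp at h2
      omega
    rw [hest]
    refine ⟨(shortestCycle_le hp).trans (by exact_mod_cast hpl), fun ℓ hℓ => ?_⟩
    obtain ⟨q, hq, rfl⟩ := exists_length_eq_of_shortestCycle_eq hℓ
    obtain ⟨h1, h2⟩ := le_mul_ceil hk q.length
    exact_mod_cast est_le_of_cycle hGH hcnt hP hloc hcov hq h1 h2
  · have hest : estimate s v = ⊤ := by
      rw [estimate, hout v v.isLt, if_neg hlt]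
      exact if_pos rfl
    rw [hest]
    refine ⟨le_top, fun ℓ hℓ => ?_⟩
    obtain ⟨q, hq, rfl⟩ := exists_length_eq_of_shortestCycle_eq hℓ
    obtain ⟨h1, h2⟩ := le_mul_ceil hk q.length
    -- A cycle through `v` would force the estimate to be at most `3n`, below `inf`.
    have := est_le_of_cycle hGH hcnt hP hloc hcov hq h1 h2
    have := length_le_card hq
    omega

end ANSC

namespace ANSC

open WordRAM WordRAM.HL

/-! ### The running time -/

/-- The running time up to polylogarithmic factors. -/
noncomputable def timeBound (n m k : ℕ) : ℝ :=
  (m : ℝ) ^ (2 - 2 / (k : ℝ)) * (n : ℝ) ^ (1 / (k : ℝ))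

section

variable {n m k A h : ℕ}

/-- Since `k ≥ 2`, the exponent of `m` is at least 1; so linear terms are within the budget. -/
theorem le_timeBound (hn : 1 ≤ n) (hm : 1 ≤ m) (hk : 2 ≤ k) : (m : ℝ) ≤ timeBound n m k := by
  have hn' : (1 : ℝ) ≤ n := by exact_mod_cast hn
  have hm' : (1 : ℝ) ≤ m := by exact_mod_cast hm
  have hk' : (2 : ℝ) ≤ k := by exact_mod_cast hk
  have h1 : 2 / (k : ℝ) ≤ 1 := (div_le_one (by linarith)).2 hk'
  calc (m : ℝ) = (m : ℝ) ^ (1 : ℝ) * 1 := by rw [Real.rpow_one, mul_one]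
    _ ≤ (m : ℝ) ^ (2 - 2 / (k : ℝ)) * (n : ℝ) ^ (1 / (k : ℝ)) := by
        refine mul_le_mul (Real.rpow_le_rpow_of_exponent_le hm' (by linarith))
          (Real.one_le_rpow hn' (by positivity)) zero_le_one (by positivity)

/-- Write `m² = m^(2-2/k) (m²)^(1/k)` and take the `k`-th root of the hypothesis in the second
factor. -/
theorem sq_le_timeBound_mul {β : ℕ} (hm : 1 ≤ m) (hk : 2 ≤ k) (h : m * m < n * β ^ k) :
    (m : ℝ) * m ≤ timeBound n m k * β := by
  have hm' : (0 : ℝ) < m := by exact_mod_cast hm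
  have hk' : (0 : ℝ) < k := by exact_mod_cast (by omega : 0 < k)
  have h1 : (m : ℝ) * m ≤ n * (β : ℝ) ^ k := by exact_mod_cast h.le
  have h2 : ((m : ℝ) * m) ^ (1 / (k : ℝ)) ≤ (n : ℝ) ^ (1 / (k : ℝ)) * β := by
    calc ((m : ℝ) * m) ^ (1 / (k : ℝ)) ≤ ((n : ℝ) * (β : ℝ) ^ k) ^ (1 / (k : ℝ)) :=
          Real.rpow_le_rpow (by positivity) h1 (by positivity)
      _ = (n : ℝ) ^ (1 / (k : ℝ)) * β := by
          rw [Real.mul_rpow (by positivity) (by positivity), one_div,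
            Real.pow_rpow_inv_natCast (by positivity) (by omega)]
  calc (m : ℝ) * m = (m : ℝ) ^ (2 - 2 / (k : ℝ)) * ((m : ℝ) * m) ^ (1 / (k : ℝ)) := by
        rw [← sq, ← Real.rpow_natCast, ← Real.rpow_mul hm'.le, ← Real.rpow_add hm']
        congr 1
        push_cast
        field_simp
        ring
    _ ≤ (m : ℝ) ^ (2 - 2 / (k : ℝ)) * ((n : ℝ) ^ (1 / (k : ℝ)) * β) :=
        mul_le_mul_of_nonneg_left h2 (by positivity)
    _ = timeBound n m k * β := by rw [timeBound]; ring

/-- Take `β = 2` in the first alternative and `β = A + 1 ≤ 2 A` in the second. -/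
theorem Params.sq_le (hP : Params n m k A h) (hn : 1 ≤ n) (hm : 1 ≤ m) (hk : 2 ≤ k) :
    (m : ℝ) * m ≤ 2 * timeBound n m k * A := by
  have hX := (Nat.cast_nonneg m).trans (le_timeBound hn hm hk)
  have hA : (2 : ℝ) ≤ A := by exact_mod_cast hP.two_le hm
  rcases hP with ⟨h1, -, -⟩ | ⟨-, -, h1, -⟩
  · have := sq_le_timeBound_mul hm hk h1
    push_cast at this
    nlinarith
  · have := sq_le_timeBound_mul hm hk h1
    push_cast at this
    nlinarith

/-- The cost of the explorations: in the second alternative it is at most `8 m² / A`, by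
`mul_levels` and `sq_le`; in the first it is of order `n m`, hence of order `m²`, which `β = 2`
already puts within the budget. -/
theorem Params.levels_le_timeBound (hP : Params n m k A h) (hn : 1 ≤ n) (hm : 1 ≤ m) (hk : 2 ≤ k)
    (hnm : n ≤ 2 * m) : ((n * ((A + 1) * (levels A h + 1)) : ℕ) : ℝ) ≤ 32 * timeBound n m k := by
  have hA2 := hP.two_le hm
  have hL := one_le_levels (A := A) (hP.h_pos hk)
  have hA' : (0 : ℝ) < A := by exact_mod_cast (by omega : 0 < A)
  by_cases hnaive : m * m < n * 2 ^ k ∧ A = 2 * m + 1 ∧ h = 1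
  · obtain ⟨h1, rfl, rfl⟩ := hnaive
    have h2 := sq_le_timeBound_mul hm hk h1
    have h3 : n * ((2 * m + 1 + 1) * (levels (2 * m + 1) 1 + 1)) ≤ 16 * (m * m) := by
      have : levels (2 * m + 1) 1 = 1 := by simp [levels]
      rw [this]
      calc n * ((2 * m + 1 + 1) * (1 + 1)) ≤ (2 * m) * ((2 * m + 2 * m) * 2) :=
          Nat.mul_le_mul hnm (Nat.mul_le_mul_right 2 (by omega))
        _ = 16 * (m * m) := by ring
    have h4 : ((n * ((2 * m + 1 + 1) * (levels (2 * m + 1) 1 + 1)) : ℕ) : ℝ) ≤ 16 * (m * m) := by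
      exact_mod_cast h3
    push_cast at h2 h4 ⊢
    linarith
  · have h5 := hP.sq_le hn hm hk
    have hML : n * (A * (A * levels A h)) ≤ 2 * (m * m) := by
      rcases hP with hP | ⟨h1, h2, h3, rfl⟩
      · exact absurd hP hnaive
      · rcases Params.mul_levels (n := n) (m := m) (.inr ⟨h1, h2, h3, rfl⟩) hk with ⟨rfl, h4⟩ | h4
        -- The value `A = 2m + 1` contradicts `A² ≤ n A ^ k ≤ m²`.
        · exfalso
          have e1 : (2 * m + 1) * (2 * m + 1) ≤ (2 * m + 1) ^ k := by
            rw [← sq]; exact Nat.pow_le_pow_right (by omega) hk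
          have e2 : (2 * m + 1) ^ k ≤ n * (2 * m + 1) ^ k := Nat.le_mul_of_pos_left _ (by omega)
          nlinarith
        · exact h4
    have h6 : (A + 1) * (levels A h + 1) ≤ (2 * A) * (2 * levels A h) :=
      Nat.mul_le_mul (by omega) (by omega)
    have h7 : n * ((A + 1) * (levels A h + 1)) * A ≤ 8 * (m * m) := by
      calc n * ((A + 1) * (levels A h + 1)) * A ≤ n * ((2 * A) * (2 * levels A h)) * A := by gcongr
        _ = 4 * (n * (A * (A * levels A h))) := by ring
        _ ≤ 4 * (2 * (m * m)) := Nat.mul_le_mul_left _ hML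
        _ = 8 * (m * m) := by ring
    have h8 : ((n * ((A + 1) * (levels A h + 1)) : ℕ) : ℝ) * A ≤ 8 * (m * m) := by
      exact_mod_cast h7
    refine (le_of_mul_le_mul_right (?_ : _ ≤ 16 * timeBound n m k * A) hA').trans ?_
    · linarith
    · have := (Nat.cast_nonneg m).trans (le_timeBound hn hm hk)
      linarith

/-- The cost of the random searches: about `4 m (d + 3) J / A` rounds of cost `m`, so of order `J m²
/ A`. The extra `+ 1` round is absorbed by `le_timeBound`. -/
theorem rounds_mul_le (hP : Params n m k A h) (hn : 1 ≤ n) (hm : 1 ≤ m) (hk : 2 ≤ k) {J : ℕ}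
    (hJ : 1 ≤ J) (d : ℕ) : ((4 * m * (d + 3) * J / A + 1 : ℕ) : ℝ) * m ≤
      9 * (d + 3) * (J * timeBound n m k) := by
  have hA' : (0 : ℝ) < A := by exact_mod_cast (by have := hP.two_le hm; omega : 0 < A)
  have hJ' : (1 : ℝ) ≤ J := by exact_mod_cast hJ
  have hX := le_timeBound hn hm hk
  have hX0 := (Nat.cast_nonneg m).trans hX
  have hd : (0 : ℝ) ≤ d := Nat.cast_nonneg d
  have h1 : ((4 * m * (d + 3) * J / A : ℕ) : ℝ) ≤ 4 * m * (d + 3) * J / A := by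
    refine Nat.cast_div_le.trans (le_of_eq ?_)
    push_cast; ring
  have h2 : (4 * m * (d + 3) * J / A : ℝ) * m ≤ 8 * (d + 3) * (J * timeBound n m k) := by
    rw [div_mul_eq_mul_div, div_le_iff₀ hA']
    calc (4 * m * (d + 3) * J * m : ℝ) = 4 * (d + 3) * J * (m * m) := by ring
      _ ≤ 4 * (d + 3) * J * (2 * timeBound n m k * A) :=
          mul_le_mul_of_nonneg_left (hP.sq_le hn hm hk) (by positivity)
      _ = 8 * (d + 3) * (J * timeBound n m k) * A := by ring
  have h3 : (m : ℝ) ≤ J * timeBound n m k := hX.trans (le_mul_of_one_le_left hX0 hJ')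
  have h4 : J * timeBound n m k ≤ (d + 3) * (J * timeBound n m k) :=
    le_mul_of_one_le_left (by positivity) (by linarith)
  have h5 := mul_le_mul_of_nonneg_right h1 (Nat.cast_nonneg (α := ℝ) m)
  push_cast at h5 ⊢
  rw [add_mul, one_mul]
  linarith

theorem le_four_mul_log {J : ℕ} (hn : 2 ≤ n) (hJ : 2 ^ (J - 1) < n) (hJ1 : 1 ≤ J) :
    (J : ℝ) ≤ 4 * Real.log n := by
  obtain ⟨J, rfl⟩ : ∃ J', J = J' + 1 := ⟨J - 1, by omega⟩
  rw [Nat.add_sub_cancel] at hJ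
  have h1 : (2 : ℝ) ^ J ≤ n := by exact_mod_cast hJ.le
  have h2 := Real.log_le_log (by positivity) h1
  rw [Real.log_pow] at h2
  have h3 := Real.log_two_gt_d9
  have h4 : Real.log 2 ≤ Real.log n := Real.log_le_log (by norm_num) (by exact_mod_cast hn)
  have h5 : (J : ℝ) * (1 / 2) ≤ J * Real.log 2 :=
    mul_le_mul_of_nonneg_left (by linarith) (Nat.cast_nonneg J)
  push_cast
  linarith

/-- The running time of the algorithm. -/
theorem total_time_le (hP : Params n m k A h) (hn : 2 ≤ n) (hm : 1 ≤ m) (hk : 2 ≤ k)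
    (hnm : n ≤ 2 * m) {J : ℕ} (hJ : 2 ^ (J - 1) < n) (hJ1 : 1 ≤ J) (d κ₁ κ₂ κ₃ : ℕ) :
    20 + (κ₁ * ((J + 1) * (m * 300 + n * ((A + 1) * (levels A h + 1)) * 2100)) +
        (4 * m * (d + 3) * J / A + 1) * (κ₂ * ((2 * m + 1) * (J + 1) * 400 + 10) + 3) +
        κ₃ * (n * 4 + 3)) ≤
      ⌊(16 * (20 + 135000 * κ₁ + (2410 * κ₂ + 3) * (9 * (d + 3)) + 11 * κ₃) : ℝ) *
        Real.log n ^ 2 * timeBound n m k⌋₊ := by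
  have hn1 : 1 ≤ n := by omega
  set X := timeBound n m k with hX
  set E := n * ((A + 1) * (levels A h + 1)) with hE
  set T := 4 * m * (d + 3) * J / A + 1 with hT
  have hm' : (1 : ℝ) ≤ m := by exact_mod_cast hm
  have hJ' : (1 : ℝ) ≤ J := by exact_mod_cast hJ1
  have hmX : (m : ℝ) ≤ X := le_timeBound hn1 hm hk
  have hX1 : 1 ≤ X := hm'.trans hmX
  have hEX : (E : ℝ) ≤ 32 * X := hP.levels_le_timeBound hn1 hm hk hnm
  have hTX : (T : ℝ) * m ≤ 9 * (d + 3) * (J * X) := rounds_mul_le hP hn1 hm hk hJ1 d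
  have hnX : (n : ℝ) ≤ 2 * X := by
    have : (n : ℝ) ≤ 2 * m := by exact_mod_cast hnm
    linarith
  have hlog := le_four_mul_log hn hJ hJ1
  have hJJ : (J : ℝ) ≤ J * J := le_mul_of_one_le_left (by linarith) hJ'
  -- Two logarithms arise: one from the number of random rounds, one from the jump tables in each
  -- search.
  have hJ2 : (J : ℝ) * J ≤ 16 * Real.log n ^ 2 := by nlinarith
  have hJX : X ≤ J * J * X := le_mul_of_one_le_left (by linarith) (by linarith)
  have h1 : ((J : ℝ) + 1) * (m * 300 + E * 2100) ≤ 135000 * (J * J * X) := by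
    calc ((J : ℝ) + 1) * (m * 300 + E * 2100) ≤ (2 * (J * J)) * (67500 * X) :=
          mul_le_mul (by linarith) (by linarith) (by positivity) (by positivity)
      _ = 135000 * (J * J * X) := by ring
  have h2 : (κ₂ * ((2 * m + 1) * (J + 1) * 400 + 10) + 3 : ℝ) ≤ (2410 * κ₂ + 3) * (m * J) := by
    have e1 : (1 : ℝ) ≤ m * J := one_le_mul_of_one_le_of_one_le hm' hJ'
    have e2 : ((2 * m + 1) * (J + 1) : ℝ) ≤ (3 * m) * (2 * J) :=
      mul_le_mul (by linarith) (by linarith) (by positivity) (by positivity)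
    have e3 : ((2 * m + 1) * (J + 1) * 400 + 10 : ℝ) ≤ 2410 * (m * J) := by linarith
    have e4 := mul_le_mul_of_nonneg_left e3 (Nat.cast_nonneg (α := ℝ) κ₂)
    linarith
  have h3 : (T : ℝ) * (κ₂ * ((2 * m + 1) * (J + 1) * 400 + 10) + 3) ≤
      (2410 * κ₂ + 3) * (9 * (d + 3)) * (J * J * X) := by
    calc (T : ℝ) * (κ₂ * ((2 * m + 1) * (J + 1) * 400 + 10) + 3) ≤
          T * ((2410 * κ₂ + 3) * (m * J)) := mul_le_mul_of_nonneg_left h2 (Nat.cast_nonneg T)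
      _ = (2410 * κ₂ + 3) * J * (T * m) := by ring
      _ ≤ (2410 * κ₂ + 3) * J * (9 * (d + 3) * (J * X)) :=
          mul_le_mul_of_nonneg_left hTX (by positivity)
      _ = (2410 * κ₂ + 3) * (9 * (d + 3)) * (J * J * X) := by ring
  have h4 : (n * 4 + 3 : ℝ) ≤ 11 * (J * J * X) := by linarith
  have h5 := mul_le_mul_of_nonneg_left h1 (Nat.cast_nonneg (α := ℝ) κ₁)
  have h6 := mul_le_mul_of_nonneg_left h4 (Nat.cast_nonneg (α := ℝ) κ₃)
  refine Nat.le_floor ?_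
  calc ((20 + (κ₁ * ((J + 1) * (m * 300 + E * 2100)) +
        T * (κ₂ * ((2 * m + 1) * (J + 1) * 400 + 10) + 3) + κ₃ * (n * 4 + 3)) : ℕ) : ℝ) =
      20 + (κ₁ * ((J + 1) * (m * 300 + E * 2100)) +
        T * (κ₂ * ((2 * m + 1) * (J + 1) * 400 + 10) + 3) + κ₃ * (n * 4 + 3)) := by push_cast; ring
    _ ≤ (20 + 135000 * κ₁ + (2410 * κ₂ + 3) * (9 * (d + 3)) + 11 * κ₃) * (J * J * X) := by linarith
    _ ≤ (20 + 135000 * κ₁ + (2410 * κ₂ + 3) * (9 * (d + 3)) + 11 * κ₃) *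
          (16 * Real.log n ^ 2 * X) := by gcongr
    _ = _ := by ring

end

/-! ### The word length -/

/-- Sixteen arrays of capacity `n ^ 10` behind the input fit into `n ^ 15` words; the additional
exponent `d` leaves room for the constant `d + 3` in the number of rounds. -/
theorem sizes_of_pow_le {n m k d w : ℕ} (hn : 2 ≤ n) (hnm : n ≤ 2 * m) (hm : m < n * n) (hk : 2 ≤ k)
    (hw : n ^ (d + 15) ≤ 2 ^ w) (hkw : k < 2 ^ w) :
    (⟨2 ^ w, 2 * m + 3, n ^ 10⟩ : Bounds).Fits w ∧ Sizes ⟨2 ^ w, 2 * m + 3, n ^ 10⟩ n m k d := by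
  have hs : stride = 16 := by decide
  have hp : ∀ i, 1 ≤ n ^ i := fun i => Nat.one_le_pow _ _ (by omega)
  have hn4 : 16 ≤ n ^ 4 := Nat.pow_le_pow_left hn 4
  have h10 : 2 * m + 3 ≤ n ^ 10 := by
    have e1 : 4 * n ^ 2 ≤ n ^ 4 := by
      calc 4 * n ^ 2 = 2 ^ 2 * n ^ 2 := by norm_num
        _ ≤ n ^ 2 * n ^ 2 := Nat.mul_le_mul_right _ (Nat.pow_le_pow_left hn 2)
        _ = n ^ 4 := by ring
    have e2 : n ^ 4 ≤ n ^ 10 := Nat.pow_le_pow_right (by omega) (by omega)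
    have e3 : n ^ 2 = n * n := sq n
    omega
  have h15 : (n ^ 10 + (2 * m + 3)) * 16 ≤ 2 ^ w := by
    calc (n ^ 10 + (2 * m + 3)) * 16 ≤ (n ^ 10 + n ^ 10) * n ^ 4 :=
          Nat.mul_le_mul (by omega) hn4
      _ = 2 * n ^ 14 := by ring
      _ ≤ n * n ^ 14 := Nat.mul_le_mul_right _ hn
      _ = n ^ 15 := by ring
      _ ≤ n ^ (d + 15) := Nat.pow_le_pow_right (by omega) (by omega)
      _ ≤ 2 ^ w := hw
  have hd : 4 * m * (d + 3) * n + n ^ 10 < 2 ^ w := by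
    -- This is where the word length depends on `d`: even for `n = 2` the literal `d + 3` has to
    -- fit.
    have e1 : d + 3 < n ^ (d + 3) :=
      Nat.lt_two_pow_self.trans_le (Nat.pow_le_pow_left hn _)
    have e2 : 4 * m ≤ n ^ 4 := by
      calc 4 * m ≤ 2 ^ 2 * (n * n) := by omega
        _ ≤ n ^ 2 * (n * n) := Nat.mul_le_mul_right _ (Nat.pow_le_pow_left hn 2)
        _ = n ^ 4 := by ring
    have e3 : n ^ 10 ≤ n ^ (d + 10) := Nat.pow_le_pow_right (by omega) (by omega)
    calc 4 * m * (d + 3) * n + n ^ 10 ≤ n ^ 4 * n ^ (d + 3) * n + n ^ (d + 10) := by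
          gcongr
      _ = n ^ (d + 8) + n ^ (d + 10) := by ring
      _ ≤ n ^ (d + 10) + n ^ (d + 10) :=
          Nat.add_le_add_right (Nat.pow_le_pow_right (by omega) (by omega)) _
      _ = 2 * n ^ (d + 10) := by ring
      _ ≤ n * n ^ (d + 10) := Nat.mul_le_mul_right _ hn
      _ = n ^ (d + 11) := by ring
      _ < n ^ (d + 15) := Nat.pow_lt_pow_right (by omega) (by omega)
      _ ≤ 2 ^ w := hw
  have h1 := hp 10
  exact ⟨⟨rfl, by rw [hs]; exact h15, by change 1 < 2 ^ w; omega⟩,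
    ⟨hn, hnm, hm, hk, hkw, rfl, le_rfl, by change n ^ 10 + (2 * m + 3) ≤ 2 ^ w; omega, hd⟩⟩

end ANSC

/-! ### Assembly of correctness, success probability and running time -/

open ANSC WordRAM WordRAM.HL in
theorem successProb_mainProgram {d k n : ℕ} {G : SimpleGraph (Fin n)} {es : List (Fin n × Fin n)}
    {w : ℕ} (hk : 2 ≤ k) (hn : 0 < n) (hnm : n ≤ 2 * es.length) (hes : IsEdgeList G es)
    (hw : n ^ (d + 15) ≤ 2 ^ w) (hkw : k < 2 ^ w) :
    1 - ((n : ℝ≥0∞) ^ d)⁻¹ ≤ successProb (mainProgram d) w (input n k es)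
      ⌊(16 * (20 + 135000 * (prepare d).slow + (2410 * globalRound.slow + 3) * (9 * (d + 3)) +
        11 * output.slow) : ℝ) * Real.log n ^ 2 * timeBound n es.length k⌋₊
      (fun s => IsApprox G k (estimate s)) := by
  classical
  have hlen : es.length = G.edgeFinset.card := by
    rw [hes.length_eq, ← SimpleGraph.coe_edgeFinset, Set.ncard_coe_finset]
  have hchoose := G.card_edgeFinset_le_card_choose_two
  rw [← hlen, Fintype.card_fin, Nat.choose_two_right] at hchoose
  -- A graph with a single vertex has no edges, which contradicts `n ≤ 2m`.
  have hn2 : 2 ≤ n := by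
    by_contra hcon
    obtain rfl : n = 1 := by omega
    omega
  have hm : es.length < n * n := by
    have e1 : n * (n - 1) / 2 ≤ n * (n - 1) := Nat.div_le_self _ _
    have e2 : n * (n - 1) < n * n := Nat.mul_lt_mul_of_pos_left (by omega) hn
    omega
  have hm1 : 1 ≤ es.length := by omega
  obtain ⟨hB, hs⟩ := sizes_of_pow_le hn2 hnm hm hk hw hkw
  have hcap : n ^ 10 + (2 * es.length + 3) ≤ 2 ^ w := hs.cap_le
  have hpow := hs.pow_ge
  have hnn := hs.n_le'
  have hnn4 := hs.nn_le
  obtain ⟨A, h, J, hP, hJ, hJ1, hmain⟩ := mainProgram_spec hB hs (input := input n k es)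
    (good := fun s => IsApprox G k (estimate s)) length_input
    (getD_input_lt (by change n < 2 ^ w; omega) (by change es.length < 2 ^ w; omega) hkw) rfl rfl rfl
    (fun S hS => hS.good hes) (fun S A h s est hI _ hP hE hL hC hout =>
      isApprox_estimate (hI.adj_iff hes) hI.cnt hk hP hE hL hC (by omega) hout)
  rw [tsub_le_iff_right]
  refine hmain.trans (add_le_add_left ?_ _)
  exact haltProb_mono (total_time_le hP hn2 hm1 hk hnm hJ hJ1 d _ _ _) _

theorem mainTheorem11 (d : ℕ) :
    ∃ (P : WordRAM.Program) (a b : ℕ) (C : ℝ),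
      ∀ (k n m : ℕ) (G : SimpleGraph (Fin n)) (es : List (Fin n × Fin n)) (w : ℕ),
        2 ≤ k → 0 < n → m = G.edgeSet.ncard → n ≤ 2 * m → ANSC.IsEdgeList G es →
        n ^ a ≤ 2 ^ w → k < 2 ^ w →
        1 - ((n : ℝ≥0∞) ^ d)⁻¹ ≤
          WordRAM.successProb P w (ANSC.input n k es)
            ⌊C * Real.log n ^ b *
              ((m : ℝ) ^ (2 - 2 / (k : ℝ)) * (n : ℝ) ^ (1 / (k : ℝ)))⌋₊
            (fun s => ANSC.IsApprox G k (ANSC.estimate s)) := by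
  refine ⟨WordRAM.HL.mainProgram d, d + 15, 2, 16 * (20 + 135000 * (WordRAM.HL.prepare d).slow +
    (2410 * WordRAM.HL.globalRound.slow + 3) * (9 * (d + 3)) + 11 * WordRAM.HL.output.slow), fun k n m G es w hk hn hm hnm hes hw hkw => ?_⟩
  obtain rfl : es.length = m := hes.length_eq.trans hm.symm
  exact successProb_mainProgram hk hn hnm hes hw hkw
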